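/- Let $\alpha\in\mathbb R$, let $K_1,K_2:[0,1]\to\mathbb R$ be continuous with $K_1<0<K_2$ on $[0,1]$ and with distributional second derivatives in $L^2([0,1])$, and let $f,\sigma:[0,1]\times\mathbb R\to\mathbb R$ satisfy (F1) $f,\sigma$ are (measurable and) bounded, and there is $L>0$ with $|f(x,y)-f(x,\hat y)|+|\sigma(x,y)-\sigma(x,\hat y)|\le L|y-\hat y|$ for all $x\in[0,1]$, $y,\hat y\in\mathbb R$. Let $\mathcal H$ be the set of functions $h(x,t)=\int_0^t\int_0^x\dot h(y,s)\,dy\,ds$ on $[0,1]\times[0,\infty)$ with $\int_0^T\int_0^1\dot h^2\,dx\,ds<\infty$ for all $T>0$, and put $\|h\|_2^\infty:=\int_0^\infty\int_0^1\dot h(x,s)^2\,dx\,ds\in[0,\infty]$. For $h\in\mathcal H$ and $u_0\in C([0,1])$ with $K_1\le u_0\le K_2$, a solution of the skeleton equation with two reflecting walls $$\partial_t u-\partial_x^2u+\alpha u=f(x,u)+\sigma(x,u)\dot h+\eta-\xi,\quad K_1\le u\le K_2,\quad u(\cdot,0)=u_0,\quad \partial_xu(0,t)=\partial_xu(1,t)=0,$$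 is a triple $(u^h,\eta,\xi)$ such that $u^h$ is continuous on $[0,1]\times[0,\infty)$, $K_1(x)\le u^h(x,t)\le K_2(x)$, $u^h(\cdot,0)=u_0$; $\eta,\xi$ are positive measures on $[0,1]\times[0,\infty)$, finite on $[0,1]\times[0,T]$ for every $T>0$; for all $t\ge0$ and $\phi\in C^\infty([0,1])$ with $\phi'(0)=\phi'(1)=0$, $$(u^h(t),\phi)-\int_0^t(u^h(s),\phi'')ds+\alpha\int_0^t(u^h(s),\phi)ds=(u_0,\phi)+\int_0^t(f(\cdot,u^h(s)),\phi)ds+\int_0^t(\sigma(\cdot,u^h(s))\dot h(s),\phi)ds+\int_{[0,1]\times[0,t]}\phi\,d\eta-\int_{[0,1]\times[0,t]}\phi\,d\xi,$$ where $(\cdot,\cdot)$ is the inner product of $L^2([0,1])$; and, for every $T>0$, $\int_{[0,1]\times[0,T]}(u^h-K_1)\,d\eta=\int_{[0,1]\times[0,T]}(K_2-u^h)\,d\xi=0$. Let $0<\gamma<\frac12$, and let $\|v\|_\gamma=\sup_{x}|v(x)|+\sup_{x\ne y}|v(x)-v(y)|/|x-y|^\gamma$ be the norm of the Hölder space $C^\gamma([0,1])$.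 Then there is a constant $C$, depending only on $\alpha,K_1,K_2,f,\sigma,\gamma$, such that for all $u_0$ and $h$ as above, every such solution and every $t>0$, $$\|u^h(\cdot,t)\|_\gamma\le C\Bigl(1+\frac1{\sqrt t}\Bigr)\bigl(1+\|h\|_2^\infty\bigr).$$ -/

import Mathlib

open MeasureTheory Set
open scoped ENNReal NNReal ContDiff

namespace ReflectedPDE

/-- The space-time cylinder `[0,1] × [0,T]`, with points written `(x, t)`. -/
def cyl (T : ℝ) : Set (ℝ × ℝ) := Icc 0 1 ×ˢ Icc 0 T

/-- The full domain `Q = [0,1] × [0,∞)`. -/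
def Q : Set (ℝ × ℝ) := Icc 0 1 ×ˢ Ici 0

/-- The second derivative of `K` on `(0,1)`, in the sense of distributions, belongs to
`L²([0,1])`. -/
def HasL2SecondDeriv (K : ℝ → ℝ) : Prop :=
  ∃ k : ℝ → ℝ, MemLp k 2 (volume.restrict (Icc 0 1)) ∧
    ∀ φ : ℝ → ℝ, ContDiff ℝ ∞ φ → HasCompactSupport φ → tsupport φ ⊆ Ioo 0 1 →
      ∫ x in Icc 0 1, K x * deriv (deriv φ) x = ∫ x in Icc 0 1, k x * φ x

/-- The standing assumptions on the two reflecting walls: continuity on `[0,1]`,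
`K₁ < 0 < K₂`, and square integrable distributional second derivatives. -/
structure Walls (K₁ K₂ : ℝ → ℝ) : Prop where
  cont₁ : ContinuousOn K₁ (Icc 0 1)
  cont₂ : ContinuousOn K₂ (Icc 0 1)
  neg₁ : ∀ x ∈ Icc (0 : ℝ) 1, K₁ x < 0
  pos₂ : ∀ x ∈ Icc (0 : ℝ) 1, 0 < K₂ x
  second₁ : HasL2SecondDeriv K₁
  second₂ : HasL2SecondDeriv K₂

/-- Condition (F1): the coefficients are bounded, and Lipschitz in the second variable uniformly
in `x ∈ [0,1]`. Measurability in `x` is what makes the integrals in the equation meaningful. -/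
structure F1 (f σ : ℝ → ℝ → ℝ) : Prop where
  meas_f : ∀ y, AEMeasurable (fun x => f x y) (volume.restrict (Icc 0 1))
  meas_σ : ∀ y, AEMeasurable (fun x => σ x y) (volume.restrict (Icc 0 1))
  bounded : ∃ M : ℝ, ∀ x ∈ Icc (0 : ℝ) 1, ∀ y, |f x y| ≤ M ∧ |σ x y| ≤ M
  lipschitz : ∃ C > 0, ∀ x ∈ Icc (0 : ℝ) 1, ∀ y z,
    |f x y - f x z| + |σ x y - σ x z| ≤ C * |y - z|

/-- `h` belongs to the Cameron-Martin space of the Brownian sheet on `[0,1] × [0,∞)`, with density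
`hdot`: `h(x,t) = ∫₀ᵗ ∫₀ˣ hdot(y,s) dy ds`, and `hdot` is square integrable on `[0,1] × [0,T]`
for every `T > 0`. -/
structure CameronMartin (h hdot : ℝ → ℝ → ℝ) : Prop where
  sq_integrable : ∀ T > 0, MemLp (fun p : ℝ × ℝ => hdot p.1 p.2) 2 (volume.restrict (cyl T))
  eq_integral : ∀ x ∈ Icc (0 : ℝ) 1, ∀ t ≥ 0,
    h x t = ∫ p in Icc 0 x ×ˢ Icc 0 t, hdot p.1 p.2

/-- The quantity `∫₀^∞ ∫₀¹ hdot(x,s)² dx ds ∈ [0,∞]` (no square root is taken). -/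
noncomputable def energy (hdot : ℝ → ℝ → ℝ) : ℝ≥0∞ :=
  ∫⁻ p in Q, ENNReal.ofReal (hdot p.1 p.2 ^ 2)

/-- `(u, η, ξ)` solves the skeleton equation with two reflecting walls
`∂ₜ u - ∂ₓₓ u + α u = f(x,u) + σ(x,u) hdot + η - ξ`, `K₁ ≤ u ≤ K₂`, `u(·,0) = u₀`, with Neumann
boundary conditions. The measures `η`, `ξ` are only evaluated inside `Q`. -/
structure IsSkeletonSolution (α : ℝ) (K₁ K₂ : ℝ → ℝ) (f σ : ℝ → ℝ → ℝ) (u₀ : ℝ → ℝ)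
    (hdot : ℝ → ℝ → ℝ) (u : ℝ → ℝ → ℝ) (η ξ : Measure (ℝ × ℝ)) : Prop where
  cont : ContinuousOn (fun p : ℝ × ℝ => u p.1 p.2) Q
  between : ∀ x ∈ Icc (0 : ℝ) 1, ∀ t ≥ 0, K₁ x ≤ u x t ∧ u x t ≤ K₂ x
  initial : ∀ x ∈ Icc (0 : ℝ) 1, u x 0 = u₀ x
  finite_η : ∀ T > 0, η (cyl T) < ⊤
  finite_ξ : ∀ T > 0, ξ (cyl T) < ⊤
  weak : ∀ t ≥ 0, ∀ φ : ℝ → ℝ, ContDiff ℝ ∞ φ → deriv φ 0 = 0 → deriv φ 1 = 0 →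
    (∫ x in Icc 0 1, u x t * φ x)
        - (∫ p in cyl t, u p.1 p.2 * deriv (deriv φ) p.1)
        + α * (∫ p in cyl t, u p.1 p.2 * φ p.1)
      = (∫ x in Icc 0 1, u₀ x * φ x)
        + (∫ p in cyl t, f p.1 (u p.1 p.2) * φ p.1)
        + (∫ p in cyl t, σ p.1 (u p.1 p.2) * hdot p.1 p.2 * φ p.1)
        + (∫ p in cyl t, φ p.1 ∂η)
        - (∫ p in cyl t, φ p.1 ∂ξ)
  contact_η : ∀ T > 0, ∫ p in cyl T, (u p.1 p.2 - K₁ p.1) ∂η = 0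
  contact_ξ : ∀ T > 0, ∫ p in cyl T, (K₂ p.1 - u p.1 p.2) ∂ξ = 0

/-- The norm of the Hölder space `C^γ([0,1])`: supremum norm plus the least Hölder constant, with
the value `∞` for functions outside the space. -/
noncomputable def holderNorm (γ : ℝ≥0) (v : ℝ → ℝ) : ℝ≥0∞ :=
  (⨆ x : Icc (0 : ℝ) 1, ‖v x‖ₑ) + eHolderNorm γ (fun x : Icc (0 : ℝ) 1 => v x)

end ReflectedPDE

/-! Fix `t > 0` and work on the window `[t₀, t]` with `t₀ = max (t - 1) 0`. The source `g = f(x,u) +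
σ(x,u) hdot - α u` is bounded in `L²` of the window by the energy, because `u` lies between the
walls and `f`, `σ` are bounded. Its Neumann heat potential `z` is spatially `γ`-Hölder with constant
`C ‖g‖₂` (`exists_heat_potential`): expand in cosines and use that the sum of `k ^ (2γ - 2)`
converges for `γ < 1/2`.

Then `v = u - z` solves an obstacle problem with no source, driven only by `η` and `ξ`, between the
moving obstacles `K₁ - z` and `K₂ - z` (`IsSkeletonSolution.isObstacleSolution`). The obstacles are
`γ`-Hölder in space, since a continuous wall with `K'' ∈ L²` is Lipschitz
(`exists_lipschitz_of_hasL2SecondDeriv`).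

The core is `IsObstacleSolution.sub_le`, a doubling of variables: `v(x,t) - v(y,t)` is compared with
`β(t) |x - y|^γ`, where `β(t) = M + A (t - t₀)^(-1/2)`. At a positive maximum of the difference, `v`
is off the lower obstacle at `x` and off the upper one at `y`, because `β ≥ M` dominates the modulus
of the obstacles. There each measure can only act in the favourable direction, and the strict
concavity of `r ↦ r^γ` outweighs the decay of `β`, which is a contradiction. No regularity of `u(·,
t₀)` is used beyond its oscillation, and this is the origin of the factor `1 + 1/√t`.

As `v` satisfies the equation only weakly, the maximum principle is applied to its convolution with
a mollifier reflected at `0` and `1`. The reflection makes the kernel a Neumann test function and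
turns boundary maxima into interior ones. -/

namespace ReflectedPDE

/-! ### Mollification on `[0,1]` with reflection at the endpoints. -/

/-- A smooth even probability density supported in `[-ε, ε]`. -/
structure IsMollifier (ε : ℝ) (ρ : ℝ → ℝ) : Prop where
  smooth : ContDiff ℝ ∞ ρ
  nonneg : ∀ x, 0 ≤ ρ x
  even : ∀ x, ρ (-x) = ρ x
  eq_zero : ∀ x, ε ≤ |x| → ρ x = 0
  integral_eq_one : ∫ x, ρ x = 1

theorem exists_isMollifier {ε : ℝ} (hε : 0 < ε) : ∃ ρ, IsMollifier ε ρ := by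
  let f : ContDiffBump (0 : ℝ) := ⟨ε / 2, ε, by positivity, by linarith⟩
  refine ⟨f.normed volume, f.contDiff_normed, f.nonneg_normed, f.normed_neg, fun x hx => ?_,
    f.integral_normed⟩
  have : x ∉ Function.support (f.normed volume) := by
    rw [f.support_normed_eq]
    simpa [f] using hx
  simpa using this

namespace IsMollifier

variable {ε : ℝ} {ρ : ℝ → ℝ}

theorem hasCompactSupport (h : IsMollifier ε ρ) : HasCompactSupport ρ :=
  HasCompactSupport.intro (isCompact_Icc (a := -ε) (b := ε)) fun x hx => h.eq_zero x (by
    by_contra! hlt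
    exact hx ⟨(abs_lt.1 hlt).1.le, (abs_lt.1 hlt).2.le⟩)

theorem smooth_deriv (h : IsMollifier ε ρ) : ContDiff ℝ ∞ (deriv ρ) :=
  (contDiff_infty_iff_deriv.1 h.smooth).2

theorem smooth_deriv_deriv (h : IsMollifier ε ρ) : ContDiff ℝ ∞ (deriv (deriv ρ)) :=
  (contDiff_infty_iff_deriv.1 h.smooth_deriv).2

theorem hasDerivAt (h : IsMollifier ε ρ) (x : ℝ) : HasDerivAt ρ (deriv ρ x) x :=
  (h.smooth.differentiable (by simp) x).hasDerivAt

theorem hasDerivAt_deriv (h : IsMollifier ε ρ) (x : ℝ) :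
    HasDerivAt (deriv ρ) (deriv (deriv ρ) x) x :=
  (h.smooth_deriv.differentiable (by simp) x).hasDerivAt

theorem deriv_neg (h : IsMollifier ε ρ) (x : ℝ) : deriv ρ (-x) = -deriv ρ x := by
  have h1 : (fun y => ρ (-y)) = ρ := funext h.even
  have h2 := deriv_comp_neg ρ x
  rw [h1] at h2
  linarith

theorem deriv_eq_zero (h : IsMollifier ε ρ) {x : ℝ} (hx : ε < |x|) : deriv ρ x = 0 := by
  have : ρ =ᶠ[nhds x] fun _ => 0 := by
    filter_upwards [continuous_abs.continuousAt.eventually (lt_mem_nhds hx)] with y hy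
    exact h.eq_zero y (le_of_lt hy)
  rw [this.deriv_eq]
  simp

theorem integral_Icc (h : IsMollifier ε ρ) {a b : ℝ} (ha : a ≤ -ε) (hb : ε ≤ b) :
    ∫ x in Icc a b, ρ x = 1 := by
  rw [← h.integral_eq_one]
  refine setIntegral_eq_integral_of_forall_compl_eq_zero fun x hx => h.eq_zero x ?_
  by_contra! hlt
  exact hx ⟨ha.trans (abs_lt.1 hlt).1.le, (abs_lt.1 hlt).2.le.trans hb⟩

end IsMollifier

theorem exists_abs_le_of_hasCompactSupport {p : ℝ → ℝ} (hp : Continuous p)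
    (hc : HasCompactSupport p) : ∃ C, ∀ x, |p x| ≤ C := by
  simpa using hc.exists_bound_of_continuous hp

theorem hasDerivAt_integral_mul_comp_sub {w p p' : ℝ → ℝ} (hw : IntegrableOn w (Icc 0 1))
    (hp : ∀ x, HasDerivAt p (p' x) x) (hp' : Continuous p') (hc : HasCompactSupport p)
    (hc' : HasCompactSupport p') (x : ℝ) :
    HasDerivAt (fun x => ∫ z in Icc (0 : ℝ) 1, w z * p (x - z))
      (∫ z in Icc (0 : ℝ) 1, w z * p' (x - z)) x := by
  have hpc : Continuous p := continuous_iff_continuousAt.2 fun y => (hp y).continuousAt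
  obtain ⟨C, hC⟩ := exists_abs_le_of_hasCompactSupport hpc hc
  obtain ⟨C', hC'⟩ := exists_abs_le_of_hasCompactSupport hp' hc'
  refine (hasDerivAt_integral_of_dominated_loc_of_deriv_le (bound := fun z => |w z| * C')
    (F := fun x z => w z * p (x - z)) (F' := fun x z => w z * p' (x - z))
    Filter.univ_mem ?_ ?_ ?_ ?_ ?_ ?_).2
  · exact Filter.Eventually.of_forall fun y => hw.aestronglyMeasurable.mul
      (hpc.comp (continuous_const.sub continuous_id)).aestronglyMeasurable
  · exact hw.mul_bdd (c := C)
      (hpc.comp (continuous_const.sub continuous_id)).aestronglyMeasurable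
      (Filter.Eventually.of_forall fun z => by simpa using hC _)
  · exact hw.aestronglyMeasurable.mul
      (hp'.comp (continuous_const.sub continuous_id)).aestronglyMeasurable
  · refine Filter.Eventually.of_forall fun z y _ => ?_
    rw [norm_mul, Real.norm_eq_abs, Real.norm_eq_abs]
    exact mul_le_mul_of_nonneg_left (hC' _) (abs_nonneg _)
  · exact hw.abs.mul_const _
  · refine Filter.Eventually.of_forall fun z y _ => ?_
    simpa using ((hp (y - z)).comp_sub_const y z).const_mul (w z)

/-- The kernel `ρ(x - z)` reflected at `0` and `1`. -/
def foldKernel (ρ : ℝ → ℝ) (x z : ℝ) : ℝ := ρ (x - z) + ρ (-x - z) + ρ (2 - x - z)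

/-- Smoothing of a function on `[0,1]` by the reflected kernel. -/
noncomputable def smoothing (w ρ : ℝ → ℝ) (x : ℝ) : ℝ :=
  ∫ z in Icc (0 : ℝ) 1, w z * foldKernel ρ x z

theorem continuous_foldKernel {ρ : ℝ → ℝ} (h : Continuous ρ) (x : ℝ) :
    Continuous (foldKernel ρ x) := by
  unfold foldKernel
  fun_prop

theorem smoothing_eq {w p : ℝ → ℝ} (hw : IntegrableOn w (Icc 0 1)) (hp : Continuous p)
    (hc : HasCompactSupport p) (x : ℝ) :
    smoothing w p x = (∫ z in Icc (0 : ℝ) 1, w z * p (x - z)) +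
      (∫ z in Icc (0 : ℝ) 1, w z * p (-x - z)) + ∫ z in Icc (0 : ℝ) 1, w z * p (2 - x - z) := by
  obtain ⟨C, hC⟩ := exists_abs_le_of_hasCompactSupport hp hc
  have hi : ∀ y, IntegrableOn (fun z => w z * p (y - z)) (Icc 0 1) := fun y =>
    hw.mul_bdd (c := C) (hp.comp (continuous_const.sub continuous_id)).aestronglyMeasurable
      (Filter.Eventually.of_forall fun z => by simpa using hC _)
  unfold smoothing foldKernel
  simp_rw [mul_add]
  have h2 : IntegrableOn (fun z => w z * p (x - z) + w z * p (-x - z)) (Icc 0 1) :=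
    (hi _).add (hi _)
  rw [integral_add h2 (hi _), integral_add (hi _) (hi _)]

namespace IsMollifier

variable {ε : ℝ} {ρ : ℝ → ℝ}

theorem contDiff_foldKernel (h : IsMollifier ε ρ) (x : ℝ) : ContDiff ℝ ∞ (foldKernel ρ x) := by
  have := h.smooth
  unfold foldKernel
  fun_prop

theorem deriv_foldKernel (h : IsMollifier ε ρ) (x z : ℝ) :
    deriv (foldKernel ρ x) z = -(deriv ρ (x - z) + deriv ρ (-x - z) + deriv ρ (2 - x - z)) := by
  have h1 := ((h.hasDerivAt (x - z)).comp_const_sub x z)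
  have h2 := ((h.hasDerivAt (-x - z)).comp_const_sub (-x) z)
  have h3 := ((h.hasDerivAt (2 - x - z)).comp_const_sub (2 - x) z)
  have := ((h1.add h2).add h3).deriv
  rw [neg_add, neg_add, ← this]
  rfl

/-- Testing the weak equation with the kernel thus produces a smoothing by `ρ''`, which is also the
second derivative in `x` of the smoothing by `ρ`: two derivatives cancel the signs of the reflected
terms. -/
theorem deriv_deriv_foldKernel (h : IsMollifier ε ρ) (x z : ℝ) :
    deriv (deriv (foldKernel ρ x)) z = foldKernel (deriv (deriv ρ)) x z := by
  have h0 : deriv (foldKernel ρ x) =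
      fun z => -(deriv ρ (x - z) + deriv ρ (-x - z) + deriv ρ (2 - x - z)) :=
    funext (h.deriv_foldKernel x)
  have h1 := ((h.hasDerivAt_deriv (x - z)).comp_const_sub x z)
  have h2 := ((h.hasDerivAt_deriv (-x - z)).comp_const_sub (-x) z)
  have h3 := ((h.hasDerivAt_deriv (2 - x - z)).comp_const_sub (2 - x) z)
  have := ((h1.add h2).add h3).neg.deriv
  rw [h0]
  refine Eq.trans ?_ (this.trans ?_)
  · rfl
  · simp only [foldKernel]; ring

/-- Together with its twin at `1`, this makes the kernel an admissible Neumann test function. `ρ'`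
is odd, so the direct term cancels the one reflected at this endpoint, and the other reflection is
out of range of the support. -/
theorem deriv_foldKernel_zero (h : IsMollifier ε ρ) (hε : ε < 1 / 2) {x : ℝ}
    (hx : x ∈ Icc (0 : ℝ) 1) : deriv (foldKernel ρ x) 0 = 0 := by
  rw [h.deriv_foldKernel, sub_zero, sub_zero, sub_zero, h.deriv_neg x,
    h.deriv_eq_zero (x := 2 - x)]
  · ring
  · rw [abs_of_nonneg (by linarith [hx.2])]; linarith [hx.2]

theorem deriv_foldKernel_one (h : IsMollifier ε ρ) (hε : ε < 1 / 2) {x : ℝ}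
    (hx : x ∈ Icc (0 : ℝ) 1) : deriv (foldKernel ρ x) 1 = 0 := by
  rw [h.deriv_foldKernel, show 2 - x - 1 = -(x - 1) by ring, h.deriv_neg (x - 1),
    h.deriv_eq_zero (x := -x - 1)]
  · ring
  · rw [abs_of_nonpos (by linarith [hx.1])]; linarith [hx.1]

theorem foldKernel_nonneg (h : IsMollifier ε ρ) (x z : ℝ) : 0 ≤ foldKernel ρ x z :=
  add_nonneg (add_nonneg (h.nonneg _) (h.nonneg _)) (h.nonneg _)

/-- Within `[0,1]`, reflecting a point at an endpoint never brings it closer to `z`. -/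
theorem foldKernel_eq_zero (h : IsMollifier ε ρ) {x z : ℝ} (hx : x ∈ Icc (0 : ℝ) 1)
    (hz : z ∈ Icc (0 : ℝ) 1) (hxz : ε ≤ |x - z|) : foldKernel ρ x z = 0 := by
  have := abs_le.1 (le_refl |x - z|)
  obtain ⟨hx0, hx1⟩ := hx
  obtain ⟨hz0, hz1⟩ := hz
  have h1 : |x - z| ≤ |-x - z| := by
    rw [abs_of_nonpos (show -x - z ≤ 0 by linarith)]
    exact abs_le.2 ⟨by linarith, by linarith⟩
  have h2 : |x - z| ≤ |2 - x - z| := by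
    rw [abs_of_nonneg (show 0 ≤ 2 - x - z by linarith)]
    exact abs_le.2 ⟨by linarith, by linarith⟩
  rw [foldKernel, h.eq_zero _ hxz, h.eq_zero _ (hxz.trans h1), h.eq_zero _ (hxz.trans h2)]
  ring

/-- By evenness the three terms integrate `ρ` over `[x-1,x]`, `[x,x+1]` and `[x-2,x-1]`, which tile
an interval containing the support of `ρ`. -/
theorem integral_foldKernel (h : IsMollifier ε ρ) (hε : ε < 1 / 2) {x : ℝ}
    (hx : x ∈ Icc (0 : ℝ) 1) : ∫ z in Icc (0 : ℝ) 1, foldKernel ρ x z = 1 := by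
  have hc := h.smooth.continuous
  have hi : ∀ (q : ℝ → ℝ) (a b : ℝ), Continuous q → IntervalIntegrable q volume a b :=
    fun q a b hq => hq.intervalIntegrable a b
  rw [integral_Icc_eq_integral_Ioc, ← intervalIntegral.integral_of_le zero_le_one]
  unfold foldKernel
  rw [intervalIntegral.integral_add (hi _ _ _ (by fun_prop)) (hi _ _ _ (by fun_prop)),
    intervalIntegral.integral_add (hi _ _ _ (by fun_prop)) (hi _ _ _ (by fun_prop)),
    intervalIntegral.integral_comp_sub_left (f := ρ), intervalIntegral.integral_comp_sub_left (f := ρ),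
    intervalIntegral.integral_comp_sub_left (f := ρ)]
  have e1 : ∫ y in (2 - x - 1)..(2 - x - 0), ρ y = ∫ y in (x - 2)..(x - 1), ρ y := by
    have := intervalIntegral.integral_comp_neg (a := x - 2) (b := x - 1) (f := ρ)
    simp_rw [h.even] at this
    rw [this]; congr 1 <;> ring
  have e2 : ∫ y in (-x - 1)..(-x - 0), ρ y = ∫ y in x..(x + 1), ρ y := by
    have := intervalIntegral.integral_comp_neg (a := x) (b := x + 1) (f := ρ)
    simp_rw [h.even] at this
    rw [this]; congr 1 <;> ring
  rw [e1, e2, sub_zero, intervalIntegral.integral_add_adjacent_intervals (hi _ _ _ hc) (hi _ _ _ hc),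
    add_comm, intervalIntegral.integral_add_adjacent_intervals (hi _ _ _ hc) (hi _ _ _ hc),
    intervalIntegral.integral_of_le (by linarith), ← integral_Icc_eq_integral_Ioc]
  exact h.integral_Icc (by linarith [hx.2]) (by linarith [hx.1])

theorem abs_smoothing_sub_le (h : IsMollifier ε ρ) (hε : ε < 1 / 2) {w : ℝ → ℝ}
    (hw : ContinuousOn w (Icc 0 1)) {m : ℝ} {x : ℝ} (hx : x ∈ Icc (0 : ℝ) 1)
    (hm : ∀ z ∈ Icc (0 : ℝ) 1, |x - z| < ε → |w z - w x| ≤ m) :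
    |smoothing w ρ x - w x| ≤ m := by
  have hk := continuous_foldKernel h.smooth.continuous x
  have hi : IntegrableOn (foldKernel ρ x) (Icc 0 1) := hk.continuousOn.integrableOn_Icc
  have hi1 : IntegrableOn (fun z => w z * foldKernel ρ x z) (Icc 0 1) :=
    (hw.mul hk.continuousOn).integrableOn_Icc
  have e : smoothing w ρ x - w x = ∫ z in Icc (0 : ℝ) 1, (w z - w x) * foldKernel ρ x z := by
    have : w x = ∫ z in Icc (0 : ℝ) 1, w x * foldKernel ρ x z := by
      rw [integral_const_mul, h.integral_foldKernel hε hx, mul_one]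
    rw [smoothing]
    conv_lhs => rw [this]
    rw [← integral_sub hi1 (hi.const_mul _)]
    simp_rw [sub_mul]
  have hb : ∀ᵐ z ∂volume.restrict (Icc (0 : ℝ) 1),
      ‖(w z - w x) * foldKernel ρ x z‖ ≤ m * foldKernel ρ x z := by
    filter_upwards [ae_restrict_mem measurableSet_Icc] with z hz
    rw [norm_mul, Real.norm_eq_abs, Real.norm_of_nonneg (h.foldKernel_nonneg x z)]
    rcases lt_or_ge |x - z| ε with hlt | hge
    · exact mul_le_mul_of_nonneg_right (hm z hz hlt) (h.foldKernel_nonneg x z)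
    · simp [h.foldKernel_eq_zero hx hz hge]
  rw [e, ← Real.norm_eq_abs]
  refine (norm_integral_le_of_norm_le (hi.const_mul m) hb).trans (le_of_eq ?_)
  rw [integral_const_mul, h.integral_foldKernel hε hx, mul_one]

theorem hasDerivAt_smoothing (h : IsMollifier ε ρ) {w : ℝ → ℝ} (hw : IntegrableOn w (Icc 0 1))
    (x : ℝ) : HasDerivAt (smoothing w ρ)
      ((∫ z in Icc (0 : ℝ) 1, w z * deriv ρ (x - z)) -
        (∫ z in Icc (0 : ℝ) 1, w z * deriv ρ (-x - z)) -
        ∫ z in Icc (0 : ℝ) 1, w z * deriv ρ (2 - x - z)) x := by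
  have H := hasDerivAt_integral_mul_comp_sub hw h.hasDerivAt h.smooth_deriv.continuous
    h.hasCompactSupport h.hasCompactSupport.deriv
  have e : smoothing w ρ = _ := funext (smoothing_eq hw h.smooth.continuous h.hasCompactSupport)
  rw [e]
  have h2 := (H (-x)).scomp x (hasDerivAt_neg x)
  have h3 := (H (2 - x)).comp_const_sub 2 x
  exact (((H x).add h2).add h3).congr_deriv (by rw [neg_one_smul]; ring)

theorem hasDerivAt_deriv_smoothing (h : IsMollifier ε ρ) {w : ℝ → ℝ}
    (hw : IntegrableOn w (Icc 0 1)) (x : ℝ) :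
    HasDerivAt (deriv (smoothing w ρ)) (smoothing w (deriv (deriv ρ)) x) x := by
  have H := hasDerivAt_integral_mul_comp_sub hw h.hasDerivAt_deriv h.smooth_deriv_deriv.continuous
    h.hasCompactSupport.deriv h.hasCompactSupport.deriv.deriv
  have e : deriv (smoothing w ρ) = _ := funext fun x => (h.hasDerivAt_smoothing hw x).deriv
  rw [e, smoothing_eq hw h.smooth_deriv_deriv.continuous h.hasCompactSupport.deriv.deriv]
  have h2 := (H (-x)).scomp x (hasDerivAt_neg x)
  have h3 := (H (2 - x)).comp_const_sub 2 x
  exact (((H x).sub h2).sub h3).congr_deriv (by rw [neg_one_smul]; ring)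

/-- The map `x ↦ 1 - |1 - |x||` folds a neighbourhood of `[0,1]` back onto it, so the smoothing
extends evenly across both endpoints. This is what allows the second derivative test at the
boundary. -/
theorem smoothing_fold (h : IsMollifier ε ρ) (hε : ε < 1 / 2) (w : ℝ → ℝ) {x : ℝ}
    (hx : x ∈ Icc (-(1 / 2) : ℝ) (3 / 2)) :
    smoothing w ρ (1 - |1 - (|x|)|) = smoothing w ρ x := by
  refine setIntegral_congr_fun measurableSet_Icc fun z hz => ?_
  obtain ⟨hx0, hx1⟩ := hx
  obtain ⟨hz0, hz1⟩ := hz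
  congr 1
  rcases le_or_gt 0 x with hx | hx
  · rw [abs_of_nonneg hx]
    rcases le_or_gt x 1 with hx' | hx'
    · rw [abs_of_nonneg (by linarith)]; simp
    · rw [abs_of_neg (by linarith)]
      have e1 : ρ (-(2 - x) - z) = 0 := h.eq_zero _ (by
        rw [abs_of_nonpos (by linarith)]; linarith)
      have e2 : ρ (-x - z) = 0 := h.eq_zero _ (by
        rw [abs_of_nonpos (by linarith)]; linarith)
      simp only [foldKernel]
      rw [show 1 - -(1 - x) = 2 - x by ring, e1, e2]
      ring_nf
  · rw [abs_of_neg hx, abs_of_nonneg (by linarith)]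
    have e1 : ρ (2 - (-x) - z) = 0 := h.eq_zero _ (by
      rw [abs_of_nonneg (by linarith)]; linarith)
    have e2 : ρ (2 - x - z) = 0 := h.eq_zero _ (by
      rw [abs_of_nonneg (by linarith)]; linarith)
    simp only [foldKernel]
    rw [show 1 - (1 - -x) = -x by ring, e1, e2]
    ring_nf

end IsMollifier

/-! ### Lipschitz continuity of the walls. -/

theorem exists_abs_le_of_continuousOn_Icc {K : ℝ → ℝ} (hc : ContinuousOn K (Icc 0 1)) :
    ∃ B : ℝ, 0 ≤ B ∧ ∀ x ∈ Icc (0 : ℝ) 1, |K x| ≤ B := by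
  obtain ⟨B, hB⟩ := isCompact_Icc.exists_bound_of_continuousOn hc
  exact ⟨B, (abs_nonneg _).trans (hB 0 (by simp)), hB⟩

namespace IsMollifier

variable {ε : ℝ} {ρ : ℝ → ℝ}

theorem deriv_smoothing_interior (h : IsMollifier ε ρ) (hε : 0 < ε) {w : ℝ → ℝ}
    (hw : IntegrableOn w (Icc 0 1)) {x : ℝ} (hx : x ∈ Icc (2 * ε) (1 - 2 * ε)) :
    HasDerivAt (smoothing w ρ) (∫ z in Icc (0 : ℝ) 1, w z * deriv ρ (x - z)) x := by
  refine (h.hasDerivAt_smoothing hw x).congr_deriv ?_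
  obtain ⟨hx0, hx1⟩ := hx
  have e1 : ∫ z in Icc (0 : ℝ) 1, w z * deriv ρ (-x - z) = 0 := by
    refine setIntegral_eq_zero_of_forall_eq_zero fun z hz => ?_
    rw [h.deriv_eq_zero, mul_zero]
    rw [abs_of_nonpos (by linarith [hz.1])]; linarith [hz.1]
  have e2 : ∫ z in Icc (0 : ℝ) 1, w z * deriv ρ (2 - x - z) = 0 := by
    refine setIntegral_eq_zero_of_forall_eq_zero fun z hz => ?_
    rw [h.deriv_eq_zero, mul_zero]
    rw [abs_of_nonneg (by linarith [hz.2])]; linarith [hz.2]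
  rw [e1, e2]; ring

/-- The distribution function of a mollifier. -/
theorem exists_cdf (h : IsMollifier ε ρ) : ∃ R : ℝ → ℝ, ContDiff ℝ ∞ R ∧
    (∀ x, HasDerivAt R (ρ x) x) ∧ (∀ x, x ≤ -ε → R x = 0) ∧ (∀ x, ε ≤ x → R x = 1) ∧
    ∀ x, R x ∈ Icc (0 : ℝ) 1 := by
  have hc := h.smooth.continuous
  have hd : ∀ x, HasDerivAt (fun x => ∫ y in (-ε)..x, ρ y) (ρ x) x := fun x =>
    (hc.integral_hasStrictDerivAt _ x).hasDerivAt
  have hde : deriv (fun x => ∫ y in (-ε)..x, ρ y) = ρ := funext fun x => (hd x).deriv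
  have h0 : ∀ x, x ≤ -ε → ∫ y in (-ε)..x, ρ y = 0 := by
    intro x hx
    refine (intervalIntegral.integral_congr (g := fun _ => (0 : ℝ)) fun y hy => ?_).trans (by simp)
    rw [uIcc_of_ge hx] at hy
    exact h.eq_zero y ((by linarith [hy.2] : ε ≤ -y).trans (neg_le_abs y))
  have hmono : Monotone fun x => ∫ y in (-ε)..x, ρ y :=
    monotone_of_deriv_nonneg (fun x => (hd x).differentiableAt) fun x => by
      rw [hde]; exact h.nonneg x
  have h1 : ∀ x, ε ≤ x → ∫ y in (-ε)..x, ρ y = 1 := by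
    intro x hx
    rcases le_or_gt (-ε) x with hle | hlt
    · rw [intervalIntegral.integral_of_le hle, ← integral_Icc_eq_integral_Ioc]
      exact h.integral_Icc le_rfl hx
    · exfalso
      have : ∫ x, ρ x = 0 := by
        have : ρ = fun _ => 0 := funext fun y => h.eq_zero y (by
          have := abs_nonneg y; linarith)
        rw [this]; simp
      rw [h.integral_eq_one] at this
      exact one_ne_zero this
  refine ⟨_, contDiff_infty_iff_deriv.2 ⟨fun x => (hd x).differentiableAt, by
    rw [hde]; exact h.smooth⟩, hd, h0, h1, fun x => ⟨?_, ?_⟩⟩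
  · rcases le_total x (-ε) with hx | hx
    · exact (h0 x hx).ge
    · exact (h0 _ le_rfl).ge.trans (hmono hx)
  · rcases le_total ε x with hx | hx
    · exact (h1 x hx).le
    · exact (hmono hx).trans (h1 _ le_rfl).le

end IsMollifier

/-- The derivative of the mollified wall oscillates by at most `∫ |k|`, and it is at most `12 B`
somewhere by the mean value theorem. It is therefore bounded independently of `ε`, and the bound
passes to the limit. -/
theorem exists_lipschitz_of_hasL2SecondDeriv {K : ℝ → ℝ} (hc : ContinuousOn K (Icc 0 1))
    (hK : HasL2SecondDeriv K) :
    ∃ M : ℝ, 0 ≤ M ∧ ∀ x ∈ Icc (0 : ℝ) 1, ∀ y ∈ Icc (0 : ℝ) 1, |K x - K y| ≤ M * |x - y| := by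
  obtain ⟨k, hk2, hk⟩ := hK
  have hk1 : IntegrableOn k (Icc 0 1) := hk2.integrable (by norm_num)
  obtain ⟨B, hB0, hB⟩ := exists_abs_le_of_continuousOn_Icc hc
  have hKi : IntegrableOn K (Icc 0 1) := hc.integrableOn_Icc
  set k' := ∫ z in Icc (0 : ℝ) 1, |k z| with hk'
  have hk'0 : 0 ≤ k' := integral_nonneg fun z => abs_nonneg _
  have huc := isCompact_Icc.uniformContinuousOn_of_continuous hc
  -- uniform Lipschitz bound for the mollified functions
  have key : ∀ ε, 0 < ε → ε ≤ 1 / 8 → ∀ ρ, IsMollifier ε ρ →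
      ∀ x ∈ Icc (2 * ε) (1 - 2 * ε), ∀ y ∈ Icc (2 * ε) (1 - 2 * ε),
      |smoothing K ρ x - smoothing K ρ y| ≤ (12 * B + k') * |x - y| := by
    intro ε hε hε8 ρ hρ
    set g : ℝ → ℝ := fun x => ∫ z in Icc (0 : ℝ) 1, K z * deriv ρ (x - z) with hg
    have hd : ∀ x ∈ Icc (2 * ε) (1 - 2 * ε), HasDerivAt (smoothing K ρ) (g x) x := fun x hx =>
      hρ.deriv_smoothing_interior hε hKi hx
    have hSb : ∀ x ∈ Icc (2 * ε) (1 - 2 * ε), |smoothing K ρ x| ≤ 3 * B := by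
      intro x hx
      have hx' : x ∈ Icc (0 : ℝ) 1 := ⟨by linarith [hx.1], by linarith [hx.2]⟩
      have := hρ.abs_smoothing_sub_le (by linarith) hc (m := 2 * B) hx' fun z hz _ =>
        (abs_sub _ _).trans (by linarith [hB z hz, hB x hx'])
      have h2 := abs_sub_abs_le_abs_sub (smoothing K ρ x) (K x)
      linarith [hB x hx']
    have hgdiff : ∀ a ∈ Icc (2 * ε) (1 - 2 * ε), ∀ b ∈ Icc (2 * ε) (1 - 2 * ε),
        |g b - g a| ≤ k' := by
      intro a ha b hb
      obtain ⟨R, hRs, hRd, hR0, hR1, hR⟩ := hρ.exists_cdf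
      -- Chosen so that `φ''` is the kernel of `g b - g a`. Being a difference of two distribution
      -- functions, `φ` is bounded by `1`, and it has compact support in `(0,1)`.
      set φ : ℝ → ℝ := fun z => R (b - z) - R (a - z) with hφ
      have hφs : ContDiff ℝ ∞ φ := by rw [hφ]; fun_prop
      have hφ0 : ∀ z, z ∉ Icc ε (1 - ε) → φ z = 0 := by
        intro z hz
        rw [mem_Icc, not_and_or, not_le, not_le] at hz
        rcases hz with hz | hz
        · simp only [hφ]
          rw [hR1 _ (by linarith [hb.1]), hR1 _ (by linarith [ha.1]), sub_self]
        · simp only [hφ]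
          rw [hR0 _ (by linarith [hb.2]), hR0 _ (by linarith [ha.2]), sub_self]
      have hts : tsupport φ ⊆ Icc ε (1 - ε) :=
        closure_minimal (fun z hz => by
          by_contra hz'
          exact hz (hφ0 z hz')) isClosed_Icc
      have hφ1 : deriv φ = fun z => -ρ (b - z) + ρ (a - z) := by
        funext z
        refine (((hRd (b - z)).comp_const_sub b z).sub
          ((hRd (a - z)).comp_const_sub a z)).deriv.trans ?_
        ring
      have hφ2 : deriv (deriv φ) = fun z => deriv ρ (b - z) - deriv ρ (a - z) := by
        rw [hφ1]
        funext z
        refine (((hρ.hasDerivAt (b - z)).comp_const_sub b z).neg.add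
          ((hρ.hasDerivAt (a - z)).comp_const_sub a z)).deriv.trans ?_
        ring
      have H := hk φ hφs (HasCompactSupport.intro isCompact_Icc hφ0)
        (hts.trans fun z hz => ⟨by linarith [hz.1], by linarith [hz.2]⟩)
      have hint : ∀ c, IntegrableOn (fun z => K z * deriv ρ (c - z)) (Icc 0 1) := fun c =>
        (hc.mul (hρ.smooth_deriv.continuous.comp
          (continuous_const.sub continuous_id)).continuousOn).integrableOn_Icc
      have e : g b - g a = ∫ z in Icc (0 : ℝ) 1, k z * φ z := by
        rw [← H, hφ2, hg]
        simp only [mul_sub]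
        rw [integral_sub (hint b) (hint a)]
      rw [e, ← Real.norm_eq_abs]
      refine norm_integral_le_of_norm_le hk1.abs (Filter.Eventually.of_forall fun z => ?_)
      rw [norm_mul, Real.norm_eq_abs, Real.norm_eq_abs]
      refine mul_le_of_le_one_right (abs_nonneg _) ?_
      obtain ⟨h1, h2⟩ := hR (b - z)
      obtain ⟨h3, h4⟩ := hR (a - z)
      exact abs_le.2 ⟨by simp only [hφ]; linarith, by simp only [hφ]; linarith⟩
    have hgb : ∀ x ∈ Icc (2 * ε) (1 - 2 * ε), ‖g x‖ ≤ 12 * B + k' := by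
      intro x hx
      obtain ⟨c, hcI, hcg⟩ := exists_hasDerivAt_eq_slope (smoothing K ρ) g
        (show 2 * ε < 1 - 2 * ε by linarith)
        (fun y hy => (hd y hy).continuousAt.continuousWithinAt)
        (fun y hy => hd y (Ioo_subset_Icc_self hy))
      -- A slope of a function bounded by `3 B` over an interval of length `1 - 4 ε ≥ 1/2`.
      have hgc : |g c| ≤ 12 * B := by
        rw [hcg, abs_div, div_le_iff₀ (abs_pos.2 (by linarith)),
          abs_of_pos (show 0 < 1 - 2 * ε - 2 * ε by linarith)]
        have h1 := hSb (1 - 2 * ε) ⟨by linarith, le_rfl⟩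
        have h2 := hSb (2 * ε) ⟨le_rfl, by linarith⟩
        have h3 := abs_sub (smoothing K ρ (1 - 2 * ε)) (smoothing K ρ (2 * ε))
        nlinarith
      have := hgdiff c (Ioo_subset_Icc_self hcI) x hx
      have h2 := abs_sub_abs_le_abs_sub (g x) (g c)
      rw [Real.norm_eq_abs]
      linarith
    intro x hx y hy
    exact (convex_Icc _ _).norm_image_sub_le_of_norm_hasDerivWithin_le
      (fun z hz => (hd z hz).hasDerivWithinAt) hgb hy hx
  have hopen : ∀ x ∈ Ioo (0 : ℝ) 1, ∀ y ∈ Ioo (0 : ℝ) 1,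
      |K x - K y| ≤ (12 * B + k') * |x - y| := by
    intro x hx y hy
    refine le_of_forall_pos_le_add fun δ hδ => ?_
    obtain ⟨r, hr, hur⟩ := Metric.uniformContinuousOn_iff.1 huc (δ / 2) (by positivity)
    set ε := min (min r (1 / 8)) (min (min (x / 2) ((1 - x) / 2)) (min (y / 2) ((1 - y) / 2)))
      with hεd
    have hε : 0 < ε := by
      have := hx.1; have := hx.2; have := hy.1; have := hy.2
      simp only [hεd, lt_min_iff]
      refine ⟨⟨hr, by norm_num⟩, ⟨by linarith, by linarith⟩, by linarith, by linarith⟩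
    have hle := le_refl ε
    conv_rhs at hle => rw [hεd]
    simp only [le_min_iff] at hle
    obtain ⟨⟨h1, h2⟩, ⟨h3, h4⟩, h5, h6⟩ := hle
    obtain ⟨ρ, hρ⟩ := exists_isMollifier hε
    have happ : ∀ p ∈ Ioo (0 : ℝ) 1, |smoothing K ρ p - K p| ≤ δ / 2 := fun p hp =>
      hρ.abs_smoothing_sub_le (by linarith) hc (Ioo_subset_Icc_self hp) fun z hz hpz => by
        have := hur z hz p (Ioo_subset_Icc_self hp) (by
          rw [Real.dist_eq, abs_sub_comm]; linarith)
        rw [Real.dist_eq] at this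
        exact this.le
    have hmain := key ε hε h2 ρ hρ x ⟨by linarith, by linarith⟩ y ⟨by linarith, by linarith⟩
    have hxa := abs_le.1 (happ x hx)
    have hya := abs_le.1 (happ y hy)
    have hm := abs_le.1 hmain
    exact abs_le.2 ⟨by linarith, by linarith⟩
  refine ⟨12 * B + k', by positivity, fun x hx y hy => ?_⟩
  have hcl : Icc (0 : ℝ) 1 ×ˢ Icc (0 : ℝ) 1 = closure (Ioo (0 : ℝ) 1 ×ˢ Ioo (0 : ℝ) 1) := by
    rw [closure_prod_eq, closure_Ioo zero_ne_one]
  have hcont1 : ContinuousOn (fun p : ℝ × ℝ => K p.1) (Icc (0 : ℝ) 1 ×ˢ Icc (0 : ℝ) 1) :=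
    hc.comp continuousOn_fst fun p hp => hp.1
  have hcont2 : ContinuousOn (fun p : ℝ × ℝ => K p.2) (Icc (0 : ℝ) 1 ×ˢ Icc (0 : ℝ) 1) :=
    hc.comp continuousOn_snd fun p hp => hp.2
  have := ContinuousOn.image_closure
    (f := fun p : ℝ × ℝ => (12 * B + k') * |p.1 - p.2| - |K p.1 - K p.2|)
    (s := Ioo (0 : ℝ) 1 ×ˢ Ioo (0 : ℝ) 1) (by
      rw [← hcl]
      exact (by fun_prop : Continuous fun p : ℝ × ℝ => (12 * B + k') * |p.1 - p.2|).continuousOn.sub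
        (hcont1.sub hcont2).abs)
  have h2 := this ⟨(x, y), hcl ▸ ⟨hx, hy⟩, rfl⟩
  have h3 := closure_minimal (t := Ici (0 : ℝ)) (by
    rintro _ ⟨p, hp, rfl⟩
    exact sub_nonneg.2 (hopen _ hp.1 _ hp.2)) isClosed_Ici h2
  exact sub_nonneg.1 h3

/-! ### Calculus at a maximum point. -/

/-- Writing the power through `d ^ 2` lets both signs of `d` be differentiated at once. -/
theorem abs_rpow_eq_sq_rpow (d γ : ℝ) : |d| ^ γ = (d ^ 2) ^ (γ / 2) := by
  rw [← sq_abs, ← Real.rpow_natCast, ← Real.rpow_mul (abs_nonneg d)]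
  congr 1
  push_cast
  ring

theorem hasDerivAt_sq_rpow {d : ℝ} (hd : d ≠ 0) (p : ℝ) :
    HasDerivAt (fun d : ℝ => (d ^ 2) ^ p) (2 * p * (d * (d ^ 2) ^ (p - 1))) d := by
  have h := (hasDerivAt_pow 2 d).rpow_const (p := p) (Or.inl (pow_ne_zero 2 hd))
  refine h.congr_deriv ?_
  push_cast
  ring

theorem hasDerivAt_deriv_abs_rpow {d : ℝ} (hd : d ≠ 0) (γ : ℝ) :
    HasDerivAt (deriv fun d : ℝ => |d| ^ γ) (γ * (γ - 1) * |d| ^ (γ - 2)) d := by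
  have e : (fun d : ℝ => |d| ^ γ) = fun d => (d ^ 2) ^ (γ / 2) :=
    funext fun d => abs_rpow_eq_sq_rpow d γ
  have h1 : (deriv fun d : ℝ => |d| ^ γ) =ᶠ[nhds d]
      fun d => 2 * (γ / 2) * (d * (d ^ 2) ^ (γ / 2 - 1)) := by
    filter_upwards [isOpen_ne.mem_nhds hd] with z hz
    rw [e, (hasDerivAt_sq_rpow hz _).deriv]
  refine HasDerivAt.congr_of_eventuallyEq ?_ h1
  have h2 := ((hasDerivAt_id d).mul (hasDerivAt_sq_rpow hd (γ / 2 - 1))).const_mul (2 * (γ / 2))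
  refine h2.congr_deriv ?_
  have hpos : 0 < d ^ 2 := by positivity
  rw [abs_rpow_eq_sq_rpow, show (γ - 2) / 2 = γ / 2 - 1 by ring, Real.rpow_sub_one hpos.ne' (γ / 2 - 1)]
  simp only [id]
  field_simp
  ring

theorem differentiableAt_abs_rpow {d : ℝ} (hd : d ≠ 0) (γ : ℝ) :
    DifferentiableAt ℝ (fun d : ℝ => |d| ^ γ) d := by
  have e : (fun d : ℝ => |d| ^ γ) = fun d => (d ^ 2) ^ (γ / 2) :=
    funext fun d => abs_rpow_eq_sq_rpow d γ
  rw [e]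
  exact (hasDerivAt_sq_rpow hd _).differentiableAt

/-- If `c > 0` the point would also be a local minimum, so `f` would be locally constant and `c`
would vanish. -/
theorem second_deriv_nonpos_of_isLocalMax {f : ℝ → ℝ} {x c : ℝ} (hf : ContinuousAt f x)
    (h2 : HasDerivAt (deriv f) c x) (hmax : IsLocalMax f x) : c ≤ 0 := by
  by_contra! hc
  have hmin := isLocalMin_of_deriv_deriv_pos (by rw [h2.deriv]; exact hc) hmax.deriv_eq_zero hf
  have hconst : f =ᶠ[nhds x] fun _ => f x := by
    filter_upwards [hmax, hmin] with y h1 h2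
    exact le_antisymm h1 h2
  have := hconst.deriv.deriv_eq
  rw [h2.deriv] at this
  simp at this
  linarith

/-- At a point where the smoothing of `w` minus `b |· - y|^γ` is maximal on `[0,1]`, boundary points
included, the second derivative test holds. -/
theorem IsMollifier.second_deriv_le_of_max {ε : ℝ} {ρ : ℝ → ℝ} (h : IsMollifier ε ρ)
    (hε : ε < 1 / 2) {w : ℝ → ℝ} (hw : IntegrableOn w (Icc 0 1)) {b γ x y : ℝ} (hb : 0 ≤ b)
    (hγ : 0 ≤ γ) (hx : x ∈ Icc (0 : ℝ) 1) (hy : y ∈ Icc (0 : ℝ) 1) (hxy : x ≠ y)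
    (hmax : ∀ᶠ x' in nhdsWithin x (Icc 0 1),
      smoothing w ρ x' - b * |x' - y| ^ γ ≤ smoothing w ρ x - b * |x - y| ^ γ) :
    smoothing w (deriv (deriv ρ)) x ≤ b * (γ * (γ - 1) * |x - y| ^ (γ - 2)) := by
  set f : ℝ → ℝ := fun x' => smoothing w ρ x' - b * |x' - y| ^ γ with hf
  have hsub : x - y ≠ 0 := sub_ne_zero.2 hxy
  have hSd : ∀ z, DifferentiableAt ℝ (smoothing w ρ) z := fun z =>
    (h.hasDerivAt_smoothing hw z).differentiableAt
  have hpd : ∀ z, z ≠ y → DifferentiableAt ℝ (fun x' => b * |x' - y| ^ γ) z := fun z hz =>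
    ((differentiableAt_abs_rpow (sub_ne_zero.2 hz) γ).comp z
      (differentiableAt_id.sub_const y)).const_mul b
  have hcont : ContinuousAt f x := ((hSd x).sub (hpd x hxy)).continuousAt
  have hdf : deriv f =ᶠ[nhds x] fun z =>
      deriv (smoothing w ρ) z - b * (deriv (fun d : ℝ => |d| ^ γ)) (z - y) := by
    filter_upwards [isOpen_ne.mem_nhds hxy] with z hz
    have h1 : HasDerivAt (fun x' => b * |x' - y| ^ γ)
        (b * (deriv (fun d : ℝ => |d| ^ γ)) (z - y)) z :=
      ((differentiableAt_abs_rpow (sub_ne_zero.2 hz) γ).hasDerivAt.comp_sub_const z y).const_mul b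
    exact ((hSd z).hasDerivAt.sub h1).deriv
  have h2 : HasDerivAt (deriv f) (smoothing w (deriv (deriv ρ)) x -
      b * (γ * (γ - 1) * |x - y| ^ (γ - 2))) x := by
    refine HasDerivAt.congr_of_eventuallyEq ?_ hdf
    exact (h.hasDerivAt_deriv_smoothing hw x).sub
      (((hasDerivAt_deriv_abs_rpow hsub γ).comp_sub_const x y).const_mul b)
  have hfold_mem : ∀ x' ∈ Icc (-(1 / 2) : ℝ) (3 / 2), 1 - |1 - (|x'|)| ∈ Icc (0 : ℝ) 1 := by
    intro x' hx'
    have h1 : |x'| ≤ 2 := abs_le.2 ⟨by linarith [hx'.1], by linarith [hx'.2]⟩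
    refine ⟨?_, by linarith [abs_nonneg (1 - |x'|)]⟩
    have : |1 - (|x'|)| ≤ 1 := abs_le.2 ⟨by linarith, by linarith [abs_nonneg x']⟩
    linarith
  have hfold_le : ∀ x' y', y' ∈ Icc (0 : ℝ) 1 → |1 - |1 - (|x'|)| - y'| ≤ |x' - y'| := by
    intro x' y' hy'
    have e : y' = 1 - |1 - (|y'|)| := by
      rw [abs_of_nonneg hy'.1, abs_of_nonneg (by linarith [hy'.2])]; ring
    conv_lhs => rw [e]
    have h1 := abs_abs_sub_abs_le_abs_sub (1 - |x'|) (1 - |y'|)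
    have h2 := abs_abs_sub_abs_le_abs_sub x' y'
    rw [show 1 - |1 - (|x'|)| - (1 - |1 - (|y'|)|) = -(|1 - (|x'|)| - |1 - (|y'|)|) by ring, abs_neg]
    rw [show 1 - |x'| - (1 - |y'|) = -(|x'| - |y'|) by ring, abs_neg] at h1
    exact h1.trans h2
  -- Folding leaves the smoothing unchanged and, being 1-Lipschitz and fixing `y`, does not increase
  -- the distance to `y`. So `f` does not decrease under folding, and a maximum relative to `[0,1]`
  -- is a local maximum on the line.
  have hlm : IsLocalMax f x := by
    have hfc : ContinuousAt (fun x' : ℝ => 1 - |1 - (|x'|)|) x := by fun_prop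
    have hfx : (1 : ℝ) - |1 - (|x|)| = x := by
      rw [abs_of_nonneg hx.1, abs_of_nonneg (by linarith [hx.2])]; ring
    have hnear : ∀ᶠ x' in nhds x, x' ∈ Icc (-(1 / 2) : ℝ) (3 / 2) :=
      Icc_mem_nhds (by linarith [hx.1]) (by linarith [hx.2])
    have htend : Filter.Tendsto (fun x' : ℝ => 1 - |1 - (|x'|)|) (nhds x)
        (nhdsWithin x (Icc 0 1)) := by
      refine tendsto_nhdsWithin_iff.2 ⟨?_, hnear.mono hfold_mem⟩
      conv => arg 3; rw [← hfx]
      exact hfc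
    filter_upwards [htend.eventually hmax, hnear] with x' h1 h2
    refine le_trans ?_ h1
    simp only [hf]
    rw [h.smoothing_fold hε w h2]
    have := Real.rpow_le_rpow (abs_nonneg _) (hfold_le x' y hy) hγ
    nlinarith
  linarith [second_deriv_nonpos_of_isLocalMax hcont h2 hlm]

/-- One-sided first derivative test for an integral. -/
theorem le_of_forall_le_intervalIntegral {a B : ℝ → ℝ} {t₀ t₁ t b κ : ℝ} (ht : t ∈ Ioc t₀ t₁)
    (ha : ContinuousOn a (Icc t₀ t₁)) (hB : HasDerivAt B b t)
    (h : ∀ᶠ s in nhdsWithin t (Iio t), B t - B s + κ * (t - s) ≤ ∫ r in s..t, a r) :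
    b + κ ≤ a t := by
  have h01 : t₀ ≤ t₁ := ht.1.le.trans ht.2
  set a' : ℝ → ℝ := IccExtend h01 (domRestrict (Icc t₀ t₁) a) with ha'
  have hc : Continuous a' := (continuousOn_iff_continuous_domRestrict.1 ha).Icc_extend'
  have heq : ∀ s ∈ Icc t₀ t₁, a' s = a s := fun s hs => by
    rw [ha', IccExtend_of_mem _ _ hs]; rfl
  have htI : t ∈ Icc t₀ t₁ := Ioc_subset_Icc_self ht
  -- The hypothesis says `H s ≤ H t` for `s < t` close to `t`, so `H' t ≥ 0`.
  set H : ℝ → ℝ := fun s => (∫ r in t₀..s, a' r) - B s - κ * s with hH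
  have hHd : HasDerivAt H (a t - b - κ) t := by
    have h1 := (hc.integral_hasStrictDerivAt t₀ t).hasDerivAt
    rw [heq t htI] at h1
    have h2 := (hasDerivAt_id t).const_mul κ
    exact ((h1.sub hB).sub h2).congr_deriv (by ring)
  have hslope := (hasDerivAt_iff_tendsto_slope.1 hHd).mono_left
    (nhdsWithin_mono t (show Iio t ⊆ {t}ᶜ from fun s hs => ne_of_lt hs))
  have : 0 ≤ a t - b - κ := by
    refine ge_of_tendsto hslope ?_
    have hgt : ∀ᶠ s in nhdsWithin t (Iio t), t₀ < s :=
      (lt_mem_nhds ht.1).filter_mono nhdsWithin_le_nhds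
    filter_upwards [h, hgt, self_mem_nhdsWithin] with s hs hs0 hst
    have hst' : s < t := hst
    have e : ∫ r in s..t, a r = (∫ r in t₀..t, a' r) - ∫ r in t₀..s, a' r := by
      rw [intervalIntegral.integral_interval_sub_left (hc.intervalIntegrable _ _)
        (hc.intervalIntegrable _ _)]
      refine intervalIntegral.integral_congr fun r hr => (heq r ?_).symm
      rw [uIcc_of_le hst'.le] at hr
      exact ⟨hs0.le.trans hr.1, hr.2.trans ht.2⟩
    rw [e] at hs
    rw [slope_def_field]
    refine div_nonneg_of_nonpos ?_ (by linarith)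
    simp only [hH]
    linarith
  linarith

/-! ### Hölder estimate for the obstacle problem without source. -/

/-- `v` solves `∂ₜ v - ∂ₓₓ v = η - ξ` on `[0,1] × [t₀, t₁]` with Neumann boundary conditions,
`k₁ ≤ v ≤ k₂`, and `η`, `ξ` only act where `v` touches `k₁`, `k₂`. -/
structure IsObstacleSolution (t₀ t₁ : ℝ) (k₁ k₂ v : ℝ → ℝ → ℝ) (η ξ : Measure (ℝ × ℝ)) : Prop where
  cont : Continuous fun p : ℝ × ℝ => v p.1 p.2
  cont₁ : Continuous fun p : ℝ × ℝ => k₁ p.1 p.2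
  cont₂ : Continuous fun p : ℝ × ℝ => k₂ p.1 p.2
  lower : ∀ x ∈ Icc (0 : ℝ) 1, ∀ t ∈ Icc t₀ t₁, k₁ x t ≤ v x t
  upper : ∀ x ∈ Icc (0 : ℝ) 1, ∀ t ∈ Icc t₀ t₁, v x t ≤ k₂ x t
  contact_η : ∀ᵐ p ∂η.restrict (Icc 0 1 ×ˢ Ioc t₀ t₁), v p.1 p.2 = k₁ p.1 p.2
  contact_ξ : ∀ᵐ p ∂ξ.restrict (Icc 0 1 ×ˢ Ioc t₀ t₁), v p.1 p.2 = k₂ p.1 p.2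
  weak : ∀ s t, t₀ ≤ s → s ≤ t → t ≤ t₁ → ∀ φ : ℝ → ℝ, ContDiff ℝ ∞ φ →
    deriv φ 0 = 0 → deriv φ 1 = 0 →
    (∫ x in Icc 0 1, v x t * φ x) - (∫ x in Icc 0 1, v x s * φ x) =
      (∫ r in s..t, ∫ x in Icc 0 1, v x r * deriv (deriv φ) x)
        + (∫ p in Icc 0 1 ×ˢ Ioc s t, φ p.1 ∂η) - ∫ p in Icc 0 1 ×ˢ Ioc s t, φ p.1 ∂ξ

namespace IsObstacleSolution

variable {t₀ t₁ : ℝ} {k₁ k₂ v : ℝ → ℝ → ℝ} {η ξ : Measure (ℝ × ℝ)}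

/-- The symmetry exchanging the two obstacles; it turns each upper estimate into a lower one. -/
theorem neg (h : IsObstacleSolution t₀ t₁ k₁ k₂ v η ξ) :
    IsObstacleSolution t₀ t₁ (fun x t => -k₂ x t) (fun x t => -k₁ x t) (fun x t => -v x t) ξ η where
  cont := h.cont.neg
  cont₁ := h.cont₂.neg
  cont₂ := h.cont₁.neg
  lower x hx t ht := neg_le_neg (h.upper x hx t ht)
  upper x hx t ht := neg_le_neg (h.lower x hx t ht)
  contact_η := h.contact_ξ.mono fun p hp => by rw [hp]
  contact_ξ := h.contact_η.mono fun p hp => by rw [hp]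
  weak s t hs hst ht φ hφ h0 h1 := by
    have := h.weak s t hs hst ht φ hφ h0 h1
    simp only [neg_mul, integral_neg, intervalIntegral.integral_neg]
    linarith

theorem continuous_smoothing (h : IsObstacleSolution t₀ t₁ k₁ k₂ v η ξ) {p : ℝ → ℝ}
    (hp : Continuous p) : Continuous fun q : ℝ × ℝ => smoothing (fun x => v x q.2) p q.1 := by
  unfold smoothing foldKernel
  refine continuous_parametric_integral_of_continuous
    (f := fun (q : ℝ × ℝ) z => v z q.2 * (p (q.1 - z) + p (-q.1 - z) + p (2 - q.1 - z))) ?_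
    isCompact_Icc
  have h1 : Continuous fun q : (ℝ × ℝ) × ℝ => v q.2 q.1.2 :=
    h.cont.comp (continuous_snd.prodMk (continuous_snd.comp continuous_fst))
  refine h1.mul ?_
  fun_prop

/-- Away from the lower obstacle the smoothed function is a subsolution of the heat equation: `η`
does not charge the support of the kernel, and `ξ` only pushes down. -/
theorem smoothing_sub_le (h : IsObstacleSolution t₀ t₁ k₁ k₂ v η ξ) {ε : ℝ} {ρ : ℝ → ℝ}
    (hρ : IsMollifier ε ρ) (hε : ε < 1 / 2) {x s t : ℝ} (hx : x ∈ Icc (0 : ℝ) 1) (hs : t₀ ≤ s)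
    (hst : s ≤ t) (ht : t ≤ t₁)
    (hfree : ∀ z ∈ Icc (0 : ℝ) 1, ∀ r ∈ Ioc s t, |x - z| < ε → k₁ z r < v z r) :
    smoothing (fun x => v x t) ρ x - smoothing (fun x => v x s) ρ x ≤
      ∫ r in s..t, smoothing (fun x => v x r) (deriv (deriv ρ)) x := by
  have H := h.weak s t hs hst ht (foldKernel ρ x) (hρ.contDiff_foldKernel x)
    (hρ.deriv_foldKernel_zero hε hx) (hρ.deriv_foldKernel_one hε hx)
  simp only [hρ.deriv_deriv_foldKernel] at H
  have hη : ∫ p in Icc (0 : ℝ) 1 ×ˢ Ioc s t, foldKernel ρ x p.1 ∂η = 0 := by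
    refine integral_eq_zero_of_ae ?_
    have hsub : Icc (0 : ℝ) 1 ×ˢ Ioc s t ⊆ Icc (0 : ℝ) 1 ×ˢ Ioc t₀ t₁ :=
      prod_mono subset_rfl (Ioc_subset_Ioc hs ht)
    filter_upwards [ae_restrict_of_ae_restrict_of_subset hsub h.contact_η,
      ae_restrict_mem (measurableSet_Icc.prod measurableSet_Ioc)] with p hp hpm
    by_contra hne
    refine (hfree p.1 hpm.1 p.2 hpm.2 ?_).ne' hp
    by_contra! hge
    exact hne (hρ.foldKernel_eq_zero hx hpm.1 hge)
  have hξ : 0 ≤ ∫ p in Icc (0 : ℝ) 1 ×ˢ Ioc s t, foldKernel ρ x p.1 ∂ξ :=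
    integral_nonneg fun p => hρ.foldKernel_nonneg x p.1
  unfold smoothing
  linarith

/-- The balance at the maximum point, with `r = |a - b|²`, `P = |a - b|^(γ-2)`, `τ` the elapsed time
and `T = τ^(-3/2)`. Concavity contributes `-2γ(1-γ)(M + AτT)P` and the decay of `β` costs `½ A T r
P`. The former wins as soon as `r ≤ 4γ(1-γ)τ`, which dictates the constant `4γ(1-γ)`. -/
theorem nonpos_of_barrier_inequalities {M A γ P T τ r m X Y : ℝ} (hM : 0 ≤ M) (hA : 0 ≤ A)
    (hγ0 : 0 ≤ γ) (hγ1 : 0 ≤ 1 - γ) (hP : 0 ≤ P) (hT : 0 ≤ T)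
    (hr : r ≤ 4 * γ * (1 - γ) * τ) (h : A * (-(1 / 2) * T) * (r * P) + m ≤ X - Y)
    (hX : X ≤ (M + A * (τ * T)) * (γ * (γ - 1) * P))
    (hY : -Y ≤ (M + A * (τ * T)) * (γ * (γ - 1) * P)) : m ≤ 0 := by
  have h1 : 0 ≤ M * (γ * (1 - γ) * P) := by positivity
  have h2 : 0 ≤ A * T * P * (4 * γ * (1 - γ) * τ - r) :=
    mul_nonneg (by positivity) (by linarith)
  linarith

set_option maxHeartbeats 800000 in
/-- Regularisation of the spatial Hölder modulus for the obstacle problem, by doubling of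
variables and the maximum principle. -/
theorem sub_le (h : IsObstacleSolution t₀ t₁ k₁ k₂ v η ξ) (hlen : t₁ ≤ t₀ + 1)
    {γ M N : ℝ} (hγ0 : 0 < γ) (hγ1 : γ < 1) (hM : 0 ≤ M)
    (hk₁ : ∀ x ∈ Icc (0 : ℝ) 1, ∀ y ∈ Icc (0 : ℝ) 1, ∀ t ∈ Icc t₀ t₁,
      k₁ x t - k₁ y t ≤ M * |x - y| ^ γ)
    (hk₂ : ∀ x ∈ Icc (0 : ℝ) 1, ∀ y ∈ Icc (0 : ℝ) 1, ∀ t ∈ Icc t₀ t₁,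
      k₂ x t - k₂ y t ≤ M * |x - y| ^ γ)
    (hosc : ∀ x ∈ Icc (0 : ℝ) 1, ∀ y ∈ Icc (0 : ℝ) 1, ∀ t ∈ Icc t₀ t₁,
      v x t - v y t ≤ N + M * |x - y| ^ γ)
    {x y t : ℝ} (hx : x ∈ Icc (0 : ℝ) 1) (hy : y ∈ Icc (0 : ℝ) 1) (ht : t ∈ Ioc t₀ t₁) :
    v x t - v y t ≤
      (M + N / (4 * γ * (1 - γ)) * (t - t₀) ^ (-(1 / 2) : ℝ)) * |x - y| ^ γ := by
  by_contra! hcon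
  set c := 4 * γ * (1 - γ) with hc
  have hγ' : 0 < 1 - γ := by linarith
  have hc0 : 0 < c := by positivity
  have hc1 : c ≤ 1 := by nlinarith [sq_nonneg (2 * γ - 1)]
  have hN : 0 ≤ N := by
    have := hosc x hx x hx t (Ioc_subset_Icc_self ht)
    simp [Real.zero_rpow hγ0.ne'] at this
    exact this
  set A := N / c with hA
  have hA0 : 0 ≤ A := by positivity
  set β : ℝ → ℝ := fun t => M + A * (t - t₀) ^ (-(1 / 2) : ℝ) with hβ
  have hβM : ∀ t, t₀ < t → M ≤ β t := fun t ht => by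
    have : 0 ≤ (t - t₀) ^ (-(1 / 2) : ℝ) := Real.rpow_nonneg (by linarith) _
    simp only [hβ]
    nlinarith
  -- Of the excess `4m`, the four smoothing errors of size `m / 4` cost `m` and the time penalty
  -- costs at most another `m`, as the window has length at most `1`. An excess above `m` survives
  -- at the maximum of the penalised functional.
  obtain ⟨m, hm, hmdef⟩ : ∃ m, 0 < m ∧ 4 * m = v x t - v y t - β t * |x - y| ^ γ :=
    ⟨(v x t - v y t - β t * |x - y| ^ γ) / 4, by
      have : 0 < v x t - v y t - β t * |x - y| ^ γ := sub_pos.2 hcon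
      positivity, by ring⟩
  have hcD : IsCompact (Icc (0 : ℝ) 1 ×ˢ Icc t₀ t₁) := isCompact_Icc.prod isCompact_Icc
  have hmod : ∀ f : ℝ × ℝ → ℝ, Continuous f → ∃ δ > 0, ∀ p ∈ Icc (0 : ℝ) 1 ×ˢ Icc t₀ t₁,
      ∀ q ∈ Icc (0 : ℝ) 1 ×ˢ Icc t₀ t₁, |p.1 - q.1| < δ → |p.2 - q.2| < δ →
      |f p - f q| < m / 4 := by
    intro f hf
    obtain ⟨δ, hδ, H⟩ := Metric.uniformContinuousOn_iff.1
      (hcD.uniformContinuousOn_of_continuous hf.continuousOn) (m / 4) (by positivity)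
    refine ⟨δ, hδ, fun p hp q hq h1 h2 => ?_⟩
    have := H p hp q hq (by rw [Prod.dist_eq, Real.dist_eq, Real.dist_eq]; exact max_lt h1 h2)
    rwa [Real.dist_eq] at this
  obtain ⟨δ₀, hδ₀, hv⟩ := hmod _ h.cont
  obtain ⟨δ₁, hδ₁, hv₁⟩ := hmod _ (h.cont.sub h.cont₁)
  obtain ⟨δ₂, hδ₂, hv₂⟩ := hmod _ (h.cont₂.sub h.cont)
  -- points where the excess is at least `m`
  have hloc : ∀ x ∈ Icc (0 : ℝ) 1, ∀ y ∈ Icc (0 : ℝ) 1, ∀ t ∈ Ioc t₀ t₁,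
      m + β t * |x - y| ^ γ < v x t - v y t →
      δ₀ ≤ |x - y| ∧ |x - y| ^ 2 < c * (t - t₀) := by
    intro x hx y hy t ht hlt
    have htI := Ioc_subset_Icc_self ht
    have hp0 : 0 ≤ |x - y| ^ γ := Real.rpow_nonneg (abs_nonneg _) _
    have hβ0 : 0 ≤ β t := hM.trans (hβM t ht.1)
    constructor
    · by_contra! hlt'
      have := hv (x, t) ⟨hx, htI⟩ (y, t) ⟨hy, htI⟩ hlt' (by simpa using hδ₀)
      have h2 := (abs_lt.1 this).2
      simp only at h2
      nlinarith
    -- For `|x - y|² ≥ c (t - t₀)`, the inequalities `c ≤ 1` and `|x - y| ≤ 1` give `|x - y|^γ ≥ c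
    -- √(t - t₀)`. The singular part of `β` then already absorbs `N`, contradicting `hosc`.
    · by_contra! hge
      have h1 := hosc x hx y hy t htI
      have hr1 : |x - y| ≤ 1 := abs_le.2 ⟨by linarith [hx.1, hy.2], by linarith [hx.2, hy.1]⟩
      have hτ : 0 < t - t₀ := by linarith [ht.1]
      have hτ1 : t - t₀ ≤ 1 := by linarith [ht.2]
      have hrpos : 0 < |x - y| := by
        rcases (abs_nonneg (x - y)).eq_or_lt with h0 | h0
        · rw [← h0] at hge
          nlinarith
        · exact h0
      have hrγ : |x - y| ≤ |x - y| ^ γ := by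
        have := Real.rpow_le_rpow_of_exponent_ge hrpos hr1 hγ1.le
        rwa [Real.rpow_one] at this
      have hsq : c * √(t - t₀) ≤ |x - y| := by
        refine abs_le_of_sq_le_sq' ?_ hrpos.le |>.2
        rw [mul_pow, Real.sq_sqrt hτ.le]
        nlinarith
      have hrp : (t - t₀) ^ (-(1 / 2) : ℝ) = (√(t - t₀))⁻¹ := by
        rw [Real.rpow_neg hτ.le, Real.sqrt_eq_rpow]
      have hsp : 0 < √(t - t₀) := Real.sqrt_pos.2 hτ
      have hNle : N ≤ A * (t - t₀) ^ (-(1 / 2) : ℝ) * |x - y| ^ γ := by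
        rw [hrp, hA]
        have h3 : c * √(t - t₀) ≤ |x - y| ^ γ := hsq.trans hrγ
        calc N = N / c * (√(t - t₀))⁻¹ * (c * √(t - t₀)) := by field_simp
          _ ≤ _ := mul_le_mul_of_nonneg_left h3 (by positivity)
      simp only [hβ] at hlt
      nlinarith
  set r₀ := min δ₀ 1 with hr₀
  have hr₀pos : 0 < r₀ := lt_min hδ₀ one_pos
  set ε := min (min δ₀ δ₁) (min δ₂ (1 / 4)) with hεdef
  have hε0 : 0 < ε := by
    simp only [hεdef, lt_min_iff]
    exact ⟨⟨hδ₀, hδ₁⟩, hδ₂, by norm_num⟩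
  have hεle : (ε ≤ δ₀ ∧ ε ≤ δ₁) ∧ ε ≤ δ₂ ∧ ε ≤ 1 / 4 := by
    have := le_refl ε
    conv_rhs at this => rw [hεdef]
    simpa only [le_min_iff] using this
  obtain ⟨⟨hε₀, hε₁⟩, hε₂, hε4⟩ := hεle
  have hεh : ε < 1 / 2 := by linarith
  obtain ⟨ρ, hρ⟩ := exists_isMollifier hε0
  set S : ℝ → ℝ → ℝ := fun x t => smoothing (fun x => v x t) ρ x with hS
  set S'' : ℝ → ℝ → ℝ := fun x t => smoothing (fun x => v x t) (deriv (deriv ρ)) x with hS''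
  have hSc : Continuous fun q : ℝ × ℝ => S q.1 q.2 := h.continuous_smoothing hρ.smooth.continuous
  have hSc'' : Continuous fun q : ℝ × ℝ => S'' q.1 q.2 :=
    h.continuous_smoothing hρ.smooth_deriv_deriv.continuous
  have hvc : ∀ t, Continuous fun x => v x t := fun t =>
    h.cont.comp (continuous_id.prodMk continuous_const)
  have hSv : ∀ x ∈ Icc (0 : ℝ) 1, ∀ t ∈ Icc t₀ t₁, |S x t - v x t| ≤ m / 4 := by
    intro x hx t ht
    refine hρ.abs_smoothing_sub_le hεh (hvc t).continuousOn hx fun z hz hxz => ?_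
    exact (hv (z, t) ⟨hz, ht⟩ (x, t) ⟨hx, ht⟩ (by rw [abs_sub_comm]; exact hxz.trans_le hε₀)
      (by simpa using hδ₀)).le
  -- the penalised functional and its maximum
  set Ψ : ℝ × ℝ × ℝ → ℝ := fun q =>
    S q.1 q.2.2 - S q.2.1 q.2.2 - β q.2.2 * |q.1 - q.2.1| ^ γ - m * (q.2.2 - t₀) with hΨ
  -- The cut-offs avoid the singularities of `|x - y|^γ` on the diagonal and of `β` at `t₀`. By
  -- `hmemD`, points with excess above `m` stay strictly inside both, so the cut-offs create no
  -- spurious maximum.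
  set D : Set (ℝ × ℝ × ℝ) := (Icc 0 1 ×ˢ Icc 0 1 ×ˢ Icc (t₀ + r₀ ^ 2) t₁) ∩
    {q | r₀ / 2 ≤ |q.1 - q.2.1|} with hD
  have hDc : IsCompact D := (isCompact_Icc.prod (isCompact_Icc.prod isCompact_Icc)).inter_right
    (isClosed_le continuous_const (by fun_prop))
  have hmemD : ∀ x ∈ Icc (0 : ℝ) 1, ∀ y ∈ Icc (0 : ℝ) 1, ∀ t ∈ Ioc t₀ t₁,
      m + β t * |x - y| ^ γ < v x t - v y t →
      r₀ / 2 < |x - y| ∧ t₀ + r₀ ^ 2 < t := by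
    intro x hx y hy t ht hlt
    obtain ⟨h1, h2⟩ := hloc x hx y hy t ht hlt
    have h3 : r₀ ≤ |x - y| := (min_le_left _ _).trans h1
    refine ⟨by linarith, ?_⟩
    have : 0 < t - t₀ := by linarith [ht.1]
    nlinarith
  have hPD : (x, y, t) ∈ D := by
    obtain ⟨h1, h2⟩ := hmemD x hx y hy t ht (by linarith)
    exact ⟨⟨hx, hy, h2.le, ht.2⟩, h1.le⟩
  have hΨc : ContinuousOn Ψ D := by
    have h1 : Continuous fun q : ℝ × ℝ × ℝ => S q.1 q.2.2 :=
      hSc.comp (continuous_fst.prodMk (continuous_snd.comp continuous_snd))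
    have h2 : Continuous fun q : ℝ × ℝ × ℝ => S q.2.1 q.2.2 :=
      hSc.comp continuous_snd
    have h3 : ContinuousOn (fun q : ℝ × ℝ × ℝ => (q.2.2 - t₀) ^ (-(1 / 2) : ℝ)) D := by
      refine ContinuousOn.rpow_const (by fun_prop) fun q hq => Or.inl ?_
      have := hq.1.2.2.1
      have := pow_pos hr₀pos 2
      linarith
    have h4 : Continuous fun q : ℝ × ℝ × ℝ => |q.1 - q.2.1| ^ γ :=
      (by fun_prop : Continuous fun q : ℝ × ℝ × ℝ => |q.1 - q.2.1|).rpow_const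
        fun q => Or.inr hγ0.le
    exact ((h1.continuousOn.sub h2.continuousOn).sub
      ((continuousOn_const.add (continuousOn_const.mul h3)).mul h4.continuousOn)).sub
      (by fun_prop)
  obtain ⟨⟨a, b, τ⟩, hqD, hqmax⟩ := hDc.exists_isMaxOn ⟨_, hPD⟩ hΨc
  obtain ⟨⟨ha, hb, hτ1⟩, hrab⟩ := hqD
  simp only at ha hb hτ1
  have hr₀2 := pow_pos hr₀pos 2
  have hτ0 : t₀ < τ := by linarith [hτ1.1]
  have hτI : τ ∈ Icc t₀ t₁ := ⟨hτ0.le, hτ1.2⟩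
  have hex : m + β τ * |a - b| ^ γ < v a τ - v b τ := by
    have h1 : Ψ (x, y, t) ≤ Ψ (a, b, τ) := hqmax hPD
    simp only [hΨ] at h1
    have h2 := abs_le.1 (hSv x hx t (Ioc_subset_Icc_self ht))
    have h3 := abs_le.1 (hSv y hy t (Ioc_subset_Icc_self ht))
    have h4 := abs_le.1 (hSv a ha τ hτI)
    have h5 := abs_le.1 (hSv b hb τ hτI)
    have h6 : m * (t - t₀) ≤ m * 1 := mul_le_mul_of_nonneg_left (by linarith [ht.2]) hm.le
    have h7 : 0 ≤ m * (τ - t₀) := mul_nonneg hm.le (by linarith)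
    linarith
  obtain ⟨hrlt, hτlt⟩ := hmemD a ha b hb τ ⟨hτ0, hτ1.2⟩ hex
  obtain ⟨-, hrc⟩ := hloc a ha b hb τ ⟨hτ0, hτ1.2⟩ hex
  have hab : a ≠ b := by
    rintro rfl
    simp at hrlt
    linarith
  have hrpos : 0 < |a - b| := abs_pos.2 (sub_ne_zero.2 hab)
  have hβτ : 0 ≤ β τ := hM.trans (hβM τ hτ0)
  have hrγ0 : 0 ≤ |a - b| ^ γ := Real.rpow_nonneg (abs_nonneg _) _
  have hMβ : M * |a - b| ^ γ ≤ β τ * |a - b| ^ γ :=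
    mul_le_mul_of_nonneg_right (hβM τ hτ0) hrγ0
  -- second derivative tests
  have hxx : S'' a τ ≤ β τ * (γ * (γ - 1) * |a - b| ^ (γ - 2)) := by
    refine hρ.second_deriv_le_of_max hεh (hvc τ).continuousOn.integrableOn_Icc hβτ hγ0.le ha hb
      hab ?_
    have hopen : ∀ᶠ x' in nhds a, r₀ / 2 < |x' - b| :=
      (by fun_prop : ContinuousAt (fun x' : ℝ => |x' - b|) a).eventually (lt_mem_nhds hrlt)
    filter_upwards [hopen.filter_mono nhdsWithin_le_nhds, self_mem_nhdsWithin] with x' h1 h2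
    have h3 : Ψ (x', b, τ) ≤ Ψ (a, b, τ) := hqmax ⟨⟨h2, hb, hτ1⟩, h1.le⟩
    simp only [hΨ, hS] at h3
    linarith
  have hneg : ∀ (p : ℝ → ℝ) z, smoothing (fun x => -v x τ) p z =
      -smoothing (fun x => v x τ) p z := fun p z => by
    unfold smoothing
    simp only [neg_mul, integral_neg]
  have hyy : -S'' b τ ≤ β τ * (γ * (γ - 1) * |a - b| ^ (γ - 2)) := by
    have := hρ.second_deriv_le_of_max (w := fun x => -v x τ) (b := β τ) (γ := γ) (x := b) (y := a)
      hεh (hvc τ).neg.continuousOn.integrableOn_Icc hβτ hγ0.le hb ha hab.symm (by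
        have hopen : ∀ᶠ y' in nhds b, r₀ / 2 < |a - y'| :=
          (by fun_prop : ContinuousAt (fun y' : ℝ => |a - y'|) b).eventually (lt_mem_nhds hrlt)
        filter_upwards [hopen.filter_mono nhdsWithin_le_nhds, self_mem_nhdsWithin] with y' h1 h2
        have h3 : Ψ (a, y', τ) ≤ Ψ (a, b, τ) := hqmax ⟨⟨ha, h2, hτ1⟩, h1.le⟩
        simp only [hΨ, hS] at h3
        rw [hneg, hneg, abs_sub_comm y', abs_sub_comm b]
        linarith)
    rwa [hneg, abs_sub_comm b] at this
  -- the reflection measures are inactive near the two points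
  have hnear : ∀ᶠ s in nhdsWithin τ (Iio τ), t₀ + r₀ ^ 2 < s ∧ τ - ε < s :=
    ((lt_mem_nhds hτlt).and (lt_mem_nhds (by linarith))).filter_mono nhdsWithin_le_nhds
  -- `v b ≥ k₁ b ≥ k₁ a - M |a - b|^γ`, and `β ≥ M`, so the excess at `(a, b)` separates `v` from
  -- the lower obstacle at `a`. `hfree₂` is symmetric at `b`.
  have hfree₁ : m < v a τ - k₁ a τ := by
    have h1 := h.lower b hb τ hτI
    have h2 := hk₁ a ha b hb τ hτI
    linarith
  have hfree₂ : m < k₂ b τ - v b τ := by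
    have h1 := h.upper a ha τ hτI
    have h2 := hk₂ a ha b hb τ hτI
    linarith
  -- Only earlier times are compared, since `τ` may be the final time `t₁`. The term `m (τ - s)`
  -- comes from the time penalty and supplies the strict inequality.
  have htime : ∀ᶠ s in nhdsWithin τ (Iio τ),
      β τ * |a - b| ^ γ - β s * |a - b| ^ γ + m * (τ - s) ≤ ∫ r in s..τ, (S'' a r - S'' b r) := by
    filter_upwards [hnear, self_mem_nhdsWithin] with s hs hsτ
    have hsτ' : s < τ := hsτ
    have hs0 : t₀ ≤ s := by linarith [hs.1]
    have h1 : Ψ (a, b, s) ≤ Ψ (a, b, τ) := hqmax ⟨⟨ha, hb, hs.1.le, hsτ'.le.trans hτ1.2⟩, hrab⟩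
    simp only [hΨ] at h1
    have h2 : S a τ - S a s ≤ ∫ r in s..τ, S'' a r :=
      h.smoothing_sub_le hρ hεh ha hs0 hsτ'.le hτ1.2 fun z hz r hr hz' => by
        have := hv₁ (a, τ) ⟨ha, hτI⟩ (z, r) ⟨hz, hs0.trans hr.1.le, hr.2.trans hτ1.2⟩
          (hz'.trans_le hε₁) (by
            simp only
            rw [abs_of_nonneg (by linarith [hr.2])]
            linarith [hr.1, hs.2])
        have := (abs_lt.1 this).2
        simp only [Pi.sub_apply] at this
        linarith
    have h3 : -S b τ - -S b s ≤ ∫ r in s..τ, -S'' b r := by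
      have := h.neg.smoothing_sub_le hρ hεh hb hs0 hsτ'.le hτ1.2 fun z hz r hr hz' => by
        have := hv₂ (b, τ) ⟨hb, hτI⟩ (z, r) ⟨hz, hs0.trans hr.1.le, hr.2.trans hτ1.2⟩
          (hz'.trans_le hε₂) (by
            simp only
            rw [abs_of_nonneg (by linarith [hr.2])]
            linarith [hr.1, hs.2])
        have := (abs_lt.1 this).2
        simp only [Pi.sub_apply] at this
        linarith
      have hneg' : ∀ (p : ℝ → ℝ) z r, smoothing (fun x => -v x r) p z =
          -smoothing (fun x => v x r) p z := fun p z r => by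
        unfold smoothing
        simp only [neg_mul, integral_neg]
      simpa only [hneg'] using this
    have hi : ∀ z, IntervalIntegrable (fun r => S'' z r) volume s τ := fun z =>
      (hSc''.comp (continuous_const.prodMk continuous_id)).intervalIntegrable _ _
    rw [intervalIntegral.integral_neg] at h3
    rw [intervalIntegral.integral_sub (hi a) (hi b)]
    linarith
  have hτpos : 0 < τ - t₀ := by linarith
  have hβd : HasDerivAt (fun s => β s * |a - b| ^ γ)
      (A * (-(1 / 2) * (τ - t₀) ^ (-(1 / 2) - 1 : ℝ)) * |a - b| ^ γ) τ := by
    have h1 : HasDerivAt (fun s => (s - t₀) ^ (-(1 / 2) : ℝ))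
        (-(1 / 2) * (τ - t₀) ^ (-(1 / 2) - 1 : ℝ)) τ :=
      ((hasDerivAt_id τ).sub_const t₀).rpow_const (p := -(1 / 2)) (Or.inl hτpos.ne') |>.congr_deriv
        (by simp)
    exact ((h1.const_mul A).const_add M).mul_const _
  have hfin := le_of_forall_le_intervalIntegral ⟨hτ0, hτ1.2⟩
    (a := fun r => S'' a r - S'' b r) (by
      exact ((hSc''.comp (continuous_const.prodMk continuous_id)).sub
        (hSc''.comp (continuous_const.prodMk continuous_id))).continuousOn) hβd htime
  have e1 : |a - b| ^ γ = |a - b| ^ 2 * |a - b| ^ (γ - 2) := by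
    rw [← Real.rpow_natCast, ← Real.rpow_add hrpos]
    norm_num
  have e2 : (τ - t₀) ^ (-(1 / 2) : ℝ) = (τ - t₀) * (τ - t₀) ^ (-(1 / 2) - 1 : ℝ) := by
    rw [mul_comm, ← Real.rpow_add_one hτpos.ne']
    norm_num
  set P := |a - b| ^ (γ - 2) with hP
  set T := (τ - t₀) ^ (-(1 / 2) - 1 : ℝ) with hT
  have hP0 : 0 < P := Real.rpow_pos_of_pos hrpos _
  have hT0 : 0 < T := Real.rpow_pos_of_pos hτpos _
  have e3 : β τ = M + A * ((τ - t₀) * T) := by simp only [hβ, e2]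
  rw [e1] at hfin
  rw [e3] at hxx hyy
  exact absurd hm (not_lt.2 (nonpos_of_barrier_inequalities hM hA0 hγ0.le hγ'.le hP0.le hT0.le
    hrc.le hfin hxx hyy))

end IsObstacleSolution

/-! ### Cosine modes and their density. -/

/-- The Neumann eigenfunctions of `[0,1]`. -/
noncomputable def cosMode (k : ℕ) (x : ℝ) : ℝ := Real.cos (k * Real.pi * x)

theorem continuous_cosMode (k : ℕ) : Continuous (cosMode k) := by
  unfold cosMode
  fun_prop

theorem abs_cosMode_le (k : ℕ) (x : ℝ) : |cosMode k x| ≤ 1 := Real.abs_cos_le_one _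

theorem cosMode_zero (x : ℝ) : cosMode 0 x = 1 := by simp [cosMode]

theorem hasDerivAt_cosMode (k : ℕ) (x : ℝ) :
    HasDerivAt (cosMode k) (-(k * Real.pi) * Real.sin (k * Real.pi * x)) x := by
  have := ((hasDerivAt_id x).const_mul (k * Real.pi)).cos
  exact this.congr_deriv (by simp; ring)

theorem hasDerivAt_sinMode (k : ℕ) (x : ℝ) :
    HasDerivAt (fun x => -(k * Real.pi) * Real.sin (k * Real.pi * x))
      (-(k * Real.pi) ^ 2 * cosMode k x) x := by
  have := (((hasDerivAt_id x).const_mul (k * Real.pi)).sin).const_mul (-(k * Real.pi))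
  exact this.congr_deriv (by simp [cosMode]; ring)

theorem integral_cos_int_mul_pi {n : ℤ} (hn : n ≠ 0) :
    ∫ x in (0 : ℝ)..1, Real.cos (n * Real.pi * x) = 0 := by
  have hne : (n : ℝ) * Real.pi ≠ 0 := mul_ne_zero (by exact_mod_cast hn) Real.pi_ne_zero
  rw [intervalIntegral.integral_comp_mul_left (f := Real.cos) hne, integral_cos]
  simp [Real.sin_int_mul_pi]

theorem integral_cosMode {k : ℕ} (hk : k ≠ 0) : ∫ x in Icc (0 : ℝ) 1, cosMode k x = 0 := by
  rw [integral_Icc_eq_integral_Ioc, ← intervalIntegral.integral_of_le zero_le_one]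
  have := integral_cos_int_mul_pi (n := k) (by exact_mod_cast hk)
  simpa [cosMode] using this

theorem integral_cosMode_mul_cosMode {j k : ℕ} (h : j ≠ k) :
    ∫ x in Icc (0 : ℝ) 1, cosMode j x * cosMode k x = 0 := by
  rw [integral_Icc_eq_integral_Ioc, ← intervalIntegral.integral_of_le zero_le_one]
  have e : ∀ x, cosMode j x * cosMode k x =
      2⁻¹ * Real.cos (((j - k : ℤ) : ℝ) * Real.pi * x) +
        2⁻¹ * Real.cos (((j + k : ℤ) : ℝ) * Real.pi * x) := by
    intro x
    have h1 := Real.cos_add (j * Real.pi * x) (k * Real.pi * x)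
    have h2 := Real.cos_sub (j * Real.pi * x) (k * Real.pi * x)
    push_cast
    rw [show ((j : ℝ) - k) * Real.pi * x = j * Real.pi * x - k * Real.pi * x by ring,
      show ((j : ℝ) + k) * Real.pi * x = j * Real.pi * x + k * Real.pi * x by ring, h1, h2]
    simp only [cosMode]
    ring
  simp_rw [e]
  rw [intervalIntegral.integral_add (Continuous.intervalIntegrable (by fun_prop) _ _)
    (Continuous.intervalIntegrable (by fun_prop) _ _), intervalIntegral.integral_const_mul,
    intervalIntegral.integral_const_mul, integral_cos_int_mul_pi (by omega),
    integral_cos_int_mul_pi (by omega)]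
  simp

theorem integral_cosMode_sq {k : ℕ} (hk : k ≠ 0) :
    ∫ x in Icc (0 : ℝ) 1, cosMode k x * cosMode k x = 1 / 2 := by
  rw [integral_Icc_eq_integral_Ioc, ← intervalIntegral.integral_of_le zero_le_one]
  have e : ∀ x, cosMode k x * cosMode k x =
      2⁻¹ + 2⁻¹ * Real.cos (((2 * k : ℤ) : ℝ) * Real.pi * x) := by
    intro x
    have h1 := Real.cos_sq (k * Real.pi * x)
    push_cast
    rw [show 2 * (k : ℝ) * Real.pi * x = 2 * (k * Real.pi * x) by ring]
    simp only [cosMode]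
    linarith
  simp_rw [e]
  rw [intervalIntegral.integral_add (Continuous.intervalIntegrable (by fun_prop) _ _)
    (Continuous.intervalIntegrable (by fun_prop) _ _), intervalIntegral.integral_const_mul,
    integral_cos_int_mul_pi (by omega)]
  simp

/-- The product-to-sum formula shows that the span of the modes is stable under multiplication by
`cos(πx)`. -/
theorem polynomial_comp_cos_mem_span (p : Polynomial ℝ) :
    (fun x => p.eval (Real.cos (Real.pi * x))) ∈ Submodule.span ℝ (range cosMode) := by
  have hmul : ∀ f ∈ Submodule.span ℝ (range cosMode),
      (fun x => Real.cos (Real.pi * x) * f x) ∈ Submodule.span ℝ (range cosMode) := by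
    intro f hf
    induction hf using Submodule.span_induction with
    | mem f hf =>
      obtain ⟨k, rfl⟩ := hf
      rcases k with - | k
      · have e : (fun x => Real.cos (Real.pi * x) * cosMode 0 x) = cosMode 1 := by
          funext x
          simp [cosMode]
        rw [e]
        exact Submodule.subset_span (mem_range_self 1)
      · have e : (fun x => Real.cos (Real.pi * x) * cosMode (k + 1) x) =
            (2⁻¹ : ℝ) • cosMode (k + 2) + (2⁻¹ : ℝ) • cosMode k := by
          funext x
          have h1 := Real.cos_add ((k + 1) * Real.pi * x) (Real.pi * x)
          have h2 := Real.cos_sub ((k + 1) * Real.pi * x) (Real.pi * x)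
          simp only [Pi.add_apply, Pi.smul_apply, cosMode, smul_eq_mul]
          push_cast
          rw [show ((k : ℝ) + 2) * Real.pi * x = (k + 1) * Real.pi * x + Real.pi * x by ring,
            show (k : ℝ) * Real.pi * x = (k + 1) * Real.pi * x - Real.pi * x by ring, h1, h2]
          ring
        rw [e]
        exact Submodule.add_mem _
          (Submodule.smul_mem _ _ (Submodule.subset_span (mem_range_self _)))
          (Submodule.smul_mem _ _ (Submodule.subset_span (mem_range_self _)))
    | zero =>
      convert Submodule.zero_mem (Submodule.span ℝ (range cosMode)) using 1
      funext x
      simp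
    | add f g _ _ hf hg =>
      convert Submodule.add_mem _ hf hg using 1
      funext x
      simp [mul_add]
    | smul a f _ hf =>
      convert Submodule.smul_mem _ a hf using 1
      funext x
      simp [mul_left_comm]
  induction p using Polynomial.induction_on' with
  | add p q hp hq =>
    convert Submodule.add_mem _ hp hq using 1
    funext x
    simp
  | monomial n a =>
    have hpow : ∀ n : ℕ, (fun x => Real.cos (Real.pi * x) ^ n) ∈
        Submodule.span ℝ (range cosMode) := by
      intro n
      induction n with
      | zero =>
        have e : (fun x => Real.cos (Real.pi * x) ^ 0) = cosMode 0 := by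
          funext x
          simp [cosMode]
        rw [e]
        exact Submodule.subset_span (mem_range_self 0)
      | succ n ih =>
        convert hmul _ ih using 1
        funext x
        ring
    convert Submodule.smul_mem _ a (hpow n) using 1
    funext x
    simp

/-- Weierstrass approximation after the substitution `y = cos(πx)`, a homeomorphism of `[0,1]` onto
`[-1,1]`. -/
theorem exists_cosMode_near {f : ℝ → ℝ} (hf : Continuous f) {δ : ℝ} (hδ : 0 < δ) :
    ∃ c : ℕ →₀ ℝ, ∀ x ∈ Icc (0 : ℝ) 1, |(∑ k ∈ c.support, c k * cosMode k x) - f x| < δ := by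
  obtain ⟨p, hp⟩ := exists_polynomial_near_of_continuousOn (-1) 1
    (fun y => f (Real.arccos y / Real.pi))
    (by have := Real.continuous_arccos; fun_prop) δ hδ
  obtain ⟨c, hc⟩ := Finsupp.mem_span_range_iff_exists_finsupp.1
    (polynomial_comp_cos_mem_span p)
  refine ⟨c, fun x hx => ?_⟩
  have h1 := hp (Real.cos (Real.pi * x)) ⟨Real.neg_one_le_cos _, Real.cos_le_one _⟩
  rw [Real.arccos_cos (mul_nonneg Real.pi_pos.le hx.1)
    (mul_le_of_le_one_right Real.pi_pos.le hx.2), mul_div_cancel_left₀ _ Real.pi_ne_zero] at h1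
  have h2 := congrFun hc x
  simp only [Finsupp.sum, Finset.sum_apply, Pi.smul_apply, smul_eq_mul] at h2
  rwa [h2]

/-- Cosine polynomials are dense, in the `C²` sense, among Neumann test functions. -/
theorem exists_cosMode_near_of_neumann {φ : ℝ → ℝ} (hφ : ContDiff ℝ ∞ φ) (h0 : deriv φ 0 = 0)
    (h1 : deriv φ 1 = 0) {δ : ℝ} (hδ : 0 < δ) :
    ∃ (F : Finset ℕ) (a : ℕ → ℝ), ∀ x ∈ Icc (0 : ℝ) 1,
      |φ x - ∑ k ∈ F, a k * cosMode k x| ≤ δ ∧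
      |deriv (deriv φ) x - ∑ k ∈ F, a k * (-(k * Real.pi) ^ 2 * cosMode k x)| ≤ δ := by
  have hφ' : ContDiff ℝ ∞ (deriv φ) := (contDiff_infty_iff_deriv.1 hφ).2
  have hφ'' : ContDiff ℝ ∞ (deriv (deriv φ)) := (contDiff_infty_iff_deriv.1 hφ').2
  obtain ⟨c, hc⟩ := exists_cosMode_near hφ''.continuous (half_pos hδ)
  -- The Neumann conditions make the mean of `φ''` zero. The constant mode, which is no second
  -- derivative of a cosine, can therefore be dropped at the cost of `δ / 2`.
  have hmean : |c 0| ≤ δ / 2 := by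
    have e1 : ∫ x in Icc (0 : ℝ) 1, deriv (deriv φ) x = 0 := by
      rw [integral_Icc_eq_integral_Ioc, ← intervalIntegral.integral_of_le zero_le_one,
        intervalIntegral.integral_deriv_eq_sub (fun x _ => hφ'.differentiable (by simp) x)
          (hφ''.continuous.intervalIntegrable _ _), h0, h1, sub_zero]
    have e2 : ∫ x in Icc (0 : ℝ) 1, ∑ k ∈ c.support, c k * cosMode k x = c 0 := by
      rw [integral_finsetSum _ fun k _ =>
        ((continuous_cosMode k).const_mul (c k)).continuousOn.integrableOn_Icc]
      rw [Finset.sum_eq_single 0]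
      · simp [cosMode_zero]
      · intro k _ hk
        rw [integral_const_mul, integral_cosMode hk, mul_zero]
      · intro h
        simp [Finsupp.notMem_support_iff.1 h]
    have e3 : c 0 = ∫ x in Icc (0 : ℝ) 1,
        ((∑ k ∈ c.support, c k * cosMode k x) - deriv (deriv φ) x) := by
      rw [integral_sub, e1, e2, sub_zero]
      · exact (continuous_finsetSum _ fun k _ =>
          (continuous_cosMode k).const_mul (c k)).continuousOn.integrableOn_Icc
      · exact hφ''.continuous.continuousOn.integrableOn_Icc
    rw [e3, ← Real.norm_eq_abs]
    refine (norm_setIntegral_le_of_norm_le_const (C := δ / 2) (by simp)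
      fun x hx => (hc x hx).le).trans (by simp)
  -- Dividing by `-(kπ)²` integrates the approximation of `φ''` twice, and `C₀` fixes the value at
  -- `0`. The error and its derivative both vanish at `0`, so two integrations over `[0,1]` keep the
  -- bound `δ`.
  set a₁ : ℕ → ℝ := fun k => -c k / (k * Real.pi) ^ 2 with ha₁
  set C₀ : ℝ := φ 0 - ∑ k ∈ c.support.erase 0, a₁ k * cosMode k 0 with hC₀
  set a : ℕ → ℝ := fun k => if k = 0 then C₀ else a₁ k with ha
  have hsum : ∀ f : ℕ → ℝ, ∑ k ∈ insert 0 (c.support.erase 0), a k * f k =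
      C₀ * f 0 + ∑ k ∈ c.support.erase 0, a₁ k * f k := by
    intro f
    rw [Finset.sum_insert (Finset.notMem_erase _ _)]
    congr 1
    refine Finset.sum_congr rfl fun k hk => ?_
    rw [ha]
    simp [(Finset.mem_erase.1 hk).1]
  have hQ'' : ∀ x, ∑ k ∈ c.support.erase 0, a₁ k * (-(k * Real.pi) ^ 2 * cosMode k x) =
      (∑ k ∈ c.support, c k * cosMode k x) - c 0 := by
    intro x
    have e1 : ∑ k ∈ c.support, c k * cosMode k x =
        c 0 + ∑ k ∈ c.support.erase 0, c k * cosMode k x := by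
      by_cases hm : 0 ∈ c.support
      · rw [← Finset.add_sum_erase _ _ hm, cosMode_zero, mul_one]
      · rw [Finset.erase_eq_of_notMem hm, Finsupp.notMem_support_iff.1 hm, zero_add]
    rw [e1, add_sub_cancel_left]
    refine Finset.sum_congr rfl fun k hk => ?_
    have hk0 : (k : ℝ) ≠ 0 := by exact_mod_cast (Finset.mem_erase.1 hk).1
    have := Real.pi_ne_zero
    simp only [ha₁]
    field_simp
  set D : ℝ → ℝ := fun x => φ x - ∑ k ∈ insert 0 (c.support.erase 0), a k * cosMode k x with hD
  set D' : ℝ → ℝ := fun x => deriv φ x - ∑ k ∈ insert 0 (c.support.erase 0),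
    a k * (-(k * Real.pi) * Real.sin (k * Real.pi * x)) with hD'
  set D'' : ℝ → ℝ := fun x => deriv (deriv φ) x - ∑ k ∈ insert 0 (c.support.erase 0),
    a k * (-(k * Real.pi) ^ 2 * cosMode k x) with hD''
  have hDd : ∀ x, HasDerivAt D (D' x) x := fun x =>
    (hφ.differentiable (by simp) x).hasDerivAt.sub
      (HasDerivAt.fun_sum fun k _ => (hasDerivAt_cosMode k x).const_mul (a k))
  have hDd' : ∀ x, HasDerivAt D' (D'' x) x := fun x =>
    (hφ'.differentiable (by simp) x).hasDerivAt.sub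
      (HasDerivAt.fun_sum fun k _ => (hasDerivAt_sinMode k x).const_mul (a k))
  have hb'' : ∀ x ∈ Icc (0 : ℝ) 1, ‖D'' x‖ ≤ δ := by
    intro x hx
    simp only [hD'']
    rw [hsum fun k => -(k * Real.pi) ^ 2 * cosMode k x, hQ'', Real.norm_eq_abs]
    have h2 := abs_lt.1 (hc x hx)
    have h3 := abs_le.1 hmean
    push_cast
    exact abs_le.2 ⟨by linarith, by linarith⟩
  have h00 : (0 : ℝ) ∈ Icc (0 : ℝ) 1 := ⟨le_rfl, zero_le_one⟩
  have hD0' : D' 0 = 0 := by simp [hD', h0]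
  have hD0 : D 0 = 0 := by
    simp only [hD]
    rw [hsum fun k => cosMode k 0, cosMode_zero]
    simp [hC₀]
  have hstep : ∀ f f' : ℝ → ℝ, (∀ x, HasDerivAt f (f' x) x) → f 0 = 0 →
      (∀ x ∈ Icc (0 : ℝ) 1, ‖f' x‖ ≤ δ) → ∀ x ∈ Icc (0 : ℝ) 1, ‖f x‖ ≤ δ := by
    intro f f' hf hf0 hb x hx
    have := (convex_Icc (0 : ℝ) 1).norm_image_sub_le_of_norm_hasDerivWithin_le
      (fun z _ => (hf z).hasDerivWithinAt) hb h00 hx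
    rw [hf0, sub_zero, sub_zero, Real.norm_of_nonneg hx.1] at this
    exact this.trans (mul_le_of_le_one_right hδ.le hx.2)
  have hb' := hstep D' D'' hDd' hD0' hb''
  have hb := hstep D D' hDd hD0 hb'
  exact ⟨_, a, fun x hx => ⟨hb x hx, hb'' x hx⟩⟩

/-! ### The Neumann heat potential of a square integrable source. -/

/-- `cos(kπx)` evolved by the Neumann heat flow from time `s` to time `t`, and `0` before time `s`. -/
noncomputable def evolvedMode (k : ℕ) (t : ℝ) (p : ℝ × ℝ) : ℝ :=
  cosMode k p.1 * (Iic t).indicator (fun s => Real.exp (-(k * Real.pi) ^ 2 * (t - s))) p.2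

/-- The `k`-th cosine coefficient of the Neumann heat potential of `g`. -/
noncomputable def duhamelCoeff (t₀ t₁ : ℝ) (g : ℝ × ℝ → ℝ) (k : ℕ) (t : ℝ) : ℝ :=
  ∫ p in Icc 0 1 ×ˢ Icc t₀ t₁, g p * evolvedMode k t p

theorem integral_mul_sq_le {X : Type*} [MeasurableSpace X] {μ : Measure X} {f g : X → ℝ}
    (hf : MemLp f 2 μ) (hg : MemLp g 2 μ) :
    (∫ x, f x * g x ∂μ) ^ 2 ≤ (∫ x, f x ^ 2 ∂μ) * ∫ x, g x ^ 2 ∂μ := by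
  have hfg : Integrable (fun x => f x * g x) μ := hf.integrable_mul hg
  have key : ∀ a : ℝ, 0 ≤ (∫ x, f x ^ 2 ∂μ) * (a * a) + 2 * (∫ x, f x * g x ∂μ) * a +
      ∫ x, g x ^ 2 ∂μ := by
    intro a
    have h0 : 0 ≤ ∫ x, (a * f x + g x) ^ 2 ∂μ := integral_nonneg fun x => sq_nonneg _
    have e : ∀ x, (a * f x + g x) ^ 2 = (a * a) * f x ^ 2 + (2 * a) * (f x * g x) + g x ^ 2 :=
      fun x => by ring
    have h1 : Integrable (fun x => (a * a) * f x ^ 2 + (2 * a) * (f x * g x)) μ :=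
      (hf.integrable_sq.const_mul _).add (hfg.const_mul _)
    simp_rw [e] at h0
    rw [integral_add h1 hg.integrable_sq,
      integral_add (hf.integrable_sq.const_mul _) (hfg.const_mul _), integral_const_mul,
      integral_const_mul] at h0
    linarith
  have := discrim_le_zero key
  rw [discrim] at this
  nlinarith

theorem volume_restrict_Icc_prod (t₀ t₁ : ℝ) :
    (volume : Measure (ℝ × ℝ)).restrict (Icc 0 1 ×ˢ Icc t₀ t₁) =
      (volume.restrict (Icc 0 1)).prod (volume.restrict (Icc t₀ t₁)) := by
  rw [Measure.prod_restrict, Measure.volume_eq_prod]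

instance isFiniteMeasure_restrict_Icc_prod (t₀ t₁ : ℝ) :
    IsFiniteMeasure ((volume : Measure (ℝ × ℝ)).restrict (Icc 0 1 ×ˢ Icc t₀ t₁)) := by
  rw [volume_restrict_Icc_prod]
  infer_instance

theorem measurable_evolvedMode (k : ℕ) :
    Measurable fun q : ℝ × (ℝ × ℝ) => evolvedMode k q.1 q.2 := by
  have e : (fun q : ℝ × (ℝ × ℝ) => evolvedMode k q.1 q.2) = fun q => cosMode k q.2.1 *
      ({q : ℝ × (ℝ × ℝ) | q.2.2 ≤ q.1}.indicator
        (fun q => Real.exp (-(k * Real.pi) ^ 2 * (q.1 - q.2.2))) q) := by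
    funext q
    simp only [evolvedMode, indicator, mem_Iic, mem_ofPred_eq]
  rw [e]
  refine ((continuous_cosMode k).measurable.comp (by fun_prop)).mul
    (Measurable.indicator (by fun_prop) (measurableSet_le (by fun_prop) (by fun_prop)))

theorem measurable_evolvedMode_right (k : ℕ) (t : ℝ) : Measurable (evolvedMode k t) :=
  (measurable_evolvedMode k).comp (g := fun q : ℝ × (ℝ × ℝ) => evolvedMode k q.1 q.2)
    (f := fun p : ℝ × ℝ => (t, p)) (measurable_const.prodMk measurable_id)

theorem abs_evolvedMode_le (k : ℕ) (t : ℝ) (p : ℝ × ℝ) : |evolvedMode k t p| ≤ 1 := by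
  rw [evolvedMode, abs_mul]
  refine mul_le_one₀ (abs_cosMode_le k _) (abs_nonneg _) ?_
  by_cases h : p.2 ∈ Iic t
  · rw [indicator_of_mem h, abs_of_pos (Real.exp_pos _)]
    refine Real.exp_le_one_iff.2 ?_
    have : 0 ≤ t - p.2 := sub_nonneg.2 h
    have := mul_nonneg (sq_nonneg ((k : ℝ) * Real.pi)) this
    linarith
  · rw [indicator_of_notMem h]
    simp

theorem memLp_evolvedMode (t₀ t₁ : ℝ) (k : ℕ) (t : ℝ) :
    MemLp (evolvedMode k t) 2 (volume.restrict (Icc 0 1 ×ˢ Icc t₀ t₁)) :=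
  MemLp.of_bound (measurable_evolvedMode_right k t).aestronglyMeasurable 1
    (Filter.Eventually.of_forall fun p => abs_evolvedMode_le k t p)

theorem integral_evolvedMode_mul_of_ne (t₀ t₁ t : ℝ) {j k : ℕ} (hjk : j ≠ k) :
    ∫ p in Icc 0 1 ×ˢ Icc t₀ t₁, evolvedMode j t p * evolvedMode k t p = 0 := by
  rw [volume_restrict_Icc_prod]
  have e : ∀ p : ℝ × ℝ, evolvedMode j t p * evolvedMode k t p =
      (cosMode j p.1 * cosMode k p.1) *
      ((Iic t).indicator (fun s => Real.exp (-(j * Real.pi) ^ 2 * (t - s))) p.2 *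
        (Iic t).indicator (fun s => Real.exp (-(k * Real.pi) ^ 2 * (t - s))) p.2) := fun p => by
    simp only [evolvedMode]; ring
  simp_rw [e]
  rw [integral_prod_mul (fun x => cosMode j x * cosMode k x) (fun s : ℝ =>
    (Iic t).indicator (fun s => Real.exp (-(j * Real.pi) ^ 2 * (t - s))) s *
        (Iic t).indicator (fun s => Real.exp (-(k * Real.pi) ^ 2 * (t - s))) s),
    integral_cosMode_mul_cosMode hjk, zero_mul]

theorem integral_Icc_exp_decay_le {c : ℝ} (hc : 0 < c) (t₀ t₁ t : ℝ) :
    ∫ s in Icc t₀ t₁, (Iic t).indicator (fun s => Real.exp (-c * (t - s))) s ≤ 1 / c := by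
  rw [setIntegral_indicator measurableSet_Iic]
  have hset : Icc t₀ t₁ ∩ Iic t = Icc t₀ (min t₁ t) := by
    ext s
    simp only [mem_inter_iff, mem_Icc, mem_Iic, le_min_iff]
    tauto
  rw [hset]
  rcases le_or_gt t₀ (min t₁ t) with h | h
  · rw [integral_Icc_eq_integral_Ioc, ← intervalIntegral.integral_of_le h]
    have hd : ∀ s ∈ uIcc t₀ (min t₁ t), HasDerivAt (fun s => 1 / c * Real.exp (-c * (t - s)))
        (Real.exp (-c * (t - s))) s := fun s _ => by
      have := ((((hasDerivAt_id s).const_sub t).const_mul (-c)).exp).const_mul (1 / c)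
      refine this.congr_deriv ?_
      simp only [id]
      field_simp
    rw [intervalIntegral.integral_eq_sub_of_hasDerivAt hd
      (Continuous.intervalIntegrable (by fun_prop) _ _)]
    have h1 : Real.exp (-c * (t - min t₁ t)) ≤ 1 := by
      refine Real.exp_le_one_iff.2 ?_
      have := mul_nonneg hc.le (sub_nonneg.2 (min_le_right t₁ t))
      linarith
    have h2 := Real.exp_pos (-c * (t - t₀))
    have h3 : 0 < 1 / c := by positivity
    nlinarith
  · rw [Icc_eq_empty (not_le.2 h)]
    simp [hc.le]

theorem integral_evolvedMode_sq_le (t₀ t₁ t : ℝ) {k : ℕ} (hk : k ≠ 0) :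
    ∫ p in Icc 0 1 ×ˢ Icc t₀ t₁, evolvedMode k t p * evolvedMode k t p ≤
      1 / (4 * (k * Real.pi) ^ 2) := by
  have hk' : (0 : ℝ) < k := by exact_mod_cast Nat.pos_of_ne_zero hk
  have hpos : 0 < (k * Real.pi) ^ 2 := by have := Real.pi_pos; positivity
  rw [volume_restrict_Icc_prod]
  have e : ∀ p : ℝ × ℝ, evolvedMode k t p * evolvedMode k t p =
      (cosMode k p.1 * cosMode k p.1) *
      ((Iic t).indicator (fun s => Real.exp (-(2 * (k * Real.pi) ^ 2) * (t - s))) p.2) := fun p => by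
    simp only [evolvedMode]
    by_cases h : p.2 ∈ Iic t
    · simp only [indicator_of_mem h]
      rw [mul_mul_mul_comm, ← Real.exp_add]
      ring_nf
    · simp only [indicator_of_notMem h]
      ring
  simp_rw [e]
  rw [integral_prod_mul (fun x => cosMode k x * cosMode k x) (fun s : ℝ =>
    (Iic t).indicator (fun s => Real.exp (-(2 * (k * Real.pi) ^ 2) * (t - s))) s),
    integral_cosMode_sq hk]
  have := integral_Icc_exp_decay_le (c := 2 * (k * Real.pi) ^ 2) (by positivity) t₀ t₁ t
  calc _ ≤ 1 / 2 * (1 / (2 * (k * Real.pi) ^ 2)) := by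
        refine mul_le_mul_of_nonneg_left this (by norm_num)
    _ = _ := by field_simp; norm_num

section
variable {t₀ t₁ : ℝ} {g : ℝ × ℝ → ℝ}

theorem integrable_mul_evolvedMode (hg : MemLp g 2 (volume.restrict (Icc 0 1 ×ˢ Icc t₀ t₁)))
    (k : ℕ) (t : ℝ) : IntegrableOn (fun p => g p * evolvedMode k t p) (Icc 0 1 ×ˢ Icc t₀ t₁) :=
  hg.integrable_mul (memLp_evolvedMode t₀ t₁ k t)

/-- Duality: the sum is the pairing of `g` with `∑ d k * evolvedMode k t`. These modes are
orthogonal in space-time with squared norm at most `1/(4k²)`, so Cauchy–Schwarz applies. Each bound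
on the potential is a choice of `d`. -/
theorem sum_mul_duhamelCoeff_sq_le (hg : MemLp g 2 (volume.restrict (Icc 0 1 ×ˢ Icc t₀ t₁)))
    (F : Finset ℕ) (hF : 0 ∉ F) (d : ℕ → ℝ) (t : ℝ) :
    (∑ k ∈ F, d k * duhamelCoeff t₀ t₁ g k t) ^ 2 ≤
      (∫ p in Icc 0 1 ×ˢ Icc t₀ t₁, g p ^ 2) * ∑ k ∈ F, d k ^ 2 / (4 * k ^ 2) := by
  set Ψ : ℝ × ℝ → ℝ := fun p => ∑ k ∈ F, d k * evolvedMode k t p with hΨ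
  have hΨL : MemLp Ψ 2 (volume.restrict (Icc 0 1 ×ˢ Icc t₀ t₁)) :=
    memLp_finsetSum _ fun k _ => (memLp_evolvedMode t₀ t₁ k t).const_mul (d k)
  have e1 : ∑ k ∈ F, d k * duhamelCoeff t₀ t₁ g k t =
      ∫ p in Icc 0 1 ×ˢ Icc t₀ t₁, g p * Ψ p := by
    simp only [hΨ, duhamelCoeff, Finset.mul_sum]
    rw [integral_finsetSum]
    · refine Finset.sum_congr rfl fun k _ => ?_
      rw [← integral_const_mul]
      congr 1
      funext p
      ring
    · intro k _
      have := (integrable_mul_evolvedMode hg k t).const_mul (d k)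
      refine this.congr (Filter.Eventually.of_forall fun p => ?_)
      simp only
      ring
  have hij : ∀ i j, IntegrableOn (fun p => d i * d j * (evolvedMode i t p * evolvedMode j t p))
      (Icc 0 1 ×ˢ Icc t₀ t₁) := fun i j =>
    (((memLp_evolvedMode t₀ t₁ i t).integrable_mul (memLp_evolvedMode t₀ t₁ j t))).const_mul _
  have e2 : ∫ p in Icc 0 1 ×ˢ Icc t₀ t₁, Ψ p ^ 2 ≤ ∑ k ∈ F, d k ^ 2 / (4 * k ^ 2) := by
    have e3 : ∀ p, Ψ p ^ 2 =
        ∑ i ∈ F, ∑ j ∈ F, d i * d j * (evolvedMode i t p * evolvedMode j t p) := by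
      intro p
      rw [sq, hΨ, Finset.sum_mul_sum]
      refine Finset.sum_congr rfl fun i _ => Finset.sum_congr rfl fun j _ => by ring
    simp_rw [e3]
    rw [integral_finsetSum _ fun i _ => integrable_finsetSum _ fun j _ => hij i j]
    refine Finset.sum_le_sum fun i hi => ?_
    rw [integral_finsetSum _ fun j _ => hij i j, Finset.sum_eq_single i]
    · have hi0 : i ≠ 0 := fun h => hF (h ▸ hi)
      have hi' : (0 : ℝ) < i := by exact_mod_cast Nat.pos_of_ne_zero hi0
      rw [integral_const_mul, ← sq, div_eq_mul_one_div]
      refine mul_le_mul_of_nonneg_left ((integral_evolvedMode_sq_le t₀ t₁ t hi0).trans ?_)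
        (sq_nonneg _)
      refine one_div_le_one_div_of_le (by positivity) ?_
      have h1 : (1 : ℝ) ≤ Real.pi := by linarith [Real.pi_gt_three]
      rw [mul_pow]
      have h2 : (1 : ℝ) ≤ Real.pi ^ 2 := one_le_pow₀ h1
      nlinarith [sq_nonneg (i : ℝ)]
    · intro j _ hji
      rw [integral_const_mul, integral_evolvedMode_mul_of_ne t₀ t₁ t hji.symm, mul_zero]
    · exact fun h => absurd hi h
  rw [e1]
  exact (integral_mul_sq_le hg hΨL).trans
    (mul_le_mul_of_nonneg_left e2 (integral_nonneg fun p => sq_nonneg _))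

theorem continuous_duhamelCoeff (hg : MemLp g 2 (volume.restrict (Icc 0 1 ×ˢ Icc t₀ t₁)))
    (k : ℕ) : Continuous (duhamelCoeff t₀ t₁ g k) := by
  have hgi : IntegrableOn g (Icc 0 1 ×ˢ Icc t₀ t₁) := hg.integrable (by norm_num)
  refine continuous_iff_continuousAt.2 fun t => ?_
  refine continuousAt_of_dominated (bound := fun p => |g p|)
    (Filter.Eventually.of_forall fun r => (integrable_mul_evolvedMode hg k r).aestronglyMeasurable)
    (Filter.Eventually.of_forall fun r => Filter.Eventually.of_forall fun p => ?_) hgi.abs ?_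
  · rw [norm_mul, Real.norm_eq_abs, Real.norm_eq_abs]
    exact mul_le_of_le_one_right (abs_nonneg _) (abs_evolvedMode_le k r p)
  · have hne : ∀ᵐ p ∂(volume : Measure (ℝ × ℝ)).restrict (Icc 0 1 ×ˢ Icc t₀ t₁), p.2 ≠ t := by
      refine ae_restrict_of_ae ?_
      rw [Measure.volume_eq_prod]
      exact Measure.quasiMeasurePreserving_snd.ae (Measure.ae_ne volume t)
    filter_upwards [hne] with p hp
    refine continuousAt_const.mul (continuousAt_const.mul ?_)
    rcases lt_or_gt_of_ne hp with h | h
    · have : (fun r => (Iic r).indicator (fun s => Real.exp (-(k * Real.pi) ^ 2 * (r - s))) p.2)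
          =ᶠ[nhds t] fun r => Real.exp (-(k * Real.pi) ^ 2 * (r - p.2)) := by
        filter_upwards [lt_mem_nhds h] with r hr
        rw [indicator_of_mem (show p.2 ∈ Iic r from hr.le)]
      exact ContinuousAt.congr (by fun_prop) this.symm
    · have : (fun r => (Iic r).indicator (fun s => Real.exp (-(k * Real.pi) ^ 2 * (r - s))) p.2)
          =ᶠ[nhds t] fun _ => 0 := by
        filter_upwards [gt_mem_nhds h] with r hr
        rw [indicator_of_notMem (notMem_Iic.2 hr)]
      exact ContinuousAt.congr continuousAt_const this.symm

theorem integral_evolvedMode_time (k : ℕ) {t : ℝ} {p : ℝ × ℝ} (hp : t₀ ≤ p.2) :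
    (k * Real.pi) ^ 2 * ∫ r in Icc t₀ t, evolvedMode k r p =
      (Iic t).indicator (fun _ => cosMode k p.1) p.2 - evolvedMode k t p := by
  set c := (k * Real.pi) ^ 2 with hc
  have e : ∀ r, evolvedMode k r p =
      (Ici p.2).indicator (fun r => cosMode k p.1 * Real.exp (-c * (r - p.2))) r := by
    intro r
    simp only [evolvedMode, indicator, mem_Iic, mem_Ici, hc]
    split_ifs <;> simp
  have hset : Icc t₀ t ∩ Ici p.2 = Icc p.2 t := by
    ext r
    simp only [mem_inter_iff, mem_Icc, mem_Ici]
    constructor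
    · exact fun h => ⟨h.2, h.1.2⟩
    · exact fun h => ⟨⟨hp.trans h.1, h.2⟩, h.1⟩
  have e0 : ∫ r in Icc t₀ t, evolvedMode k r p =
      ∫ r in Icc p.2 t, cosMode k p.1 * Real.exp (-c * (r - p.2)) := by
    simp_rw [e]
    rw [setIntegral_indicator measurableSet_Ici, hset]
  rw [e0]
  rcases le_or_gt p.2 t with h | h
  · rw [integral_Icc_eq_integral_Ioc, ← intervalIntegral.integral_of_le h, ←
      intervalIntegral.integral_const_mul]
    have hd : ∀ r ∈ uIcc p.2 t, HasDerivAt (fun r => -cosMode k p.1 * Real.exp (-c * (r - p.2)))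
        (c * (cosMode k p.1 * Real.exp (-c * (r - p.2)))) r := fun r _ => by
      have := ((((hasDerivAt_id r).sub_const p.2).const_mul (-c)).exp).const_mul (-cosMode k p.1)
      refine this.congr_deriv ?_
      simp only [id]
      ring
    rw [intervalIntegral.integral_eq_sub_of_hasDerivAt hd
      (Continuous.intervalIntegrable (by fun_prop) _ _), indicator_of_mem (show p.2 ∈ Iic t from h),
      evolvedMode, indicator_of_mem (show p.2 ∈ Iic t from h)]
    simp
    ring
  · rw [Icc_eq_empty (not_le.2 h), evolvedMode, indicator_of_notMem (notMem_Iic.2 h),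
      indicator_of_notMem (notMem_Iic.2 h)]
    simp

/-- The integrated heat equation tested against a single mode; Fubini reduces it to the time
integral of an evolved mode. -/
theorem duhamelCoeff_ode (hg : MemLp g 2 (volume.restrict (Icc 0 1 ×ˢ Icc t₀ t₁)))
    (k : ℕ) {t : ℝ} (ht : t ∈ Icc t₀ t₁) :
    duhamelCoeff t₀ t₁ g k t + (k * Real.pi) ^ 2 * ∫ r in t₀..t, duhamelCoeff t₀ t₁ g k r =
      ∫ p in Icc 0 1 ×ˢ Icc t₀ t, g p * cosMode k p.1 := by
  have hgi : IntegrableOn g (Icc 0 1 ×ˢ Icc t₀ t₁) := hg.integrable (by norm_num)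
  set P := (volume : Measure (ℝ × ℝ)).restrict (Icc 0 1 ×ˢ Icc t₀ t₁) with hP
  have hswap : ∫ r in Icc t₀ t, duhamelCoeff t₀ t₁ g k r =
      ∫ p, g p * (∫ r in Icc t₀ t, evolvedMode k r p) ∂P := by
    simp only [duhamelCoeff]
    rw [integral_integral_swap]
    · simp_rw [integral_const_mul]
      rfl
    · have h1 : Integrable (fun q : ℝ × (ℝ × ℝ) => g q.2) ((volume.restrict (Icc t₀ t)).prod P) :=
        Integrable.comp_snd (f := g) hgi _
      exact h1.mul_bdd (c := 1) (measurable_evolvedMode k).aestronglyMeasurable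
        (Filter.Eventually.of_forall fun q => abs_evolvedMode_le k q.1 q.2)
  rw [intervalIntegral.integral_of_le ht.1, ← integral_Icc_eq_integral_Ioc, hswap,
    ← integral_const_mul]
  have hset : Icc (0 : ℝ) 1 ×ˢ Icc t₀ t = Icc (0 : ℝ) 1 ×ˢ Icc t₀ t₁ ∩ {p | p.2 ∈ Iic t} := by
    ext p
    simp only [mem_prod, mem_Icc, mem_inter_iff, mem_ofPred_eq, mem_Iic]
    constructor
    · exact fun h => ⟨⟨h.1, h.2.1, h.2.2.trans ht.2⟩, h.2.2⟩
    · exact fun h => ⟨h.1.1, h.1.2.1, h.2⟩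
  have hms : MeasurableSet {p : ℝ × ℝ | p.2 ∈ Iic t} := measurable_snd measurableSet_Iic
  have e1 : ∫ p, (k * Real.pi) ^ 2 * (g p * (∫ r in Icc t₀ t, evolvedMode k r p)) ∂P =
      ∫ p, ({p : ℝ × ℝ | p.2 ∈ Iic t}.indicator (fun p => g p * cosMode k p.1) p -
        g p * evolvedMode k t p) ∂P := by
    refine integral_congr_ae ?_
    filter_upwards [ae_restrict_mem (measurableSet_Icc.prod measurableSet_Icc)] with p hp
    rw [mul_left_comm, integral_evolvedMode_time k hp.2.1, mul_sub]
    congr 1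
    by_cases h : p.2 ∈ Iic t
    · rw [indicator_of_mem h, indicator_of_mem (show p ∈ {p : ℝ × ℝ | p.2 ∈ Iic t} from h)]
    · rw [indicator_of_notMem h,
        indicator_of_notMem (show p ∉ {p : ℝ × ℝ | p.2 ∈ Iic t} from h), mul_zero]
  have hgc : Integrable (fun p => g p * cosMode k p.1) P :=
    hgi.mul_bdd (c := 1) ((continuous_cosMode k).comp continuous_fst).aestronglyMeasurable
      (Filter.Eventually.of_forall fun p => abs_cosMode_le k p.1)
  rw [e1, integral_sub (hgc.indicator hms) (integrable_mul_evolvedMode hg k t), hset,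
    ← setIntegral_indicator hms]
  simp only [duhamelCoeff, hP]
  ring

end

/-- Partial sums of the cosine expansion of the Neumann heat potential of `g`. -/
noncomputable def duhamelSum (t₀ t₁ : ℝ) (g : ℝ × ℝ → ℝ) (n : ℕ) (p : ℝ × ℝ) : ℝ :=
  ∑ k ∈ Finset.range n, (if k = 0 then 1 else 2) * duhamelCoeff t₀ t₁ g k p.2 * cosMode k p.1

/-- Interpolation between the Lipschitz bound `kπ|x - y|` and the trivial bound `2`. The resulting
weights `k ^ (2γ - 2)` are summable exactly when `γ < 1/2`. -/
theorem abs_cosMode_sub_sq_le {γ : ℝ} (hγ0 : 0 < γ) (hγ1 : γ ≤ 1) {k : ℕ} (hk : k ≠ 0) (x y : ℝ) :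
    (cosMode k x - cosMode k y) ^ 2 / k ^ 2 ≤
      (4 * Real.pi ^ 2) * (|x - y| ^ γ) ^ 2 * (k : ℝ) ^ (2 * γ - 2) := by
  have hk0 : (0 : ℝ) < k := by exact_mod_cast Nat.pos_of_ne_zero hk
  have hpi : (1 : ℝ) ≤ Real.pi := by linarith [Real.pi_gt_three]
  have h1 : |cosMode k x - cosMode k y| ≤ k * Real.pi * |x - y| := by
    have := (convex_univ (𝕜 := ℝ) (E := ℝ)).norm_image_sub_le_of_norm_hasDerivWithin_le (C := k * Real.pi)
      (fun z _ => (hasDerivAt_cosMode k z).hasDerivWithinAt) (fun z _ => by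
        rw [norm_mul, norm_neg, Real.norm_of_nonneg (by positivity)]
        exact mul_le_of_le_one_right (by positivity) (Real.abs_sin_le_one _))
      (mem_univ y) (mem_univ x)
    simpa using this
  have h2 : |cosMode k x - cosMode k y| ≤ 2 := (abs_sub _ _).trans (by
    linarith [abs_cosMode_le k x, abs_cosMode_le k y])
  set r := (k : ℝ) * |x - y| with hr
  have hr0 : 0 ≤ r := by positivity
  have h3 : |cosMode k x - cosMode k y| ≤ 2 * Real.pi * r ^ γ := by
    rcases le_or_gt 1 r with h | h
    · have := Real.one_le_rpow h hγ0.le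
      nlinarith
    · have hrγ : r ≤ r ^ γ := by
        rcases hr0.eq_or_lt with h0 | h0
        · rw [← h0]
          exact Real.rpow_nonneg le_rfl _
        · have := Real.rpow_le_rpow_of_exponent_ge h0 h.le hγ1
          rwa [Real.rpow_one] at this
      calc _ ≤ k * Real.pi * |x - y| := h1
        _ = Real.pi * r := by rw [hr]; ring
        _ ≤ 2 * Real.pi * r ^ γ := by nlinarith
  have h4 : (cosMode k x - cosMode k y) ^ 2 ≤ (2 * Real.pi * r ^ γ) ^ 2 := by
    rw [← sq_abs]
    exact pow_le_pow_left₀ (abs_nonneg _) h3 2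
  rw [div_le_iff₀ (by positivity)]
  refine h4.trans (le_of_eq ?_)
  have e1 : r ^ γ = (k : ℝ) ^ γ * |x - y| ^ γ := Real.mul_rpow hk0.le (abs_nonneg _)
  have e2 : (k : ℝ) ^ (2 * γ - 2) * (k : ℝ) ^ 2 = ((k : ℝ) ^ γ) ^ 2 := by
    rw [← Real.rpow_natCast (k : ℝ) 2, ← Real.rpow_add hk0, ← Real.rpow_natCast _ 2,
      ← Real.rpow_mul hk0.le]
    congr 1
    push_cast
    ring
  rw [e1, mul_assoc _ ((k : ℝ) ^ (2 * γ - 2)), e2]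
  ring

section
variable {t₀ t₁ : ℝ} {g : ℝ × ℝ → ℝ}

theorem continuous_duhamelSum (hg : MemLp g 2 (volume.restrict (Icc 0 1 ×ˢ Icc t₀ t₁))) (n : ℕ) :
    Continuous (duhamelSum t₀ t₁ g n) :=
  continuous_finsetSum _ fun k _ =>
    (continuous_const.mul ((continuous_duhamelCoeff hg k).comp continuous_snd)).mul
      ((continuous_cosMode k).comp continuous_fst)

/-- The tail of `∑ 1/k²` does not depend on the point, so the partial sums are uniformly Cauchy and
the potential is continuous. -/
theorem duhamelSum_sub_sq_le (hg : MemLp g 2 (volume.restrict (Icc 0 1 ×ˢ Icc t₀ t₁)))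
    {n m : ℕ} (hn : 1 ≤ n) (hnm : n ≤ m) (p : ℝ × ℝ) :
    (duhamelSum t₀ t₁ g m p - duhamelSum t₀ t₁ g n p) ^ 2 ≤
      (∫ p in Icc 0 1 ×ˢ Icc t₀ t₁, g p ^ 2) * ∑ k ∈ Finset.Ico n m, 1 / (k : ℝ) ^ 2 := by
  have e : duhamelSum t₀ t₁ g m p - duhamelSum t₀ t₁ g n p =
      ∑ k ∈ Finset.Ico n m, (2 * cosMode k p.1) * duhamelCoeff t₀ t₁ g k p.2 := by
    rw [duhamelSum, duhamelSum, ← Finset.sum_Ico_eq_sub _ hnm]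
    refine Finset.sum_congr rfl fun k hk => ?_
    have : k ≠ 0 := by have := (Finset.mem_Ico.1 hk).1; omega
    rw [if_neg this]
    ring
  rw [e]
  refine (sum_mul_duhamelCoeff_sq_le hg _ (by simp; omega) _ _).trans ?_
  refine mul_le_mul_of_nonneg_left (Finset.sum_le_sum fun k hk => ?_)
    (integral_nonneg fun p => sq_nonneg _)
  have hk0 : (0 : ℝ) < k := by
    have := (Finset.mem_Ico.1 hk).1
    exact_mod_cast (by omega : 0 < k)
  have h1 : cosMode k p.1 ^ 2 ≤ 1 := (sq_le_one_iff_abs_le_one _).2 (abs_cosMode_le k _)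
  rw [div_le_div_iff₀ (by positivity) (by positivity)]
  nlinarith [sq_nonneg (k : ℝ)]

theorem duhamelSum_space_sub_sq_le (hg : MemLp g 2 (volume.restrict (Icc 0 1 ×ˢ Icc t₀ t₁)))
    {γ : ℝ} (hγ0 : 0 < γ) (hγ : γ < 1 / 2) (n : ℕ) (x y t : ℝ) :
    (duhamelSum t₀ t₁ g n (x, t) - duhamelSum t₀ t₁ g n (y, t)) ^ 2 ≤
      (∫ p in Icc 0 1 ×ˢ Icc t₀ t₁, g p ^ 2) *
        ((4 * Real.pi ^ 2) * (|x - y| ^ γ) ^ 2 * ∑' k : ℕ, (k : ℝ) ^ (2 * γ - 2)) := by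
  have hsum : Summable fun k : ℕ => (k : ℝ) ^ (2 * γ - 2) :=
    Real.summable_nat_rpow.2 (by linarith)
  have e : duhamelSum t₀ t₁ g n (x, t) - duhamelSum t₀ t₁ g n (y, t) =
      ∑ k ∈ (Finset.range n).erase 0, (2 * (cosMode k x - cosMode k y)) *
        duhamelCoeff t₀ t₁ g k t := by
    rw [duhamelSum, duhamelSum, ← Finset.sum_sub_distrib]
    refine (Finset.sum_subset (Finset.erase_subset 0 _) fun k hk hk' => ?_).symm.trans
      (Finset.sum_congr rfl fun k hk => ?_)
    · have : k = 0 := by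
        by_contra h
        exact hk' (Finset.mem_erase.2 ⟨h, hk⟩)
      simp [this, cosMode_zero]
    · rw [if_neg (Finset.mem_erase.1 hk).1]
      ring
  rw [e]
  refine (sum_mul_duhamelCoeff_sq_le hg _ (by simp) _ _).trans ?_
  refine mul_le_mul_of_nonneg_left ?_ (integral_nonneg fun p => sq_nonneg _)
  rw [← hsum.tsum_mul_left]
  refine (Finset.sum_le_sum fun k hk => ?_).trans
    ((hsum.mul_left _).sum_le_tsum ((Finset.range n).erase 0) fun k _ => by positivity)
  have hk0 := (Finset.mem_erase.1 hk).1
  refine le_trans (le_of_eq ?_) (abs_cosMode_sub_sq_le hγ0 (by linarith) hk0 x y)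
  have : (k : ℝ) ≠ 0 := by exact_mod_cast hk0
  field_simp
  ring

theorem exists_tendstoUniformly_duhamelSum
    (hg : MemLp g 2 (volume.restrict (Icc 0 1 ×ˢ Icc t₀ t₁))) :
    ∃ z : ℝ × ℝ → ℝ, TendstoUniformly (duhamelSum t₀ t₁ g) z Filter.atTop := by
  set G := ∫ p in Icc 0 1 ×ˢ Icc t₀ t₁, g p ^ 2 with hG
  have hG0 : 0 ≤ G := integral_nonneg fun p => sq_nonneg _
  have hsum : Summable fun k : ℕ => 1 / (k : ℝ) ^ 2 := Real.summable_one_div_nat_pow.2 (by norm_num)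
  have hC : UniformCauchySeqOn (duhamelSum t₀ t₁ g) Filter.atTop univ := by
    rw [Metric.uniformCauchySeqOn_iff]
    intro ε hε
    have hc := hsum.hasSum.tendsto_sum_nat.cauchySeq
    obtain ⟨N, hN⟩ := Metric.cauchySeq_iff.1 hc (ε ^ 2 / (G + 1)) (by positivity)
    have key : ∀ n m, max N 1 ≤ n → n ≤ m → ∀ p,
        dist (duhamelSum t₀ t₁ g m p) (duhamelSum t₀ t₁ g n p) < ε := by
      intro n m hn hnm p
      have h1 := duhamelSum_sub_sq_le hg ((le_max_right _ _).trans hn) hnm p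
      have h2 := hN m ((le_max_left _ _).trans (hn.trans hnm)) n ((le_max_left _ _).trans hn)
      rw [Real.dist_eq, ← Finset.sum_Ico_eq_sub _ hnm] at h2
      have h3 := (abs_lt.1 h2).2
      rw [lt_div_iff₀ (by positivity)] at h3
      have h4 : 0 ≤ ∑ k ∈ Finset.Ico n m, 1 / (k : ℝ) ^ 2 := Finset.sum_nonneg fun k _ => by positivity
      rw [Real.dist_eq]
      refine abs_lt_of_sq_lt_sq ?_ hε.le
      nlinarith
    refine ⟨max N 1, fun m hm n hn p _ => ?_⟩
    rcases le_total n m with h | h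
    · exact key n m hn h p
    · rw [dist_comm]
      exact key m n hm h p
  have hlim : ∀ p, ∃ l, Filter.Tendsto (fun n => duhamelSum t₀ t₁ g n p) Filter.atTop (nhds l) :=
    fun p => cauchySeq_tendsto_of_complete (hC.cauchySeq (mem_univ p))
  choose z hz using hlim
  exact ⟨z, tendstoUniformlyOn_univ.1 (hC.tendstoUniformlyOn_of_tendsto fun p _ => hz p)⟩

theorem integral_duhamelSum_mul_cosMode {j n : ℕ} (hj : j < n) (t : ℝ) :
    ∫ x in Icc (0 : ℝ) 1, duhamelSum t₀ t₁ g n (x, t) * cosMode j x =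
      duhamelCoeff t₀ t₁ g j t := by
  simp only [duhamelSum, Finset.sum_mul]
  have hcm : ∀ k, ∀ x, (if k = 0 then 1 else 2) * duhamelCoeff t₀ t₁ g k t * cosMode k x *
      cosMode j x = ((if k = 0 then 1 else 2) * duhamelCoeff t₀ t₁ g k t) *
        (cosMode k x * cosMode j x) := fun k x => by ring
  simp_rw [hcm]
  have hi : ∀ k, IntegrableOn (fun x => cosMode k x * cosMode j x) (Icc 0 1) := fun k =>
    ((continuous_cosMode k).mul (continuous_cosMode j)).continuousOn.integrableOn_Icc
  rw [integral_finsetSum _ fun k _ => (hi k).const_mul _]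
  rw [Finset.sum_eq_single j]
  · rw [integral_const_mul]
    by_cases h : j = 0
    · subst h
      simp [cosMode_zero]
    · rw [integral_cosMode_sq h, if_neg h]
      ring
  · intro k _ hk
    rw [integral_const_mul, integral_cosMode_mul_cosMode hk, mul_zero]
  · exact fun h => absurd (Finset.mem_range.2 hj) h

theorem integral_limit_mul_cosMode (hg : MemLp g 2 (volume.restrict (Icc 0 1 ×ˢ Icc t₀ t₁)))
    {z : ℝ × ℝ → ℝ} (hz : TendstoUniformly (duhamelSum t₀ t₁ g) z Filter.atTop) (j : ℕ) (t : ℝ) :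
    ∫ x in Icc (0 : ℝ) 1, z (x, t) * cosMode j x = duhamelCoeff t₀ t₁ g j t := by
  have hzc : Continuous z := hz.continuous
    (Filter.Frequently.of_forall fun n => continuous_duhamelSum hg n)
  have hzt : Continuous fun x => z (x, t) := hzc.comp (by fun_prop)
  refine eq_of_abs_sub_le_all fun ε hε => ?_
  obtain ⟨n, hn, hjn⟩ := ((Metric.tendstoUniformly_iff.1 hz ε hε).and
    (Filter.eventually_gt_atTop j)).exists
  have hsc : Continuous fun x => duhamelSum t₀ t₁ g n (x, t) :=
    (continuous_duhamelSum hg n).comp (by fun_prop)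
  have hi : ∀ w : ℝ → ℝ, Continuous w → IntegrableOn (fun x => w x * cosMode j x) (Icc 0 1) :=
    fun w hw => (hw.mul (continuous_cosMode j)).continuousOn.integrableOn_Icc
  rw [← integral_duhamelSum_mul_cosMode (g := g) (t₀ := t₀) (t₁ := t₁) hjn t,
    ← integral_sub (hi _ hzt) (hi _ hsc), ← Real.norm_eq_abs]
  refine (norm_setIntegral_le_of_norm_le_const (C := ε) (by simp) fun x _ => ?_).trans (by simp)
  rw [← sub_mul, norm_mul]
  have := (hn (x, t)).le
  rw [Real.dist_eq] at this
  exact (mul_le_of_le_one_right (abs_nonneg _) (abs_cosMode_le j x)).trans this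

/-- The defect in the integrated heat equation tested against `φ`, where `ψ` stands for `φ''`. -/
noncomputable def heatDefect (t₀ : ℝ) (g z : ℝ × ℝ → ℝ) (t : ℝ) (φ ψ : ℝ → ℝ) : ℝ :=
  (∫ x in Icc (0 : ℝ) 1, z (x, t) * φ x) - (∫ p in Icc 0 1 ×ˢ Icc t₀ t, z p * ψ p.1) -
    ∫ p in Icc 0 1 ×ˢ Icc t₀ t, g p * φ p.1

theorem heatDefect_sub {z : ℝ × ℝ → ℝ} (hz : Continuous z) {t : ℝ}
    (hg : IntegrableOn g (Icc 0 1 ×ˢ Icc t₀ t)) {φ₁ φ₂ ψ₁ ψ₂ : ℝ → ℝ} (h1 : Continuous φ₁)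
    (h2 : Continuous φ₂) (h3 : Continuous ψ₁) (h4 : Continuous ψ₂) :
    heatDefect t₀ g z t (fun x => φ₁ x - φ₂ x) (fun x => ψ₁ x - ψ₂ x) =
      heatDefect t₀ g z t φ₁ ψ₁ - heatDefect t₀ g z t φ₂ ψ₂ := by
  have hc : IsCompact (Icc (0 : ℝ) 1 ×ˢ Icc t₀ t) := isCompact_Icc.prod isCompact_Icc
  have i1 : ∀ φ : ℝ → ℝ, Continuous φ → IntegrableOn (fun x => z (x, t) * φ x) (Icc 0 1) :=
    fun φ hφ => ((hz.comp (by fun_prop : Continuous fun x => (x, t))).mul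
      hφ).continuousOn.integrableOn_Icc
  have i2 : ∀ φ : ℝ → ℝ, Continuous φ → IntegrableOn (fun p : ℝ × ℝ => z p * φ p.1)
      (Icc 0 1 ×ˢ Icc t₀ t) :=
    fun φ hφ => (hz.mul (hφ.comp continuous_fst)).continuousOn.integrableOn_compact hc
  have i3 : ∀ φ : ℝ → ℝ, Continuous φ → IntegrableOn (fun p : ℝ × ℝ => g p * φ p.1)
      (Icc 0 1 ×ˢ Icc t₀ t) :=
    fun φ hφ => hg.mul_continuousOn (hφ.comp continuous_fst).continuousOn hc
  simp only [heatDefect, mul_sub]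
  rw [integral_sub (i1 _ h1) (i1 _ h2), integral_sub (i2 _ h3) (i2 _ h4),
    integral_sub (i3 _ h1) (i3 _ h2)]
  ring

theorem heatDefect_sum {z : ℝ × ℝ → ℝ} (hz : Continuous z) {t : ℝ}
    (hg : IntegrableOn g (Icc 0 1 ×ˢ Icc t₀ t)) (F : Finset ℕ) (a : ℕ → ℝ) {φ ψ : ℕ → ℝ → ℝ}
    (h1 : ∀ k, Continuous (φ k)) (h2 : ∀ k, Continuous (ψ k)) :
    heatDefect t₀ g z t (fun x => ∑ k ∈ F, a k * φ k x) (fun x => ∑ k ∈ F, a k * ψ k x) =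
      ∑ k ∈ F, a k * heatDefect t₀ g z t (φ k) (ψ k) := by
  have hc : IsCompact (Icc (0 : ℝ) 1 ×ˢ Icc t₀ t) := isCompact_Icc.prod isCompact_Icc
  have i1 : ∀ φ : ℝ → ℝ, Continuous φ → IntegrableOn (fun x => z (x, t) * φ x) (Icc 0 1) :=
    fun φ hφ => ((hz.comp (by fun_prop : Continuous fun x => (x, t))).mul
      hφ).continuousOn.integrableOn_Icc
  have i2 : ∀ φ : ℝ → ℝ, Continuous φ → IntegrableOn (fun p : ℝ × ℝ => z p * φ p.1)
      (Icc 0 1 ×ˢ Icc t₀ t) :=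
    fun φ hφ => (hz.mul (hφ.comp continuous_fst)).continuousOn.integrableOn_compact hc
  have i3 : ∀ φ : ℝ → ℝ, Continuous φ → IntegrableOn (fun p : ℝ × ℝ => g p * φ p.1)
      (Icc 0 1 ×ˢ Icc t₀ t) :=
    fun φ hφ => hg.mul_continuousOn (hφ.comp continuous_fst).continuousOn hc
  simp only [heatDefect, Finset.mul_sum]
  simp_rw [mul_left_comm (z _) (a _), mul_left_comm (g _) (a _)]
  rw [integral_finsetSum _ fun k _ => (i1 _ (h1 k)).const_mul (a k),
    integral_finsetSum _ fun k _ => (i2 _ (h2 k)).const_mul (a k),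
    integral_finsetSum _ fun k _ => (i3 _ (h1 k)).const_mul (a k),
    ← Finset.sum_sub_distrib, ← Finset.sum_sub_distrib]
  refine Finset.sum_congr rfl fun k _ => ?_
  rw [integral_const_mul, integral_const_mul, integral_const_mul]
  ring

/-- Continuity of the defect in `φ` and `φ''` for the uniform norm, as needed to pass from cosine
polynomials to all Neumann test functions. -/
theorem exists_abs_heatDefect_le {z : ℝ × ℝ → ℝ} (hz : Continuous z) {t : ℝ}
    (hg : IntegrableOn g (Icc 0 1 ×ˢ Icc t₀ t)) :
    ∃ C : ℝ, 0 ≤ C ∧ ∀ (φ ψ : ℝ → ℝ) (δ : ℝ), (∀ x ∈ Icc (0 : ℝ) 1, |φ x| ≤ δ) →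
      (∀ x ∈ Icc (0 : ℝ) 1, |ψ x| ≤ δ) → |heatDefect t₀ g z t φ ψ| ≤ C * δ := by
  have hc : IsCompact (Icc (0 : ℝ) 1 ×ˢ Icc t₀ t) := isCompact_Icc.prod isCompact_Icc
  have hms : MeasurableSet (Icc (0 : ℝ) 1 ×ˢ Icc t₀ t) := measurableSet_Icc.prod measurableSet_Icc
  have hz1 : IntegrableOn (fun x => z (x, t)) (Icc 0 1) :=
    (hz.comp (by fun_prop : Continuous fun x => (x, t))).continuousOn.integrableOn_Icc
  have hz2 : IntegrableOn z (Icc (0 : ℝ) 1 ×ˢ Icc t₀ t) := hz.continuousOn.integrableOn_compact hc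
  have bound : ∀ {X : Type} [MeasurableSpace X] (μ : Measure X) (s : Set X) (w φ : X → ℝ) (δ : ℝ),
      MeasurableSet s → IntegrableOn w s μ → (∀ x ∈ s, |φ x| ≤ δ) →
      |∫ x in s, w x * φ x ∂μ| ≤ (∫ x in s, |w x| ∂μ) * δ := by
    intro X _ μ s w φ δ hs hw hφ
    rw [← integral_mul_const, ← Real.norm_eq_abs]
    refine norm_integral_le_of_norm_le (hw.abs.mul_const δ) ?_
    filter_upwards [ae_restrict_mem hs] with x hx
    rw [norm_mul]
    exact mul_le_mul_of_nonneg_left (hφ x hx) (abs_nonneg _)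
  refine ⟨(∫ x in Icc (0 : ℝ) 1, |z (x, t)|) + (∫ p in Icc (0 : ℝ) 1 ×ˢ Icc t₀ t, |z p|) +
    ∫ p in Icc (0 : ℝ) 1 ×ˢ Icc t₀ t, |g p|, ?_, fun φ ψ δ hφ hψ => ?_⟩
  · have h1 : 0 ≤ ∫ x in Icc (0 : ℝ) 1, |z (x, t)| := integral_nonneg fun _ => abs_nonneg _
    have h2 : 0 ≤ ∫ p in Icc (0 : ℝ) 1 ×ˢ Icc t₀ t, |z p| := integral_nonneg fun _ => abs_nonneg _
    have h3 : 0 ≤ ∫ p in Icc (0 : ℝ) 1 ×ˢ Icc t₀ t, |g p| := integral_nonneg fun _ => abs_nonneg _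
    linarith
  · have b1 := bound volume (Icc (0 : ℝ) 1) (fun x => z (x, t)) φ δ measurableSet_Icc hz1 hφ
    have b2 := bound volume (Icc (0 : ℝ) 1 ×ˢ Icc t₀ t) z (fun p => ψ p.1) δ hms hz2
      fun p hp => hψ p.1 hp.1
    have b3 := bound volume (Icc (0 : ℝ) 1 ×ˢ Icc t₀ t) g (fun p => φ p.1) δ hms hg
      fun p hp => hφ p.1 hp.1
    rw [add_mul, add_mul]
    exact (abs_sub _ _).trans (add_le_add ((abs_sub _ _).trans (add_le_add b1 b2)) b3)

end

/-- The Neumann heat equation with square integrable source has a solution whose spatial Hölder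
seminorm of order `γ < 1/2` is controlled by the `L²` norm of the source. -/
theorem exists_heat_potential {γ : ℝ} (hγ0 : 0 < γ) (hγ : γ < 1 / 2) :
    ∃ C : ℝ, 0 ≤ C ∧ ∀ (t₀ t₁ : ℝ) (g : ℝ × ℝ → ℝ),
      MemLp g 2 (volume.restrict (Icc 0 1 ×ˢ Icc t₀ t₁)) →
      ∃ z : ℝ × ℝ → ℝ, Continuous z ∧
        (∀ x y t, |z (x, t) - z (y, t)| ≤
          C * √(∫ p in Icc 0 1 ×ˢ Icc t₀ t₁, g p ^ 2) * |x - y| ^ γ) ∧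
        ∀ t ∈ Icc t₀ t₁, ∀ φ : ℝ → ℝ, ContDiff ℝ ∞ φ → deriv φ 0 = 0 → deriv φ 1 = 0 →
          ∫ x in Icc (0 : ℝ) 1, z (x, t) * φ x =
            (∫ p in Icc 0 1 ×ˢ Icc t₀ t, z p * deriv (deriv φ) p.1) +
              ∫ p in Icc 0 1 ×ˢ Icc t₀ t, g p * φ p.1 := by
  set S := ∑' k : ℕ, (k : ℝ) ^ (2 * γ - 2) with hS
  have hS0 : 0 ≤ S := tsum_nonneg fun k => by positivity
  refine ⟨2 * Real.pi * √S, by have := Real.pi_pos; positivity, fun t₀ t₁ g hg => ?_⟩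
  obtain ⟨z, hz⟩ := exists_tendstoUniformly_duhamelSum hg
  have hzc : Continuous z := hz.continuous
    (Filter.Frequently.of_forall fun n => continuous_duhamelSum hg n)
  have hpt : ∀ p, Filter.Tendsto (fun n => duhamelSum t₀ t₁ g n p) Filter.atTop (nhds (z p)) :=
    fun p => hz.tendsto_at p
  refine ⟨z, hzc, fun x y t => ?_, fun t ht φ hφ h0 h1 => ?_⟩
  · have hG0 : 0 ≤ ∫ p in Icc 0 1 ×ˢ Icc t₀ t₁, g p ^ 2 := integral_nonneg fun p => sq_nonneg _
    have hlim := ((hpt (x, t)).sub (hpt (y, t))).pow 2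
    have hle := le_of_tendsto' hlim fun n => duhamelSum_space_sub_sq_le hg hγ0 hγ n x y t
    have hr0 : 0 ≤ |x - y| ^ γ := Real.rpow_nonneg (abs_nonneg _) _
    refine abs_le_of_sq_le_sq (hle.trans (le_of_eq ?_))
      (by have := Real.pi_pos; positivity)
    rw [mul_pow, mul_pow, mul_pow, Real.sq_sqrt hS0, Real.sq_sqrt hG0]
    ring
  · have hgt : IntegrableOn g (Icc 0 1 ×ˢ Icc t₀ t) :=
      IntegrableOn.mono_set (hg.integrable (by norm_num))
        (prod_mono subset_rfl (Icc_subset_Icc le_rfl ht.2))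
    have hcos : ∀ k : ℕ, heatDefect t₀ g z t (cosMode k)
        (fun x => -(k * Real.pi) ^ 2 * cosMode k x) = 0 := by
      intro k
      have hode := duhamelCoeff_ode hg k ht
      have e : ∫ p in Icc 0 1 ×ˢ Icc t₀ t, z p * (-(k * Real.pi) ^ 2 * cosMode k p.1) =
          -(k * Real.pi) ^ 2 * ∫ r in t₀..t, duhamelCoeff t₀ t₁ g k r := by
        have e1 : ∀ p : ℝ × ℝ, z p * (-(k * Real.pi) ^ 2 * cosMode k p.1) =
            -(k * Real.pi) ^ 2 * (z p * cosMode k p.1) := fun p => by ring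
        simp_rw [e1]
        rw [integral_const_mul, volume_restrict_Icc_prod, integral_prod_symm,
          intervalIntegral.integral_of_le ht.1, ← integral_Icc_eq_integral_Ioc]
        · simp_rw [integral_limit_mul_cosMode hg hz k]
        · rw [← volume_restrict_Icc_prod]
          exact (hzc.mul ((continuous_cosMode k).comp
            continuous_fst)).continuousOn.integrableOn_compact (isCompact_Icc.prod isCompact_Icc)
      rw [heatDefect, integral_limit_mul_cosMode hg hz k, e, ← hode]
      ring
    have hφ' : ContDiff ℝ ∞ (deriv φ) := (contDiff_infty_iff_deriv.1 hφ).2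
    have hφ'' : ContDiff ℝ ∞ (deriv (deriv φ)) := (contDiff_infty_iff_deriv.1 hφ').2
    obtain ⟨C, hC0, hC⟩ := exists_abs_heatDefect_le hzc hgt
    -- The defect is linear, vanishes on each mode by `hcos`, and is continuous under uniform
    -- approximation of `φ` and `φ''`.
    have hzero : heatDefect t₀ g z t φ (deriv (deriv φ)) = 0 := by
      refine abs_eq_zero.1 (le_antisymm (le_of_forall_pos_le_add fun ε hε => ?_) (abs_nonneg _))
      obtain ⟨F, a, hFa⟩ := exists_cosMode_near_of_neumann hφ h0 h1
        (δ := ε / (C + 1)) (by positivity)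
      have hq1 : Continuous fun x => ∑ k ∈ F, a k * cosMode k x :=
        continuous_finsetSum _ fun k _ => (continuous_cosMode k).const_mul _
      have hq2 : Continuous fun x => ∑ k ∈ F, a k * (-(k * Real.pi) ^ 2 * cosMode k x) :=
        continuous_finsetSum _ fun k _ => ((continuous_cosMode k).const_mul _).const_mul _
      have hb := hC _ _ _ (fun x hx => (hFa x hx).1) (fun x hx => (hFa x hx).2)
      rw [heatDefect_sub hzc hgt hφ.continuous hq1 hφ''.continuous hq2,
        heatDefect_sum hzc hgt F a continuous_cosMode
          (ψ := fun k x => -(k * Real.pi) ^ 2 * cosMode k x)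
          (fun k => (continuous_cosMode k).const_mul _),
        Finset.sum_eq_zero fun k _ => by rw [hcos k, mul_zero], sub_zero] at hb
      refine hb.trans ?_
      rw [zero_add, ← mul_div_assoc, div_le_iff₀ (by positivity)]
      nlinarith
    rw [heatDefect] at hzero
    linarith

/-! ### Measurability and square integrability of the source. -/

/-- Nearest point projection onto `[a, b]`. -/
noncomputable def clip (a b x : ℝ) : ℝ := max a (min b x)

theorem continuous_clip (a b : ℝ) : Continuous (clip a b) := by
  unfold clip
  fun_prop

theorem clip_mem {a b : ℝ} (h : a ≤ b) (x : ℝ) : clip a b x ∈ Icc a b :=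
  ⟨le_max_left _ _, max_le h (min_le_left _ _)⟩

theorem clip_of_mem {a b x : ℝ} (h : x ∈ Icc a b) : clip a b x = x := by
  rw [clip, min_eq_right h.2, max_eq_right h.1]

/-- Extends a function continuous on the rectangle to the whole plane, since `IsObstacleSolution`
asks for global continuity. -/
theorem continuous_comp_clip {w : ℝ → ℝ → ℝ} {a b : ℝ} (hab : a ≤ b)
    (hw : ContinuousOn (fun p : ℝ × ℝ => w p.1 p.2) (Icc 0 1 ×ˢ Icc a b)) :
    Continuous fun p : ℝ × ℝ => w (clip 0 1 p.1) (clip a b p.2) :=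
  hw.comp_continuous (f := fun p : ℝ × ℝ => (clip 0 1 p.1, clip a b p.2))
    (((continuous_clip 0 1).comp continuous_fst).prodMk ((continuous_clip a b).comp continuous_snd))
    fun _ => ⟨clip_mem zero_le_one _, clip_mem hab _⟩

/-- Superposition with a Carathéodory function preserves measurability. -/
theorem aestronglyMeasurable_superposition {f : ℝ → ℝ → ℝ} {C : ℝ}
    (hf : ∀ y, AEMeasurable (fun x => f x y) (volume.restrict (Icc 0 1)))
    (hC : ∀ x ∈ Icc (0 : ℝ) 1, ∀ y z, |f x y - f x z| ≤ C * |y - z|) {w : ℝ × ℝ → ℝ}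
    (hw : Measurable w) (a b : ℝ) :
    AEStronglyMeasurable (fun p => f p.1 (w p)) (volume.restrict (Icc 0 1 ×ˢ Icc a b)) := by
  -- The exceptional null set depends on `y`. Rational values of `y` give one common set of full
  -- measure, and continuity in `y` covers the rest.
  have hae : ∀ᵐ x ∂volume.restrict (Icc (0 : ℝ) 1),
      x ∈ Icc (0 : ℝ) 1 ∧ ∀ q : ℚ, f x q = (hf q).mk _ x :=
    (ae_restrict_mem measurableSet_Icc).and (ae_all_iff.2 fun q => (hf q).ae_eq_mk)
  obtain ⟨G, hG, hGm, hGp⟩ := hae.exists_measurable_mem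
  set F : ℝ → ℝ → ℝ := fun y x => G.indicator (fun x => f x y) x with hF
  have hcont : ∀ x, Continuous fun y => F y x := by
    intro x
    by_cases hx : x ∈ G
    · simp only [hF, indicator_of_mem hx]
      have hL : LipschitzWith (Real.toNNReal C) (f x) := LipschitzWith.of_dist_le_mul fun y z => by
        rw [Real.dist_eq, Real.dist_eq]
        exact (hC x (hGp x hx).1 y z).trans
          (mul_le_mul_of_nonneg_right (Real.le_coe_toNNReal C) (abs_nonneg _))
      exact hL.continuous
    · simp only [hF, indicator_of_notMem hx]
      exact continuous_const
  have hmq : ∀ q : ℚ, Measurable (F q) := by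
    intro q
    have : F q = G.indicator ((hf q).mk _) := by
      funext x
      by_cases hx : x ∈ G
      · simp only [hF, indicator_of_mem hx, (hGp x hx).2 q]
      · simp only [hF, indicator_of_notMem hx]
    rw [this]
    exact (hf q).measurable_mk.indicator hGm
  have hmeas : ∀ y, Measurable (F y) := by
    intro y
    obtain ⟨q, -, -, hq⟩ := Real.exists_seq_rat_strictMono_tendsto y
    refine measurable_of_tendsto_metrizable (fun n => hmq (q n)) (tendsto_pi_nhds.2 fun x => ?_)
    exact ((hcont x).tendsto y).comp hq
  have hunc := measurable_uncurry_of_continuous_of_measurable hcont hmeas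
  have hcomp : Measurable fun p : ℝ × ℝ => F (w p) p.1 :=
    hunc.comp (hw.prodMk measurable_fst)
  refine hcomp.aestronglyMeasurable.congr ?_
  rw [volume_restrict_Icc_prod]
  filter_upwards [Measure.quasiMeasurePreserving_fst.ae hG] with p hp
  simp only [hF]
  rw [indicator_of_mem hp]

/-- The absolutely continuous part of the right-hand side of the skeleton equation, with the
zeroth order term absorbed. -/
def source (α : ℝ) (f σ : ℝ → ℝ → ℝ) (hdot u : ℝ → ℝ → ℝ) (p : ℝ × ℝ) : ℝ :=
  f p.1 (u p.1 p.2) + σ p.1 (u p.1 p.2) * hdot p.1 p.2 - α * u p.1 p.2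

section
variable {α : ℝ} {f σ hdot u : ℝ → ℝ → ℝ} {h : ℝ → ℝ → ℝ} {t₀ t₁ : ℝ}

theorem F1.aestronglyMeasurable_f (hF : F1 f σ) (h01 : t₀ ≤ t₁)
    (hu : ContinuousOn (fun p : ℝ × ℝ => u p.1 p.2) (Icc 0 1 ×ˢ Icc t₀ t₁)) :
    AEStronglyMeasurable (fun p : ℝ × ℝ => f p.1 (u p.1 p.2))
      (volume.restrict (Icc 0 1 ×ˢ Icc t₀ t₁)) := by
  obtain ⟨C, _, hC⟩ := hF.lipschitz
  refine (aestronglyMeasurable_superposition hF.meas_f (C := C)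
    (fun x hx y z => (le_add_of_nonneg_right (abs_nonneg _)).trans (hC x hx y z))
    (continuous_comp_clip h01 hu).measurable t₀ t₁).congr ?_
  filter_upwards [ae_restrict_mem (measurableSet_Icc.prod measurableSet_Icc)] with p hp
  rw [clip_of_mem hp.1, clip_of_mem hp.2]

theorem F1.aestronglyMeasurable_σ (hF : F1 f σ) (h01 : t₀ ≤ t₁)
    (hu : ContinuousOn (fun p : ℝ × ℝ => u p.1 p.2) (Icc 0 1 ×ˢ Icc t₀ t₁)) :
    AEStronglyMeasurable (fun p : ℝ × ℝ => σ p.1 (u p.1 p.2))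
      (volume.restrict (Icc 0 1 ×ˢ Icc t₀ t₁)) := by
  obtain ⟨C, _, hC⟩ := hF.lipschitz
  refine (aestronglyMeasurable_superposition hF.meas_σ (C := C)
    (fun x hx y z => (le_add_of_nonneg_left (abs_nonneg _)).trans (hC x hx y z))
    (continuous_comp_clip h01 hu).measurable t₀ t₁).congr ?_
  filter_upwards [ae_restrict_mem (measurableSet_Icc.prod measurableSet_Icc)] with p hp
  rw [clip_of_mem hp.1, clip_of_mem hp.2]

theorem CameronMartin.memLp (hh : CameronMartin h hdot) (h0 : 0 ≤ t₀) (h01 : t₀ ≤ t₁) :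
    MemLp (fun p : ℝ × ℝ => hdot p.1 p.2) 2 (volume.restrict (Icc 0 1 ×ˢ Icc t₀ t₁)) :=
  (hh.sq_integrable (t₁ + 1) (by linarith)).mono_measure
    (Measure.restrict_mono (prod_mono subset_rfl (Icc_subset_Icc h0 (by linarith))) le_rfl)

theorem CameronMartin.memLp_σ (hF : F1 f σ) (hh : CameronMartin h hdot) (h0 : 0 ≤ t₀)
    (h01 : t₀ ≤ t₁) (hu : ContinuousOn (fun p : ℝ × ℝ => u p.1 p.2) (Icc 0 1 ×ˢ Icc t₀ t₁)) :
    MemLp (fun p : ℝ × ℝ => σ p.1 (u p.1 p.2) * hdot p.1 p.2) 2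
      (volume.restrict (Icc 0 1 ×ˢ Icc t₀ t₁)) := by
  obtain ⟨M, hM⟩ := hF.bounded
  have hd := hh.memLp h0 h01
  refine hd.of_le_mul (c := M) ((hF.aestronglyMeasurable_σ h01 hu).mul hd.aestronglyMeasurable) ?_
  filter_upwards [ae_restrict_mem (measurableSet_Icc.prod measurableSet_Icc)] with p hp
  rw [norm_mul]
  exact mul_le_mul_of_nonneg_right (hM p.1 hp.1 _).2 (norm_nonneg _)

theorem F1.memLp_f (hF : F1 f σ)
    (h01 : t₀ ≤ t₁) (hu : ContinuousOn (fun p : ℝ × ℝ => u p.1 p.2) (Icc 0 1 ×ˢ Icc t₀ t₁)) :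
    MemLp (fun p : ℝ × ℝ => f p.1 (u p.1 p.2)) 2 (volume.restrict (Icc 0 1 ×ˢ Icc t₀ t₁)) := by
  obtain ⟨M, hM⟩ := hF.bounded
  refine MemLp.of_bound (hF.aestronglyMeasurable_f h01 hu) M ?_
  filter_upwards [ae_restrict_mem (measurableSet_Icc.prod measurableSet_Icc)] with p hp
  exact (hM p.1 hp.1 _).1

theorem memLp_of_continuousOn (hu : ContinuousOn (fun p : ℝ × ℝ => u p.1 p.2)
    (Icc 0 1 ×ˢ Icc t₀ t₁)) :
    MemLp (fun p : ℝ × ℝ => u p.1 p.2) 2 (volume.restrict (Icc 0 1 ×ˢ Icc t₀ t₁)) := by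
  have hc : IsCompact (Icc (0 : ℝ) 1 ×ˢ Icc t₀ t₁) := isCompact_Icc.prod isCompact_Icc
  obtain ⟨B, hB⟩ := hc.exists_bound_of_continuousOn hu
  refine MemLp.of_bound (hu.aestronglyMeasurable (measurableSet_Icc.prod measurableSet_Icc)) B ?_
  filter_upwards [ae_restrict_mem (measurableSet_Icc.prod measurableSet_Icc)] with p hp
  exact hB p hp

theorem memLp_source (α : ℝ) (hF : F1 f σ) (hh : CameronMartin h hdot) (h0 : 0 ≤ t₀)
    (h01 : t₀ ≤ t₁) (hu : ContinuousOn (fun p : ℝ × ℝ => u p.1 p.2) (Icc 0 1 ×ˢ Icc t₀ t₁)) :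
    MemLp (source α f σ hdot u) 2 (volume.restrict (Icc 0 1 ×ˢ Icc t₀ t₁)) :=
  ((hF.memLp_f h01 hu).add (hh.memLp_σ hF h0 h01 hu)).sub ((memLp_of_continuousOn hu).const_mul α)

theorem integral_hdot_sq_le (hh : CameronMartin h hdot) (h0 : 0 ≤ t₀)
    (h01 : t₀ ≤ t₁) (hE : energy hdot ≠ ⊤) :
    ∫ p in Icc 0 1 ×ˢ Icc t₀ t₁, hdot p.1 p.2 ^ 2 ≤ (energy hdot).toReal := by
  have hd := (hh.memLp h0 h01).integrable_sq
  have h1 := ofReal_integral_eq_lintegral_ofReal hd (Filter.Eventually.of_forall fun p => sq_nonneg _)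
  have h2 : ENNReal.ofReal (∫ p in Icc 0 1 ×ˢ Icc t₀ t₁, hdot p.1 p.2 ^ 2) ≤ energy hdot := by
    rw [h1]
    exact lintegral_mono_set (prod_mono subset_rfl fun s hs => h0.trans hs.1)
  exact (ENNReal.ofReal_le_iff_le_toReal hE).1 h2

theorem integral_source_sq_le (hF : F1 f σ) (hh : CameronMartin h hdot) (h0 : 0 ≤ t₀)
    (h01 : t₀ ≤ t₁) (hlen : t₁ ≤ t₀ + 1)
    (hu : ContinuousOn (fun p : ℝ × ℝ => u p.1 p.2) (Icc 0 1 ×ˢ Icc t₀ t₁))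
    (hE : energy hdot ≠ ⊤) {M B : ℝ}
    (hM : ∀ x ∈ Icc (0 : ℝ) 1, ∀ y, |f x y| ≤ M ∧ |σ x y| ≤ M)
    (hB : ∀ x ∈ Icc (0 : ℝ) 1, ∀ t ∈ Icc t₀ t₁, |u x t| ≤ B) :
    ∫ p in Icc 0 1 ×ˢ Icc t₀ t₁, source α f σ hdot u p ^ 2 ≤
      3 * (M ^ 2 + α ^ 2 * B ^ 2) + 3 * M ^ 2 * (energy hdot).toReal := by
  have hd := (hh.memLp h0 h01).integrable_sq
  have hle : ∫ p in Icc 0 1 ×ˢ Icc t₀ t₁, source α f σ hdot u p ^ 2 ≤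
      ∫ p in Icc 0 1 ×ˢ Icc t₀ t₁,
        (3 * (M ^ 2 + α ^ 2 * B ^ 2) + 3 * M ^ 2 * hdot p.1 p.2 ^ 2) := by
    refine setIntegral_mono_on (memLp_source α hF hh h0 h01 hu).integrable_sq
      ((integrable_const _).add (hd.const_mul _)) (measurableSet_Icc.prod measurableSet_Icc)
      fun p hp => ?_
    obtain ⟨h1, h2⟩ := hM p.1 hp.1 (u p.1 p.2)
    have h3 := hB p.1 hp.1 p.2 hp.2
    have e1 : f p.1 (u p.1 p.2) ^ 2 ≤ M ^ 2 := sq_le_sq.2 (h1.trans (le_abs_self _))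
    have e2 : σ p.1 (u p.1 p.2) ^ 2 ≤ M ^ 2 := sq_le_sq.2 (h2.trans (le_abs_self _))
    have e3 : u p.1 p.2 ^ 2 ≤ B ^ 2 := sq_le_sq.2 (h3.trans (le_abs_self _))
    have e4 : ∀ a b c : ℝ, (a + b - c) ^ 2 ≤ 3 * (a ^ 2 + b ^ 2 + c ^ 2) := fun a b c => by
      nlinarith [sq_nonneg (a - b), sq_nonneg (a + c), sq_nonneg (b + c)]
    refine (e4 _ _ _).trans ?_
    rw [mul_pow, mul_pow]
    have e5 := mul_le_mul_of_nonneg_right e2 (sq_nonneg (hdot p.1 p.2))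
    have e6 := mul_le_mul_of_nonneg_left e3 (sq_nonneg α)
    linarith
  refine hle.trans ?_
  rw [integral_add (integrable_const _) (hd.const_mul _), integral_const, integral_const_mul]
  -- The window has length at most `1`, which keeps the constant independent of `t`.
  have hvol : (volume.restrict (Icc (0 : ℝ) 1 ×ˢ Icc t₀ t₁)).real univ ≤ 1 := by
    rw [volume_restrict_Icc_prod, ← univ_prod_univ, measureReal_prod_prod]
    simp [Measure.real]
    rw [ENNReal.toReal_ofReal (by linarith)]
    linarith
  have h1 := integral_hdot_sq_le hh h0 h01 hE
  have h2 : 0 ≤ 3 * (M ^ 2 + α ^ 2 * B ^ 2) := by positivity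
  have h3 : 0 ≤ 3 * M ^ 2 := by positivity
  rw [smul_eq_mul]
  exact add_le_add (mul_le_of_le_one_left h2 hvol) (mul_le_mul_of_nonneg_left h1 h3)

end

/-! ### Time increments and the reduction to the obstacle problem. -/

/-- The slab is half-open because `η` and `ξ` may charge the time slice at `s`. -/
theorem integral_prod_Icc_sub {μ : Measure (ℝ × ℝ)} {F : ℝ × ℝ → ℝ} {a s t : ℝ} (has : a ≤ s)
    (hst : s ≤ t) (hF : IntegrableOn F (Icc 0 1 ×ˢ Icc a t) μ) :
    (∫ p in Icc 0 1 ×ˢ Icc a t, F p ∂μ) - ∫ p in Icc 0 1 ×ˢ Icc a s, F p ∂μ =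
      ∫ p in Icc 0 1 ×ˢ Ioc s t, F p ∂μ := by
  have hset : Icc (0 : ℝ) 1 ×ˢ Icc a t = Icc (0 : ℝ) 1 ×ˢ Icc a s ∪ Icc (0 : ℝ) 1 ×ˢ Ioc s t := by
    rw [← prod_union, Icc_union_Ioc_eq_Icc has hst]
  have hdisj : Disjoint (Icc (0 : ℝ) 1 ×ˢ Icc a s) (Icc (0 : ℝ) 1 ×ˢ Ioc s t) := by
    refine Disjoint.set_prod_right ?_ _ _
    rw [Set.disjoint_left]
    exact fun r h1 h2 => absurd h1.2 (not_le.2 h2.1)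
  rw [hset] at hF ⊢
  rw [setIntegral_union hdisj (measurableSet_Icc.prod measurableSet_Ioc)
    (hF.mono_set subset_union_left) (hF.mono_set subset_union_right)]
  ring

theorem integral_prod_Ioc_eq {F : ℝ × ℝ → ℝ} {s t : ℝ} (hst : s ≤ t)
    (hF : IntegrableOn F (Icc 0 1 ×ˢ Icc s t)) :
    ∫ p in Icc 0 1 ×ˢ Ioc s t, F p = ∫ r in s..t, ∫ x in Icc (0 : ℝ) 1, F (x, r) := by
  have hF' : IntegrableOn F (Icc 0 1 ×ˢ Ioc s t) :=
    hF.mono_set (prod_mono subset_rfl Ioc_subset_Icc_self)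
  have e : (volume : Measure (ℝ × ℝ)).restrict (Icc 0 1 ×ˢ Ioc s t) =
      (volume.restrict (Icc 0 1)).prod (volume.restrict (Ioc s t)) := by
    rw [Measure.prod_restrict, Measure.volume_eq_prod]
  rw [intervalIntegral.integral_of_le hst, e, integral_prod_symm]
  rw [← e]
  exact hF'

theorem integrableOn_prod_of_finite {μ : Measure (ℝ × ℝ)} {F : ℝ × ℝ → ℝ} {a b : ℝ}
    (hμ : μ (Icc 0 1 ×ˢ Icc a b) < ⊤) (hF : ContinuousOn F (Icc 0 1 ×ˢ Icc a b)) :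
    IntegrableOn F (Icc 0 1 ×ˢ Icc a b) μ := by
  have hc : IsCompact (Icc (0 : ℝ) 1 ×ˢ Icc a b) := isCompact_Icc.prod isCompact_Icc
  have hms : MeasurableSet (Icc (0 : ℝ) 1 ×ˢ Icc a b) := measurableSet_Icc.prod measurableSet_Icc
  obtain ⟨B, hB⟩ := hc.exists_bound_of_continuousOn hF
  have : IsFiniteMeasure (μ.restrict (Icc 0 1 ×ˢ Icc a b)) := ⟨by rwa [Measure.restrict_apply_univ]⟩
  refine Integrable.of_bound (hF.aestronglyMeasurable hms) B ?_
  filter_upwards [ae_restrict_mem hms] with p hp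
  exact hB p hp

namespace IsSkeletonSolution

variable {α : ℝ} {K₁ K₂ : ℝ → ℝ} {f σ : ℝ → ℝ → ℝ} {u₀ : ℝ → ℝ} {h hdot u : ℝ → ℝ → ℝ}
  {η ξ : Measure (ℝ × ℝ)} {t₀ t₁ : ℝ}

theorem continuousOn_Icc (hs : IsSkeletonSolution α K₁ K₂ f σ u₀ hdot u η ξ) (h0 : 0 ≤ t₀) :
    ContinuousOn (fun p : ℝ × ℝ => u p.1 p.2) (Icc 0 1 ×ˢ Icc t₀ t₁) :=
  hs.cont.mono (prod_mono subset_rfl fun _ hs => h0.trans hs.1)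

/-- A nonnegative function with zero integral vanishes almost everywhere. Finiteness of `η` on the
cylinder matters here: it makes the integrand integrable, so the integral is not zero merely by
convention. -/
theorem ae_eq_lower (hs : IsSkeletonSolution α K₁ K₂ f σ u₀ hdot u η ξ) (hK : Walls K₁ K₂)
    {T : ℝ} (hT : 0 < T) : ∀ᵐ p ∂η.restrict (Icc 0 1 ×ˢ Icc 0 T), u p.1 p.2 = K₁ p.1 := by
  have hc : ContinuousOn (fun p : ℝ × ℝ => u p.1 p.2 - K₁ p.1) (Icc 0 1 ×ˢ Icc 0 T) :=
    (hs.continuousOn_Icc le_rfl).sub (hK.cont₁.comp continuousOn_fst fun p hp => hp.1)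
  have h1 := (setIntegral_eq_zero_iff_of_nonneg_ae ?_
    (integrableOn_prod_of_finite (hs.finite_η T hT) hc)).1 (hs.contact_η T hT)
  · filter_upwards [h1] with p hp
    exact sub_eq_zero.1 hp
  · filter_upwards [ae_restrict_mem (measurableSet_Icc.prod measurableSet_Icc)] with p hp
    exact sub_nonneg.2 (hs.between p.1 hp.1 p.2 hp.2.1).1

theorem ae_eq_upper (hs : IsSkeletonSolution α K₁ K₂ f σ u₀ hdot u η ξ) (hK : Walls K₁ K₂)
    {T : ℝ} (hT : 0 < T) : ∀ᵐ p ∂ξ.restrict (Icc 0 1 ×ˢ Icc 0 T), u p.1 p.2 = K₂ p.1 := by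
  have hc : ContinuousOn (fun p : ℝ × ℝ => K₂ p.1 - u p.1 p.2) (Icc 0 1 ×ˢ Icc 0 T) :=
    (hK.cont₂.comp continuousOn_fst fun p hp => hp.1).sub (hs.continuousOn_Icc le_rfl)
  have h1 := (setIntegral_eq_zero_iff_of_nonneg_ae ?_
    (integrableOn_prod_of_finite (hs.finite_ξ T hT) hc)).1 (hs.contact_ξ T hT)
  · filter_upwards [h1] with p hp
    exact (sub_eq_zero.1 hp).symm
  · filter_upwards [ae_restrict_mem (measurableSet_Icc.prod measurableSet_Icc)] with p hp
    exact sub_nonneg.2 (hs.between p.1 hp.1 p.2 hp.2.1).2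

/-- The weak formulation on a time interval `(s, t]`. -/
theorem weak_increment (hs : IsSkeletonSolution α K₁ K₂ f σ u₀ hdot u η ξ) (hF : F1 f σ)
    (hh : CameronMartin h hdot) {s t : ℝ} (h0 : 0 ≤ s) (hst : s ≤ t) {φ : ℝ → ℝ}
    (hφ : ContDiff ℝ ∞ φ) (hφ0 : deriv φ 0 = 0) (hφ1 : deriv φ 1 = 0) :
    (∫ x in Icc 0 1, u x t * φ x) - (∫ x in Icc 0 1, u x s * φ x) =
      (∫ p in Icc 0 1 ×ˢ Ioc s t, u p.1 p.2 * deriv (deriv φ) p.1)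
        + (∫ p in Icc 0 1 ×ˢ Ioc s t, source α f σ hdot u p * φ p.1)
        + (∫ p in Icc 0 1 ×ˢ Ioc s t, φ p.1 ∂η) - ∫ p in Icc 0 1 ×ˢ Ioc s t, φ p.1 ∂ξ := by
  have hφ'' : ContDiff ℝ ∞ (deriv (deriv φ)) :=
    (contDiff_infty_iff_deriv.1 (contDiff_infty_iff_deriv.1 hφ).2).2
  have h0t := h0.trans hst
  have hc : IsCompact (Icc (0 : ℝ) 1 ×ˢ Icc (0 : ℝ) t) := isCompact_Icc.prod isCompact_Icc
  have hu : ContinuousOn (fun p : ℝ × ℝ => u p.1 p.2) (Icc 0 1 ×ˢ Icc 0 t) :=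
    hs.continuousOn_Icc le_rfl
  have hφc : ContinuousOn (fun p : ℝ × ℝ => φ p.1) (Icc 0 1 ×ˢ Icc 0 t) :=
    (hφ.continuous.comp continuous_fst).continuousOn
  have hφc'' : ContinuousOn (fun p : ℝ × ℝ => deriv (deriv φ) p.1) (Icc 0 1 ×ˢ Icc 0 t) :=
    (hφ''.continuous.comp continuous_fst).continuousOn
  have iu : IntegrableOn (fun p : ℝ × ℝ => u p.1 p.2 * φ p.1) (Icc 0 1 ×ˢ Icc 0 t) :=
    (hu.mul hφc).integrableOn_compact hc
  have iu'' : IntegrableOn (fun p : ℝ × ℝ => u p.1 p.2 * deriv (deriv φ) p.1)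
      (Icc 0 1 ×ˢ Icc 0 t) := (hu.mul hφc'').integrableOn_compact hc
  have i_f : IntegrableOn (fun p : ℝ × ℝ => f p.1 (u p.1 p.2) * φ p.1) (Icc 0 1 ×ˢ Icc 0 t) :=
    IntegrableOn.mul_continuousOn ((hF.memLp_f h0t hu).integrable (by norm_num)) hφc hc
  have iσ : IntegrableOn (fun p : ℝ × ℝ => σ p.1 (u p.1 p.2) * hdot p.1 p.2 * φ p.1)
      (Icc 0 1 ×ˢ Icc 0 t) :=
    IntegrableOn.mul_continuousOn ((hh.memLp_σ hF le_rfl h0t hu).integrable (by norm_num)) hφc hc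
  have hfin : ∀ μ : Measure (ℝ × ℝ), (∀ T > 0, μ (cyl T) < ⊤) → μ (Icc 0 1 ×ˢ Icc 0 t) < ⊤ :=
    fun μ hμ => (measure_mono (prod_mono subset_rfl (Icc_subset_Icc le_rfl
      (by linarith)))).trans_lt (hμ (t + 1) (by linarith))
  have iη := integrableOn_prod_of_finite (hfin η hs.finite_η) hφc
  have iξ := integrableOn_prod_of_finite (hfin ξ hs.finite_ξ) hφc
  have hsub : Icc (0 : ℝ) 1 ×ˢ Ioc s t ⊆ Icc (0 : ℝ) 1 ×ˢ Icc 0 t :=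
    prod_mono subset_rfl fun r hr => ⟨h0.trans hr.1.le, hr.2⟩
  have hw1 := hs.weak t h0t φ hφ hφ0 hφ1
  have hw2 := hs.weak s h0 φ hφ hφ0 hφ1
  have e : ∫ p in Icc 0 1 ×ˢ Ioc s t, source α f σ hdot u p * φ p.1 =
      (∫ p in Icc 0 1 ×ˢ Ioc s t, f p.1 (u p.1 p.2) * φ p.1) +
      (∫ p in Icc 0 1 ×ˢ Ioc s t, σ p.1 (u p.1 p.2) * hdot p.1 p.2 * φ p.1) -
      α * ∫ p in Icc 0 1 ×ˢ Ioc s t, u p.1 p.2 * φ p.1 := by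
    have e1 : ∀ p : ℝ × ℝ, source α f σ hdot u p * φ p.1 = f p.1 (u p.1 p.2) * φ p.1 +
        σ p.1 (u p.1 p.2) * hdot p.1 p.2 * φ p.1 - α * (u p.1 p.2 * φ p.1) := fun p => by
      simp only [source]; ring
    have i1 : IntegrableOn (fun p : ℝ × ℝ => f p.1 (u p.1 p.2) * φ p.1 +
        σ p.1 (u p.1 p.2) * hdot p.1 p.2 * φ p.1) (Icc 0 1 ×ˢ Ioc s t) :=
      (i_f.mono_set hsub).add (iσ.mono_set hsub)
    simp_rw [e1]
    rw [integral_sub i1 ((iu.mono_set hsub).const_mul α),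
      integral_add (i_f.mono_set hsub) (iσ.mono_set hsub), integral_const_mul]
  rw [e]
  rw [← integral_prod_Icc_sub h0 hst iu, ← integral_prod_Icc_sub h0 hst iu'',
    ← integral_prod_Icc_sub h0 hst i_f, ← integral_prod_Icc_sub h0 hst iσ,
    ← integral_prod_Icc_sub h0 hst iη, ← integral_prod_Icc_sub h0 hst iξ]
  simp only [cyl] at hw1 hw2
  linarith

/-- Subtracting a heat potential of the source turns the skeleton equation into an obstacle
problem without source. -/
theorem isObstacleSolution (hs : IsSkeletonSolution α K₁ K₂ f σ u₀ hdot u η ξ)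
    (hK : Walls K₁ K₂) (hF : F1 f σ) (hh : CameronMartin h hdot) (h0 : 0 ≤ t₀) (h01 : t₀ < t₁)
    {z : ℝ × ℝ → ℝ} (hz : Continuous z)
    (hzw : ∀ t ∈ Icc t₀ t₁, ∀ φ : ℝ → ℝ, ContDiff ℝ ∞ φ → deriv φ 0 = 0 → deriv φ 1 = 0 →
      ∫ x in Icc (0 : ℝ) 1, z (x, t) * φ x =
        (∫ p in Icc 0 1 ×ˢ Icc t₀ t, z p * deriv (deriv φ) p.1) +
          ∫ p in Icc 0 1 ×ˢ Icc t₀ t, source α f σ hdot u p * φ p.1) :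
    IsObstacleSolution t₀ t₁ (fun x t => K₁ (clip 0 1 x) - z (x, t))
      (fun x t => K₂ (clip 0 1 x) - z (x, t))
      (fun x t => u (clip 0 1 x) (clip t₀ t₁ t) - z (x, t)) η ξ := by
  have hsub : Icc (0 : ℝ) 1 ×ˢ Ioc t₀ t₁ ⊆ Icc (0 : ℝ) 1 ×ˢ Icc 0 t₁ :=
    prod_mono subset_rfl fun r hr => ⟨h0.trans hr.1.le, hr.2⟩
  have ht₁ : 0 < t₁ := h0.trans_lt h01
  have hu := hs.continuousOn_Icc (t₁ := t₁) h0
  refine ⟨(continuous_comp_clip h01.le hu).sub hz, ?_, ?_, fun x hx t ht => ?_,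
    fun x hx t ht => ?_, ?_, ?_, fun s t hs0 hst ht φ hφ hφ0 hφ1 => ?_⟩
  · exact (hK.cont₁.comp_continuous ((continuous_clip 0 1).comp continuous_fst)
      fun p => clip_mem zero_le_one _).sub hz
  · exact (hK.cont₂.comp_continuous ((continuous_clip 0 1).comp continuous_fst)
      fun p => clip_mem zero_le_one _).sub hz
  · rw [clip_of_mem hx, clip_of_mem ht]
    linarith [(hs.between x hx t (h0.trans ht.1)).1]
  · rw [clip_of_mem hx, clip_of_mem ht]
    linarith [(hs.between x hx t (h0.trans ht.1)).2]
  · filter_upwards [ae_restrict_of_ae_restrict_of_subset hsub (hs.ae_eq_lower hK ht₁),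
      ae_restrict_mem (measurableSet_Icc.prod measurableSet_Ioc)] with p hp hpm
    rw [clip_of_mem hpm.1, clip_of_mem (Ioc_subset_Icc_self hpm.2), hp]
  · filter_upwards [ae_restrict_of_ae_restrict_of_subset hsub (hs.ae_eq_upper hK ht₁),
      ae_restrict_mem (measurableSet_Icc.prod measurableSet_Ioc)] with p hp hpm
    rw [clip_of_mem hpm.1, clip_of_mem (Ioc_subset_Icc_self hpm.2), hp]
  · have hφ'' : ContDiff ℝ ∞ (deriv (deriv φ)) :=
      (contDiff_infty_iff_deriv.1 (contDiff_infty_iff_deriv.1 hφ).2).2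
    have hc : IsCompact (Icc (0 : ℝ) 1 ×ˢ Icc s t) := isCompact_Icc.prod isCompact_Icc
    have hc₀ : IsCompact (Icc (0 : ℝ) 1 ×ˢ Icc t₀ t) := isCompact_Icc.prod isCompact_Icc
    have hzt : ∀ r, IntegrableOn (fun x => z (x, r) * φ x) (Icc 0 1) := fun r =>
      ((hz.comp (by fun_prop : Continuous fun x => (x, r))).mul
        hφ.continuous).continuousOn.integrableOn_Icc
    have hut : ∀ r ∈ Icc t₀ t₁, IntegrableOn (fun x => u x r * φ x) (Icc 0 1) := fun r hr =>
      ((hu.comp (by fun_prop : Continuous fun x => (x, r)).continuousOn fun x hx =>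
        ⟨hx, hr⟩).mul hφ.continuous.continuousOn).integrableOn_Icc
    have hsplit : ∀ r ∈ Icc t₀ t₁,
        ∫ x in Icc 0 1, (u (clip 0 1 x) (clip t₀ t₁ r) - z (x, r)) * φ x =
          (∫ x in Icc 0 1, u x r * φ x) - ∫ x in Icc 0 1, z (x, r) * φ x := by
      intro r hr
      rw [← integral_sub (hut r hr) (hzt r)]
      refine setIntegral_congr_fun measurableSet_Icc fun x hx => ?_
      rw [clip_of_mem hx, clip_of_mem hr, sub_mul]
    have hzi : ∀ a b, IntegrableOn (fun p : ℝ × ℝ => z p * deriv (deriv φ) p.1)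
        (Icc 0 1 ×ˢ Icc a b) := fun a b =>
      (hz.mul (hφ''.continuous.comp continuous_fst)).continuousOn.integrableOn_compact
        (isCompact_Icc.prod isCompact_Icc)
    have hui : IntegrableOn (fun p : ℝ × ℝ => u p.1 p.2 * deriv (deriv φ) p.1)
        (Icc 0 1 ×ˢ Icc s t) :=
      ((hs.continuousOn_Icc (h0.trans hs0)).mul
        (hφ''.continuous.comp continuous_fst).continuousOn).integrableOn_compact hc
    have hgi : IntegrableOn (fun p : ℝ × ℝ => source α f σ hdot u p * φ p.1)
        (Icc 0 1 ×ˢ Icc t₀ t) :=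
      IntegrableOn.mul_continuousOn ((memLp_source α hF hh h0 (hs0.trans hst)
        (hs.continuousOn_Icc h0)).integrable (by norm_num))
        (hφ.continuous.comp continuous_fst).continuousOn hc₀
    have hsI : s ∈ Icc t₀ t₁ := ⟨hs0, hst.trans ht⟩
    have htI : t ∈ Icc t₀ t₁ := ⟨hs0.trans hst, ht⟩
    -- `z` carries exactly the source on the slab, so in `u - z` only the two measures remain.
    have hzinc : (∫ x in Icc 0 1, z (x, t) * φ x) - (∫ x in Icc 0 1, z (x, s) * φ x) =
        (∫ p in Icc 0 1 ×ˢ Ioc s t, z p * deriv (deriv φ) p.1) +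
          ∫ p in Icc 0 1 ×ˢ Ioc s t, source α f σ hdot u p * φ p.1 := by
      rw [hzw t htI φ hφ hφ0 hφ1, hzw s hsI φ hφ hφ0 hφ1,
        ← integral_prod_Icc_sub hs0 hst (hzi t₀ t), ← integral_prod_Icc_sub hs0 hst hgi]
      ring
    have huinc := hs.weak_increment hF hh (h0.trans hs0) hst hφ hφ0 hφ1
    have htime : (∫ r in s..t, ∫ x in Icc 0 1,
        (u (clip 0 1 x) (clip t₀ t₁ r) - z (x, r)) * deriv (deriv φ) x) =
        (∫ p in Icc 0 1 ×ˢ Ioc s t, u p.1 p.2 * deriv (deriv φ) p.1) -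
          ∫ p in Icc 0 1 ×ˢ Ioc s t, z p * deriv (deriv φ) p.1 := by
      have hsub' : Icc (0 : ℝ) 1 ×ˢ Ioc s t ⊆ Icc (0 : ℝ) 1 ×ˢ Icc s t :=
        prod_mono subset_rfl Ioc_subset_Icc_self
      rw [← integral_sub (hui.mono_set hsub') ((hzi s t).mono_set hsub')]
      have hI : IntegrableOn (fun p : ℝ × ℝ => (u (clip 0 1 p.1) (clip t₀ t₁ p.2) - z p) *
          deriv (deriv φ) p.1) (Icc 0 1 ×ˢ Icc s t) :=
        (((continuous_comp_clip h01.le hu).sub hz).mul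
          (hφ''.continuous.comp continuous_fst)).continuousOn.integrableOn_compact hc
      rw [← integral_prod_Ioc_eq hst hI]
      refine setIntegral_congr_fun (measurableSet_Icc.prod measurableSet_Ioc) fun p hp => ?_
      rw [clip_of_mem hp.1, clip_of_mem ⟨hs0.trans hp.2.1.le, hp.2.2.trans ht⟩, sub_mul]
    rw [hsplit t htI, hsplit s hsI, htime]
    linarith

end IsSkeletonSolution

/-! ### Assembling the estimate. -/

theorem Walls.exists_bound {K₁ K₂ : ℝ → ℝ} (hK : Walls K₁ K₂) :
    ∃ B : ℝ, 0 ≤ B ∧ ∀ x ∈ Icc (0 : ℝ) 1, ∀ y, K₁ x ≤ y → y ≤ K₂ x → |y| ≤ B := by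
  obtain ⟨B₁, h1, hB₁⟩ := exists_abs_le_of_continuousOn_Icc hK.cont₁
  obtain ⟨B₂, h2, hB₂⟩ := exists_abs_le_of_continuousOn_Icc hK.cont₂
  refine ⟨B₁ + B₂, by positivity, fun x hx y hy1 hy2 => ?_⟩
  have h3 := abs_le.1 (hB₁ x hx)
  have h4 := abs_le.1 (hB₂ x hx)
  exact abs_le.2 ⟨by linarith, by linarith⟩

theorem Walls.exists_holder {K₁ K₂ : ℝ → ℝ} (hK : Walls K₁ K₂) :
    ∃ L : ℝ, 0 ≤ L ∧ ∀ γ : ℝ, 0 < γ → γ ≤ 1 → ∀ x ∈ Icc (0 : ℝ) 1, ∀ y ∈ Icc (0 : ℝ) 1,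
      |K₁ x - K₁ y| ≤ L * |x - y| ^ γ ∧ |K₂ x - K₂ y| ≤ L * |x - y| ^ γ := by
  obtain ⟨L₁, h1, hL₁⟩ := exists_lipschitz_of_hasL2SecondDeriv hK.cont₁ hK.second₁
  obtain ⟨L₂, h2, hL₂⟩ := exists_lipschitz_of_hasL2SecondDeriv hK.cont₂ hK.second₂
  refine ⟨L₁ + L₂, by positivity, fun γ hγ0 hγ1 x hx y hy => ?_⟩
  have hr : |x - y| ≤ |x - y| ^ γ := by
    rcases (abs_nonneg (x - y)).eq_or_lt with h0 | h0
    · rw [← h0]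
      exact Real.rpow_nonneg le_rfl _
    · have := Real.rpow_le_rpow_of_exponent_ge h0
        (abs_le.2 ⟨by linarith [hx.1, hy.2], by linarith [hx.2, hy.1]⟩) hγ1
      rwa [Real.rpow_one] at this
  have hr0 : 0 ≤ |x - y| ^ γ := (abs_nonneg _).trans hr
  have h3 := hL₁ x hx y hy
  have h4 := hL₂ x hx y hy
  constructor <;> nlinarith

/-- The window has length `t` when `t ≤ 1` and length `1` otherwise. -/
theorem rpow_neg_half_min_le {t : ℝ} (ht : 0 < t) :
    (t - max (t - 1) 0) ^ (-(1 / 2) : ℝ) ≤ 1 + 1 / √t := by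
  have hs : 0 < √t := Real.sqrt_pos.2 ht
  have h1 : 0 < 1 / √t := by positivity
  rcases le_total (t - 1) 0 with h | h
  · rw [max_eq_right h, sub_zero, Real.rpow_neg ht.le, ← Real.sqrt_eq_rpow, ← one_div]
    linarith
  · rw [max_eq_left h, sub_sub_cancel, Real.one_rpow]
    linarith

/-- The Hölder seminorm estimate for solutions of the skeleton equation. -/
theorem exists_holder_seminorm_bound {α : ℝ} {K₁ K₂ : ℝ → ℝ} (hK : Walls K₁ K₂)
    {f σ : ℝ → ℝ → ℝ} (hF : F1 f σ) {γ : ℝ} (hγ0 : 0 < γ) (hγ : γ < 1 / 2) :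
    ∃ C : ℝ, 0 ≤ C ∧ ∀ (u₀ : ℝ → ℝ) (h hdot : ℝ → ℝ → ℝ), CameronMartin h hdot →
      energy hdot ≠ ⊤ → ∀ (u : ℝ → ℝ → ℝ) (η ξ : Measure (ℝ × ℝ)),
        IsSkeletonSolution α K₁ K₂ f σ u₀ hdot u η ξ → ∀ t : ℝ, 0 < t →
          ∀ x ∈ Icc (0 : ℝ) 1, ∀ y ∈ Icc (0 : ℝ) 1,
            |u x t - u y t| ≤
              C * (1 + 1 / √t) * (1 + (energy hdot).toReal) * |x - y| ^ γ := by
  obtain ⟨B, hB0, hB⟩ := hK.exists_bound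
  obtain ⟨L, hL0, hL⟩ := hK.exists_holder
  obtain ⟨M, hM⟩ := hF.bounded
  obtain ⟨Cz, hCz0, hCz⟩ := exists_heat_potential hγ0 hγ
  -- The summand `1` gives `D (1 + E) ≥ 1`, so the square root of the `L²` bound is at most `D (1 +
  -- E)`. This is how the energy appears without a square root.
  set D := 3 * (M ^ 2 + α ^ 2 * B ^ 2) + 1 with hD
  have hD1 : 1 ≤ D := by
    have : 0 ≤ 3 * (M ^ 2 + α ^ 2 * B ^ 2) := by positivity
    linarith
  set A := 2 * B / (4 * γ * (1 - γ)) with hA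
  have hA0 : 0 ≤ A := div_nonneg (by positivity) (mul_nonneg (by positivity) (by linarith))
  refine ⟨L + 2 * (Cz * D) + A, by positivity,
    fun u₀ h hdot hh hE u η ξ hs t ht x hx y hy => ?_⟩
  set t₀ := max (t - 1) 0 with ht₀
  have h00 : 0 ≤ t₀ := le_max_right _ _
  have h01 : t₀ < t := max_lt (by linarith) ht
  have hlen : t ≤ t₀ + 1 := by linarith [le_max_left (t - 1) 0]
  have hu := hs.continuousOn_Icc (t₁ := t) h00
  set E := (energy hdot).toReal with hEdef
  have hE0 : 0 ≤ E := ENNReal.toReal_nonneg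
  set g := source α f σ hdot u with hg
  obtain ⟨z, hzc, hzh, hzw⟩ := hCz t₀ t g (memLp_source α hF hh h00 h01.le hu)
  have huB : ∀ x ∈ Icc (0 : ℝ) 1, ∀ s ∈ Icc t₀ t, |u x s| ≤ B := fun x hx s hs' =>
    hB x hx _ (hs.between x hx s (h00.trans hs'.1)).1 (hs.between x hx s (h00.trans hs'.1)).2
  have hgle : √(∫ p in Icc 0 1 ×ˢ Icc t₀ t, g p ^ 2) ≤ D * (1 + E) := by
    refine Real.sqrt_le_iff.2 ⟨by positivity, ?_⟩
    have h1 := integral_source_sq_le (α := α) hF hh h00 h01.le hlen hu hE hM huB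
    have h2 : 3 * M ^ 2 ≤ D := by
      have : 0 ≤ α ^ 2 * B ^ 2 := by positivity
      linarith
    have h3 : 1 ≤ D * (1 + E) := by nlinarith
    have h4 : 3 * M ^ 2 * E ≤ D * E := mul_le_mul_of_nonneg_right h2 hE0
    refine h1.trans ?_
    nlinarith
  set m := Cz * D * (1 + E) with hm
  have hm0 : 0 ≤ m := by positivity
  have hz : ∀ a b s, |z (a, s) - z (b, s)| ≤ m * |a - b| ^ γ := fun a b s => by
    refine (hzh a b s).trans (mul_le_mul_of_nonneg_right ?_ (Real.rpow_nonneg (abs_nonneg _) _))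
    rw [hm, mul_assoc]
    exact mul_le_mul_of_nonneg_left hgle hCz0
  have hobs := hs.isObstacleSolution hK hF hh h00 h01 hzc hzw
  have key : ∀ a ∈ Icc (0 : ℝ) 1, ∀ b ∈ Icc (0 : ℝ) 1, u a t - u b t ≤
      (L + 2 * m + A * (t - t₀) ^ (-(1 / 2) : ℝ)) * |a - b| ^ γ := by
    intro a ha b hb
    -- The modulus of the obstacles is `L` from the walls plus `m` from `z`, and `2 B` bounds the
    -- oscillation of `u`. Adding `z` back costs a second `m`.
    have H := hobs.sub_le hlen (M := L + m) (N := 2 * B) hγ0 (by linarith) (by positivity)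
      (fun a ha b hb s _ => ?_) (fun a ha b hb s _ => ?_) (fun a ha b hb s hs' => ?_)
      ha hb ⟨h01, le_rfl⟩
    · rw [clip_of_mem ha, clip_of_mem hb, clip_of_mem ⟨h01.le, le_rfl⟩] at H
      have := (abs_le.1 (hz a b t)).2
      rw [← hA] at H
      linarith
    · rw [clip_of_mem ha, clip_of_mem hb]
      have h1 := (abs_le.1 (hL γ hγ0 (by linarith) a ha b hb).1).2
      have h2 := (abs_le.1 (hz a b s)).1
      linarith
    · rw [clip_of_mem ha, clip_of_mem hb]
      have h1 := (abs_le.1 (hL γ hγ0 (by linarith) a ha b hb).2).2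
      have h2 := (abs_le.1 (hz a b s)).1
      linarith
    · rw [clip_of_mem ha, clip_of_mem hb, clip_of_mem hs']
      have h1 := (abs_le.1 (huB a ha s hs')).2
      have h2 := (abs_le.1 (huB b hb s hs')).1
      have h3 := (abs_le.1 (hz a b s)).1
      have h4 : 0 ≤ L * |a - b| ^ γ := mul_nonneg hL0 (Real.rpow_nonneg (abs_nonneg _) _)
      linarith
  have hcoef : L + 2 * m + A * (t - t₀) ^ (-(1 / 2) : ℝ) ≤
      (L + 2 * (Cz * D) + A) * (1 + 1 / √t) * (1 + E) := by
    have h1 := mul_le_mul_of_nonneg_left (rpow_neg_half_min_le ht) hA0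
    have hT : 1 ≤ 1 + 1 / √t := le_add_of_nonneg_right (by positivity)
    set T := 1 + 1 / √t
    have hCD : 0 ≤ Cz * D := by positivity
    have hTE : 1 ≤ T * (1 + E) := by nlinarith
    have e1 : L ≤ L * (T * (1 + E)) := le_mul_of_one_le_right hL0 hTE
    have e2 : Cz * D * (1 + E) ≤ Cz * D * (T * (1 + E)) :=
      mul_le_mul_of_nonneg_left (le_mul_of_one_le_left (by positivity) hT) hCD
    have e3 : A * T ≤ A * (T * (1 + E)) :=
      mul_le_mul_of_nonneg_left (le_mul_of_one_le_right (by positivity) (by linarith)) hA0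
    rw [hm]
    linarith
  have hr0 : 0 ≤ |x - y| ^ γ := Real.rpow_nonneg (abs_nonneg _) _
  refine le_trans ?_ (mul_le_mul_of_nonneg_right hcoef hr0)
  have k1 := key x hx y hy
  have k2 := key y hy x hx
  rw [abs_sub_comm y x] at k2
  exact abs_le.2 ⟨by linarith, k1⟩

theorem holderNorm_le {γ : ℝ≥0} {v : ℝ → ℝ} {B R : ℝ} (hR : 0 ≤ R)
    (hB : ∀ x ∈ Icc (0 : ℝ) 1, |v x| ≤ B)
    (hv : ∀ x ∈ Icc (0 : ℝ) 1, ∀ y ∈ Icc (0 : ℝ) 1, |v x - v y| ≤ R * |x - y| ^ (γ : ℝ)) :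
    holderNorm γ v ≤ ENNReal.ofReal B + ENNReal.ofReal R := by
  refine add_le_add (iSup_le fun x => ?_) ?_
  · rw [← ofReal_norm]
    exact ENNReal.ofReal_le_ofReal (hB x x.2)
  · refine HolderWith.eHolderNorm_le (C := R.toNNReal) fun x y => ?_
    rw [edist_dist, edist_dist, ENNReal.ofReal_rpow_of_nonneg dist_nonneg γ.coe_nonneg]
    change _ ≤ ENNReal.ofReal R * _
    rw [← ENNReal.ofReal_mul hR]
    exact ENNReal.ofReal_le_ofReal (hv x x.2 y y.2)

end ReflectedPDE

theorem proposition4p1 (α : ℝ) (K₁ K₂ : ℝ → ℝ) (hK : ReflectedPDE.Walls K₁ K₂)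
    (f σ : ℝ → ℝ → ℝ) (hF : ReflectedPDE.F1 f σ)
    (γ : ℝ≥0) (hγ0 : 0 < γ) (hγ : γ < 1 / 2) :
    ∃ C : ℝ≥0, ∀ u₀ : ℝ → ℝ, ContinuousOn u₀ (Icc 0 1) →
      (∀ x ∈ Icc (0 : ℝ) 1, K₁ x ≤ u₀ x ∧ u₀ x ≤ K₂ x) →
      ∀ h hdot : ℝ → ℝ → ℝ, ReflectedPDE.CameronMartin h hdot →
      ∀ (u : ℝ → ℝ → ℝ) (η ξ : Measure (ℝ × ℝ)),
        ReflectedPDE.IsSkeletonSolution α K₁ K₂ f σ u₀ hdot u η ξ →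
        ∀ t : ℝ, 0 < t →
          ReflectedPDE.holderNorm γ (fun x => u x t) ≤
            C * ENNReal.ofReal (1 + 1 / √t) * (1 + ReflectedPDE.energy hdot) := by
  have hγ' : (γ : ℝ) < 1 / 2 := by
    have : ((γ : ℝ≥0) : ℝ) < ((1 / 2 : ℝ≥0) : ℝ) := by exact_mod_cast hγ
    simpa using this
  obtain ⟨C, hC0, hC⟩ := ReflectedPDE.exists_holder_seminorm_bound (α := α) hK hF
    (γ := γ) (by exact_mod_cast hγ0) hγ'
  obtain ⟨B, hB0, hB⟩ := hK.exists_bound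
  -- `B` serves the supremum norm and `C` the seminorm. The summand `1` keeps the constant nonzero,
  -- so that for infinite energy the right-hand side is `∞` and not `0 * ∞ = 0`.
  refine ⟨(B + C + 1).toNNReal, fun u₀ _ _ h hdot hh u η ξ hs t ht => ?_⟩
  have hT : 1 ≤ 1 + 1 / √t := le_add_of_nonneg_right (by positivity)
  by_cases hE : ReflectedPDE.energy hdot = ⊤
  · have h1 : ((B + C + 1).toNNReal : ℝ≥0∞) * ENNReal.ofReal (1 + 1 / √t) ≠ 0 := by
      refine mul_ne_zero ?_ (by
        rw [Ne, ENNReal.ofReal_eq_zero, not_le]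
        linarith)
      rw [Ne, ENNReal.coe_eq_zero, Real.toNNReal_eq_zero, not_le]
      linarith
    rw [hE, add_top, ENNReal.mul_top h1]
    exact le_top
  · set E := (ReflectedPDE.energy hdot).toReal with hEdef
    have hE0 : 0 ≤ E := ENNReal.toReal_nonneg
    set T := 1 + 1 / √t with hTdef
    have hle := ReflectedPDE.holderNorm_le (γ := γ) (v := fun x => u x t) (B := B)
      (R := C * T * (1 + E)) (by positivity)
      (fun x hx => hB x hx _ (hs.between x hx t ht.le).1 (hs.between x hx t ht.le).2)
      (fun x hx y hy => hC u₀ h hdot hh hE u η ξ hs t ht x hx y hy)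
    refine hle.trans ?_
    have e : (1 : ℝ≥0∞) + ReflectedPDE.energy hdot = ENNReal.ofReal (1 + E) := by
      rw [ENNReal.ofReal_add zero_le_one hE0, ENNReal.ofReal_one, ENNReal.ofReal_toReal hE]
    rw [e]
    change _ ≤ ENNReal.ofReal (B + C + 1) * _ * _
    rw [← ENNReal.ofReal_mul (by positivity), ← ENNReal.ofReal_mul (by positivity),
      ← ENNReal.ofReal_add hB0 (by positivity)]
    refine ENNReal.ofReal_le_ofReal ?_
    have hTE : 1 ≤ T * (1 + E) := by nlinarith
    nlinarith [mul_le_mul_of_nonneg_left hTE hB0]
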